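/- Let $\mathcal{M}$ be a combinatorial closed symmetric monoidal model category (a complete, locally presentable, cofibrantly generated model category satisfying the pushout-product axiom). Let $\mathrm{Alg}(\mathcal{M})$ be the category of associative unital algebra objects of $\mathcal{M}$, and for an algebra $R$ let $\mathrm{LMod}(R)$ and $\mathrm{RMod}(R)$ be its categories of left and right modules. On each of these categories call a map a weak equivalence (resp. fibration) if its underlying map in $\mathcal{M}$ is one, and a cofibration if it has the left lifting property against all maps that are both fibrations and weak equivalences. A left $R$-module $N$ is *flat* if $(-)\otimes_R N$ takes weak equivalences of right $R$-modules to weak equivalences in $\mathcal{M}$; flat right modules are defined symmetrically. A map $g$ of right (resp. left) $R$-modules is a *flat equivalence* if $g\otimes_R O$ (resp. $O\otimes_R g$) is a weak equivalence in $\mathcal{M}$ for every left (resp. right) $R$-module $O$. Assume that $\mathcal{M}$ satisfies the Schwede–Shipley assumptions: * (monoid axiom) every map in the smallest class of maps of $\mathcal{M}$ that is closed under pushouts, transfinite compositions and retracts and contains all $f\otimes X$, with $f$ a trivial cofibration and $X\in\mathcal{M}$, is a weak equivalence; * for every algebra $R$, every cofibrant left or right $R$-module is flat. Then the following hold. 1.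 The classes above are model structures on $\mathrm{Alg}(\mathcal{M})$, on every $\mathrm{LMod}(R)$ and on every $\mathrm{RMod}(R)$, and for each map of algebras $f:R\to S$ the adjunctions $f_!\dashv f^*$ between extension of scalars ($S\otimes_R(-)$, resp. $(-)\otimes_R S$) and restriction of scalars are Quillen adjunctions. Thus $R\mapsto \mathrm{LMod}(R)$ and $R\mapsto\mathrm{RMod}(R)$ are (pseudo)functors $\mathrm{Alg}(\mathcal{M})\to\mathrm{ModCat}$ to model categories and Quillen adjunctions. 2. For every trivial cofibration $R\to S$ in $\mathrm{Alg}(\mathcal{M})$, the map $R\to S$ is a flat equivalence both as a map of right $R$-modules and as a map of left $R$-modules. 3. Both functors are proper: for every trivial cofibration $f$ in $\mathrm{Alg}(\mathcal{M})$ the functor $f_!$ preserves all weak equivalences, and for every trivial fibration $f$ the functor $f^*$ preserves all weak equivalences. 4. Let $\mathcal{F}$ be $\mathrm{LMod}$ or $\mathrm{RMod}$. In the Grothendieck construction $\int_{R\in\mathrm{Alg}(\mathcal{M})}\mathcal{F}(R)$, call a map $(f,\varphi):(R,X)\to(S,Y)$, with $\varphi:f_!X\to Y$ and adjoint $\varphi^{\mathrm{ad}}:X\to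 f^*Y$, a weak equivalence if $f$ is a weak equivalence and the composite $f_!(X^{\mathrm{cof}})\to f_!X\to Y$ is a weak equivalence for a cofibrant replacement $X^{\mathrm{cof}}\to X$; a fibration if $f$ and $\varphi^{\mathrm{ad}}$ are fibrations; a cofibration if $f$ and $\varphi$ are cofibrations. These classes form a model structure, and with it the projection $\pi:\int_{R\in\mathrm{Alg}(\mathcal{M})}\mathcal{F}(R)\to\mathrm{Alg}(\mathcal{M})$ is a model fibration. Here a model category is complete and cocomplete and has functorial factorizations. A functor $\pi:\mathcal{N}\to\mathcal{B}$ between categories with classes $\mathcal{W},\mathcal{C}of,\mathcal{F}ib$ closed under composition and containing the identities is a *model fibration* if: * $\pi$ has all small relative colimits and limits: for a small diagram $\delta$ in $\mathcal{N}$ and a cocone (resp. cone) on $\pi\delta$, there is an initial (resp. terminal) lift to a cocone (resp. cone) on $\delta$; * if two of $f,g,gf$ are in $\mathcal{W}_{\mathcal{N}}$ and $\pi$ sends the third into $\mathcal{W}_{\mathcal{B}}$, then the third is in $\mathcal{W}_{\mathcal{N}}$; * for $(L,R)=(\mathcal{C}of\cap\mathcal{W},\mathcal{F}ib)$ and for $(L,R)=(\mathcal{C}of,\mathcal{F}ib\cap\mathcal{W})$: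 $\pi$ preserves $L$ and $R$; a retract $f$ of a map in $L_{\mathcal{N}}$ (resp. $R_{\mathcal{N}}$) with $\pi f\in L_{\mathcal{B}}$ (resp. $R_{\mathcal{B}}$) lies in $L_{\mathcal{N}}$ (resp. $R_{\mathcal{N}}$); every factorization $\pi\varphi=gh$ with $h\in L_{\mathcal{B}}$, $g\in R_{\mathcal{B}}$ lifts to a factorization of $\varphi$ into a map in $L_{\mathcal{N}}$ followed by a map in $R_{\mathcal{N}}$; and for every commutative square in $\mathcal{N}$ with left side in $L_{\mathcal{N}}$ and right side in $R_{\mathcal{N}}$, every diagonal filler of its image in $\mathcal{B}$ lifts to a diagonal filler in $\mathcal{N}$; * $\pi$ is a Cartesian and a coCartesian fibration; * a coCartesian map $f:X\to Y$ with $\pi f\in\mathcal{W}_{\mathcal{B}}$ is in $\mathcal{W}_{\mathcal{N}}$ if $X$ is $\pi$-cofibrant (the map to $X$ from the initial object of its fibre is in $\mathcal{C}of_{\mathcal{N}}$), and a Cartesian map $f:X\to Y$ with $\pi f\in\mathcal{W}_{\mathcal{B}}$ is in $\mathcal{W}_{\mathcal{N}}$ if $Y$ is $\pi$-fibrant (the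 map from $Y$ to the terminal object of its fibre is in $\mathcal{F}ib_{\mathcal{N}}$). -/

import Mathlib

open CategoryTheory MonoidalCategory Limits MonObj Opposite HomotopicalAlgebra
universe w v u v₁ u₁ v₂ u₂
namespace ModFib
noncomputable section

section Modules
variable {C : Type u} [Category.{v} C] [MonoidalCategory C]

/-- Left modules over an algebra object. -/
abbrev LMod (R : Mon C) := Mod C R.X

section
variable {R : Mon C}

/-- The action map of a left module. -/
def lact (M : LMod R) : R.X ⊗ M.X ⟶ M.X := γ[R.X, M.X]

@[simp]
lemma one_lact (M : LMod R) : η[R.X] ▷ M.X ≫ lact M = (λ_ M.X).hom :=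
  ModObj.one_smul_self R.X M.X

@[simp]
lemma one_lact_assoc (M : LMod R) {T : C} (w : _ ⟶ T) :
    η[R.X] ▷ M.X ≫ lact M ≫ w =
      (λ_ M.X).hom ≫ w :=
  (reassoc_of% (one_lact M)) w

lemma mul_lact (M : LMod R) : μ[R.X] ▷ M.X ≫ lact M =
    (α_ R.X R.X M.X).hom ≫ R.X ◁ lact M ≫ lact M :=
  ModObj.mul_smul_self R.X M.X

lemma mul_lact_assoc (M : LMod R) {T : C} (w : _ ⟶ T) :
    μ[R.X] ▷ M.X ≫ lact M ≫ w =
      (α_ R.X R.X M.X).hom ≫ R.X ◁ lact M ≫ lact M ≫ w :=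
  (reassoc_of% (mul_lact M)) w

lemma lact_hom {M N : LMod R} (g : M ⟶ N) : lact M ≫ g.hom = R.X ◁ g.hom ≫ lact N :=
  IsModHom.smul_hom (A := R.X) (f := g.hom)

lemma lact_hom_assoc {M N : LMod R} (g : M ⟶ N) {T : C} (w : _ ⟶ T) :
    lact M ≫ g.hom ≫ w =
      R.X ◁ g.hom ≫ lact N ≫ w :=
  (reassoc_of% (lact_hom g)) w

end

/-- A right module over an algebra object. -/
structure RMod (R : Mon C) where
  X : C
  act : X ⊗ R.X ⟶ X
  act_one : X ◁ η[R.X] ≫ act = (ρ_ X).hom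
  act_mul : X ◁ μ[R.X] ≫ act = (α_ X R.X R.X).inv ≫ act ▷ R.X ≫ act

namespace RMod

attribute [simp] act_one act_mul

@[simp]
lemma act_one_assoc {R : Mon C} (M : RMod R) {Z : C} (w : M.X ⟶ Z) :
    M.X ◁ η[R.X] ≫ M.act ≫ w = (ρ_ M.X).hom ≫ w :=
  (reassoc_of% M.act_one) w

@[simp]
lemma act_mul_assoc {R : Mon C} (M : RMod R) {Z : C} (w : M.X ⟶ Z) :
    M.X ◁ μ[R.X] ≫ M.act ≫ w = (α_ M.X R.X R.X).inv ≫ M.act ▷ R.X ≫ M.act ≫ w :=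
  (reassoc_of% M.act_mul) w

@[ext]
structure Hom {R : Mon C} (M N : RMod R) where
  hom : M.X ⟶ N.X
  act_hom : M.act ≫ hom = hom ▷ R.X ≫ N.act

attribute [simp] Hom.act_hom

@[simp]
lemma Hom.act_hom_assoc {R : Mon C} {M N : RMod R} (g : Hom M N) {Z : C} (w : N.X ⟶ Z) :
    M.act ≫ g.hom ≫ w = g.hom ▷ R.X ≫ N.act ≫ w :=
  (reassoc_of% g.act_hom) w

instance (R : Mon C) : Category (RMod R) where
  Hom M N := Hom M N
  id M := { hom := 𝟙 M.X, act_hom := by simp }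
  comp f g := { hom := f.hom ≫ g.hom, act_hom := by simp }

variable {R : Mon C}

@[ext]
lemma hom_ext {M N : RMod R} (f g : M ⟶ N) (h : f.hom = g.hom) : f = g := Hom.ext h

@[simp] lemma id_hom (M : RMod R) : Hom.hom (𝟙 M) = 𝟙 M.X := rfl
@[simp] lemma comp_hom {M N P : RMod R} (f : M ⟶ N) (g : N ⟶ P) :
    Hom.hom (f ≫ g) = f.hom ≫ g.hom := rfl

variable (R) in
@[simps] def forget : RMod R ⥤ C where
  obj M := M.X
  map f := f.hom

variable (R) in
/-- The algebra `R` as a right module over itself. -/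
@[simps] def regular : RMod R where
  X := R.X
  act := μ
  act_one := by simp
  act_mul := by simp

/-- Restriction of scalars along `f`. -/
@[simps] def res {R S : Mon C} (f : R ⟶ S) : RMod S ⥤ RMod R where
  obj M :=
    { X := M.X
      act := M.X ◁ f.hom ≫ M.act
      act_one := by simp [← MonoidalCategory.whiskerLeft_comp_assoc]
      act_mul := by
        simp only [← MonoidalCategory.whiskerLeft_comp_assoc, IsMonHom.mul_hom]
        rw [MonoidalCategory.tensorHom_def]
        simp only [MonoidalCategory.whiskerLeft_comp, Category.assoc, RMod.act_mul,
          comp_whiskerRight, whisker_assoc, Iso.inv_hom_id_assoc]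
        rw [associator_inv_naturality_right_assoc, whisker_exchange_assoc] }
  map g := { hom := g.hom, act_hom := by simp [whisker_exchange_assoc] }

end RMod

/-- The right `R`-module `S_{/R}` underlying an algebra `S` under `R`. -/
abbrev algRight {R S : Mon C} (f : R ⟶ S) : RMod R := (RMod.res f).obj (RMod.regular S)

/-- The left `R`-module `S_{R/}` underlying an algebra `S` under `R`. -/
abbrev algLeft {R S : Mon C} (f : R ⟶ S) : LMod R := (Mod.comap f.hom).obj (Mod.regular S.X)

abbrev resL {R S : Mon C} (f : R ⟶ S) : LMod S ⥤ LMod R := Mod.comap f.hom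

abbrev resR {R S : Mon C} (f : R ⟶ S) : RMod S ⥤ RMod R := RMod.res f

lemma eqToHom_homL {R : Mon C} {M N : LMod R} (h : M = N) :
    (eqToHom h).hom = eqToHom (congrArg Mod.X h) := by
  subst h; rfl

lemma eqToHom_homR {R : Mon C} {M N : RMod R} (h : M = N) :
    RMod.Hom.hom (eqToHom h) = eqToHom (congrArg RMod.X h) := by
  subst h; rfl

def resLId (R : Mon C) : resL (𝟙 R) ≅ 𝟭 (LMod R) :=
  NatIso.ofComponents (fun M ↦
    { hom := Mod.Hom.mk' (M := (resL (𝟙 R)).obj M) (N := M) (𝟙 M.X) (by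
        change (𝟙 R.X ▷ M.X ≫ lact M) ≫ 𝟙 _ = R.X ◁ 𝟙 M.X ≫ lact M
        simp)
      inv := Mod.Hom.mk' (M := M) (N := (resL (𝟙 R)).obj M) (𝟙 M.X) (by
        change lact M ≫ 𝟙 _ = R.X ◁ 𝟙 M.X ≫ 𝟙 R.X ▷ M.X ≫ lact M
        simp)
      hom_inv_id := Mod.hom_ext _ _ (Category.comp_id _)
      inv_hom_id := Mod.hom_ext _ _ (Category.comp_id _) })
    (fun g ↦ Mod.hom_ext _ _ ((Category.comp_id _).trans (Category.id_comp _).symm))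

def resLComp {R S T : Mon C} (f : R ⟶ S) (g : S ⟶ T) : resL (f ≫ g) ≅ resL g ⋙ resL f :=
  NatIso.ofComponents (fun M ↦
    { hom := Mod.Hom.mk' (M := (resL (f ≫ g)).obj M) (N := (resL g ⋙ resL f).obj M) (𝟙 M.X) (by
        change ((f.hom ≫ g.hom) ▷ M.X ≫ lact M) ≫ 𝟙 _ =
          R.X ◁ 𝟙 M.X ≫ f.hom ▷ M.X ≫ g.hom ▷ M.X ≫ lact M
        simp)
      inv := Mod.Hom.mk' (M := (resL g ⋙ resL f).obj M) (N := (resL (f ≫ g)).obj M) (𝟙 M.X) (by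
        change (f.hom ▷ M.X ≫ g.hom ▷ M.X ≫ lact M) ≫ 𝟙 _ =
          R.X ◁ 𝟙 M.X ≫ (f.hom ≫ g.hom) ▷ M.X ≫ lact M
        simp)
      hom_inv_id := Mod.hom_ext _ _ (Category.comp_id _)
      inv_hom_id := Mod.hom_ext _ _ (Category.comp_id _) })
    (fun g ↦ Mod.hom_ext _ _ ((Category.comp_id _).trans (Category.id_comp _).symm))

def resRId (R : Mon C) : resR (𝟙 R) ≅ 𝟭 (RMod R) :=
  NatIso.ofComponents (fun M ↦
    { hom := RMod.Hom.mk (M := (resR (𝟙 R)).obj M) (N := M) (𝟙 M.X) (by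
        change (M.X ◁ 𝟙 R.X ≫ M.act) ≫ 𝟙 _ = 𝟙 M.X ▷ R.X ≫ M.act
        simp)
      inv := RMod.Hom.mk (M := M) (N := (resR (𝟙 R)).obj M) (𝟙 M.X) (by
        change M.act ≫ 𝟙 _ = 𝟙 M.X ▷ R.X ≫ M.X ◁ 𝟙 R.X ≫ M.act
        simp)
      hom_inv_id := RMod.hom_ext _ _ (Category.comp_id _)
      inv_hom_id := RMod.hom_ext _ _ (Category.comp_id _) })
    (fun g ↦ RMod.hom_ext _ _ ((Category.comp_id _).trans (Category.id_comp _).symm))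

def resRComp {R S T : Mon C} (f : R ⟶ S) (g : S ⟶ T) : resR (f ≫ g) ≅ resR g ⋙ resR f :=
  NatIso.ofComponents (fun M ↦
    { hom := RMod.Hom.mk (M := (resR (f ≫ g)).obj M) (N := (resR g ⋙ resR f).obj M) (𝟙 M.X) (by
        change (M.X ◁ (f.hom ≫ g.hom) ≫ M.act) ≫ 𝟙 _ =
          𝟙 M.X ▷ R.X ≫ M.X ◁ f.hom ≫ M.X ◁ g.hom ≫ M.act
        simp)
      inv := RMod.Hom.mk (M := (resR g ⋙ resR f).obj M) (N := (resR (f ≫ g)).obj M) (𝟙 M.X) (by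
        change (M.X ◁ f.hom ≫ M.X ◁ g.hom ≫ M.act) ≫ 𝟙 _ =
          𝟙 M.X ▷ R.X ≫ M.X ◁ (f.hom ≫ g.hom) ≫ M.act
        simp)
      hom_inv_id := RMod.hom_ext _ _ (Category.comp_id _)
      inv_hom_id := RMod.hom_ext _ _ (Category.comp_id _) })
    (fun g ↦ RMod.hom_ext _ _ ((Category.comp_id _).trans (Category.id_comp _).symm))

/-- A map of algebras `f : R ⟶ S`, seen as a map of right `R`-modules. -/
def hRight {R S : Mon C} (f : R ⟶ S) : RMod.regular R ⟶ algRight f :=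
  RMod.Hom.mk (M := RMod.regular R) (N := algRight f) f.hom (by
    change μ ≫ f.hom = f.hom ▷ R.X ≫ S.X ◁ f.hom ≫ μ
    rw [IsMonHom.mul_hom, MonoidalCategory.tensorHom_def, Category.assoc])

/-- A map of algebras `f : R ⟶ S`, seen as a map of left `R`-modules. -/
def hLeft {R S : Mon C} (f : R ⟶ S) : Mod.regular R.X ⟶ algLeft f :=
  Mod.Hom.mk' (M := Mod.regular R.X) (N := algLeft f) f.hom (by
    change μ ≫ f.hom = R.X ◁ f.hom ≫ f.hom ▷ S.X ≫ μ
    rw [IsMonHom.mul_hom, tensorHom_def', Category.assoc])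

lemma whiskerLeft_unit_mul (S : Mon C) (X : C) :
    S.X ◁ (λ_ X).inv ≫ S.X ◁ η[S.X] ▷ X ≫ (α_ S.X S.X X).inv ≫ μ[S.X] ▷ X = 𝟙 _ := by
  rw [associator_inv_naturality_middle_assoc, ← comp_whiskerRight, MonObj.mul_one]
  simp

lemma unit_condition {R S : Mon C} (f : R ⟶ S) (M : LMod R) : (λ_ (R.X ⊗ M.X)).inv ≫ η[S.X] ▷ (R.X ⊗ M.X) ≫ (α_ S.X R.X M.X).inv ≫
    (S.X ◁ f.hom) ▷ M.X ≫ μ[S.X] ▷ M.X = f.hom ▷ M.X := by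
  rw [associator_inv_naturality_left_assoc, ← comp_whiskerRight_assoc, ← whisker_exchange,
    comp_whiskerRight_assoc, ← comp_whiskerRight, MonObj.one_mul, ← comp_whiskerRight,
    leftUnitor_naturality]
  simp

lemma whiskerRight_unit_mul (S : Mon C) (X : C) :
    (ρ_ X).inv ▷ S.X ≫ (X ◁ η[S.X]) ▷ S.X ≫ (α_ X S.X S.X).hom ≫ X ◁ μ[S.X] = 𝟙 _ := by
  rw [associator_naturality_middle_assoc, ← MonoidalCategory.whiskerLeft_comp, MonObj.one_mul]
  simp

lemma unit_condition_right {R S : Mon C} (f : R ⟶ S) (M : RMod R) :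
    (ρ_ (M.X ⊗ R.X)).inv ≫ (M.X ⊗ R.X) ◁ η[S.X] ≫ (α_ M.X R.X S.X).hom ≫
      M.X ◁ f.hom ▷ S.X ≫ M.X ◁ μ[S.X] = M.X ◁ f.hom := by
  rw [associator_naturality_right_assoc, ← MonoidalCategory.whiskerLeft_comp_assoc,
    whisker_exchange, MonoidalCategory.whiskerLeft_comp_assoc,
    ← MonoidalCategory.whiskerLeft_comp, MonObj.mul_one, ← MonoidalCategory.whiskerLeft_comp,
    rightUnitor_naturality]
  simp

section Tensor
variable [HasCoequalizers C]

/-- `M ⊗_R N`: the coequalizer of the two maps `M ⊗ R ⊗ N ⟶ M ⊗ N`. -/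
def relTensor {R : Mon C} (M : RMod R) (N : LMod R) : C :=
  coequalizer (M.act ▷ N.X) ((α_ M.X R.X N.X).hom ≫ M.X ◁ lact N)

namespace relTensor
variable {R : Mon C} 

def π (M : RMod R) (N : LMod R) : M.X ⊗ N.X ⟶ relTensor M N := coequalizer.π _ _

lemma condition (M : RMod R) (N : LMod R) :
    M.act ▷ N.X ≫ π M N = (α_ M.X R.X N.X).hom ≫ M.X ◁ lact N ≫ π M N := by
  have := coequalizer.condition (M.act ▷ N.X) ((α_ M.X R.X N.X).hom ≫ M.X ◁ lact N)
  rwa [Category.assoc] at this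

lemma condition_assoc (M : RMod R) (N : LMod R) {T : C} (w : _ ⟶ T) :
    M.act ▷ N.X ≫ π M N ≫ w =
      (α_ M.X R.X N.X).hom ≫ M.X ◁ lact N ≫ π M N ≫ w :=
  (reassoc_of% (condition M N)) w

def desc {M : RMod R} {N : LMod R} {Z : C} (k : M.X ⊗ N.X ⟶ Z)
    (h : M.act ▷ N.X ≫ k = (α_ M.X R.X N.X).hom ≫ M.X ◁ lact N ≫ k) :
    relTensor M N ⟶ Z :=
  coequalizer.desc k (by simpa using h)

@[simp]
lemma π_desc {M : RMod R} {N : LMod R} {Z : C} (k : M.X ⊗ N.X ⟶ Z) (h) :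
    π M N ≫ desc k h = k := coequalizer.π_desc _ _

@[ext]
lemma hom_ext {M : RMod R} {N : LMod R} {Z : C} {a b : relTensor M N ⟶ Z}
    (h : π M N ≫ a = π M N ≫ b) : a = b := coequalizer.hom_ext h

/-- The map `g ⊗_R h`. -/
def map {M M' : RMod R} {N N' : LMod R} (g : M ⟶ M') (h : N ⟶ N') :
    relTensor M N ⟶ relTensor M' N' :=
  desc (g.hom ▷ N.X ≫ M'.X ◁ h.hom ≫ π M' N') (by
    have h₁ := lact_hom h
    rw [← comp_whiskerRight_assoc, g.act_hom, comp_whiskerRight_assoc, ← whisker_exchange_assoc,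
      condition, whisker_exchange_assoc, ← MonoidalCategory.whiskerLeft_comp_assoc, h₁]
    simp)

@[simp]
lemma π_map {M M' : RMod R} {N N' : LMod R} (g : M ⟶ M') (h : N ⟶ N') :
    π M N ≫ map g h = g.hom ▷ N.X ≫ M'.X ◁ h.hom ≫ π M' N' := π_desc _ _

@[simp]
lemma π_map_assoc {M M' : RMod R} {N N' : LMod R} (g : M ⟶ M') (h : N ⟶ N') {T : C} (w : _ ⟶ T) :
    π M N ≫ map g h ≫ w =
      g.hom ▷ N.X ≫ M'.X ◁ h.hom ≫ π M' N' ≫ w :=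
  (reassoc_of% (π_map g h)) w

section Left
variable [∀ X : C, PreservesColimitsOfSize.{0, 0} (tensorLeft X)]

lemma whiskerLeft_hom_ext {M : RMod R} {N : LMod R} {W Z : C} {a b : W ⊗ relTensor M N ⟶ Z}
    (h : W ◁ π M N ≫ a = W ◁ π M N ≫ b) : a = b :=
  (cancel_epi ((tensorLeft W).map (coequalizer.π (M.act ▷ N.X)
    ((α_ M.X R.X N.X).hom ≫ M.X ◁ lact N)))).1 h

def whiskerLeftDesc {M : RMod R} {N : LMod R} {W Z : C} (k : W ⊗ M.X ⊗ N.X ⟶ Z)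
    (h : W ◁ M.act ▷ N.X ≫ k = W ◁ (α_ M.X R.X N.X).hom ≫ W ◁ M.X ◁ lact N ≫ k) :
    W ⊗ relTensor M N ⟶ Z :=
  (PreservesCoequalizer.iso (tensorLeft W) _ _).inv ≫ coequalizer.desc k (by simpa using h)

@[simp]
lemma π_whiskerLeftDesc {M : RMod R} {N : LMod R} {W Z : C} (k : W ⊗ M.X ⊗ N.X ⟶ Z) (h) :
    W ◁ π M N ≫ whiskerLeftDesc k h = k :=
  id_tensor_π_preserves_coequalizer_inv_desc _ _ _ _

end Left
section Right
variable [∀ X : C, PreservesColimitsOfSize.{0, 0} (tensorRight X)]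

lemma whiskerRight_hom_ext {M : RMod R} {N : LMod R} {W Z : C} {a b : relTensor M N ⊗ W ⟶ Z}
    (h : π M N ▷ W ≫ a = π M N ▷ W ≫ b) : a = b :=
  (cancel_epi ((tensorRight W).map (coequalizer.π (M.act ▷ N.X)
    ((α_ M.X R.X N.X).hom ≫ M.X ◁ lact N)))).1 h

def whiskerRightDesc {M : RMod R} {N : LMod R} {W Z : C} (k : (M.X ⊗ N.X) ⊗ W ⟶ Z)
    (h : M.act ▷ N.X ▷ W ≫ k = (α_ M.X R.X N.X).hom ▷ W ≫ (M.X ◁ lact N) ▷ W ≫ k) :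
    relTensor M N ⊗ W ⟶ Z :=
  (PreservesCoequalizer.iso (tensorRight W) _ _).inv ≫ coequalizer.desc k (by simpa using h)

@[simp]
lemma π_whiskerRightDesc {M : RMod R} {N : LMod R} {W Z : C} (k : (M.X ⊗ N.X) ⊗ W ⟶ Z) (h) :
    π M N ▷ W ≫ whiskerRightDesc k h = k :=
  π_tensor_id_preserves_coequalizer_inv_desc _ _ _ _

end Right
end relTensor

section ExtL

/-- The object `S ⊗_R M`. -/
def extLX {R S : Mon C} (f : R ⟶ S) (M : LMod R) : C := relTensor (algRight f) M

namespace extLX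
variable {R S : Mon C} (f : R ⟶ S) (M : LMod R)

def π : S.X ⊗ M.X ⟶ extLX f M := relTensor.π (algRight f) M

variable {f M} in
def desc {Z : C} (k : S.X ⊗ M.X ⟶ Z)
    (h : (S.X ◁ f.hom) ▷ M.X ≫ μ[S.X] ▷ M.X ≫ k =
      (α_ S.X R.X M.X).hom ≫ S.X ◁ lact M ≫ k) : extLX f M ⟶ Z :=
  relTensor.desc (M := algRight f) (N := M) k (by
    rw [← comp_whiskerRight_assoc] at h
    exact h)

@[simp]
lemma π_desc {Z : C} (k : S.X ⊗ M.X ⟶ Z) (h) : π f M ≫ desc k h = k :=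
  relTensor.π_desc (M := algRight f) (N := M) _ _

variable {f M} in
lemma hom_ext {Z : C} {a b : extLX f M ⟶ Z} (h : π f M ≫ a = π f M ≫ b) : a = b :=
  relTensor.hom_ext h

variable {M} in
def map {N : LMod R} (g : M ⟶ N) : extLX f M ⟶ extLX f N := relTensor.map (𝟙 (algRight f)) g

@[simp]
lemma π_map {N : LMod R} (g : M ⟶ N) : π f M ≫ map f g = S.X ◁ g.hom ≫ π f N := by
  have := relTensor.π_map (𝟙 (algRight f)) g
  simp only [RMod.id_hom, id_whiskerRight, Category.id_comp] at this
  exact this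

@[simp]
lemma π_map_assoc {N : LMod R} (g : M ⟶ N) {T : C} (w : _ ⟶ T) :
    π f M ≫ map f g ≫ w =
      S.X ◁ g.hom ≫ π f N ≫ w :=
  (reassoc_of% (π_map f M g)) w

@[simp]
lemma whiskerLeft_π_map (W : C) {N : LMod R} (g : M ⟶ N) :
    W ◁ π f M ≫ W ◁ map f g = W ◁ S.X ◁ g.hom ≫ W ◁ π f N := by
  simp only [← MonoidalCategory.whiskerLeft_comp, π_map]

@[simp]
lemma whiskerLeft_π_map_assoc (W : C) {N : LMod R} (g : M ⟶ N) {T : C} (w : _ ⟶ T) :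
    W ◁ π f M ≫ W ◁ map f g ≫ w =
      W ◁ S.X ◁ g.hom ≫ W ◁ π f N ≫ w :=
  (reassoc_of% (whiskerLeft_π_map f M W g)) w

lemma condition : (S.X ◁ f.hom) ▷ M.X ≫ μ[S.X] ▷ M.X ≫ π f M =
      (α_ S.X R.X M.X).hom ≫ S.X ◁ lact M ≫ π f M := by
  have := relTensor.condition (algRight f) M
  rw [← comp_whiskerRight_assoc]
  exact this

lemma condition_assoc {T : C} (w : _ ⟶ T) :
    (S.X ◁ f.hom) ▷ M.X ≫ μ[S.X] ▷ M.X ≫ π f M ≫ w =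
      (α_ S.X R.X M.X).hom ≫ S.X ◁ lact M ≫ π f M ≫ w :=
  (reassoc_of% (condition f M)) w

variable [∀ X : C, PreservesColimitsOfSize.{0, 0} (tensorLeft X)]

variable {f M} in
def wdesc {W Z : C} (k : W ⊗ S.X ⊗ M.X ⟶ Z)
    (h : W ◁ (S.X ◁ f.hom) ▷ M.X ≫ W ◁ μ[S.X] ▷ M.X ≫ k =
      W ◁ (α_ S.X R.X M.X).hom ≫ W ◁ S.X ◁ lact M ≫ k) : W ⊗ extLX f M ⟶ Z :=
  relTensor.whiskerLeftDesc (M := algRight f) (N := M) k (by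
    rw [← MonoidalCategory.whiskerLeft_comp_assoc, ← comp_whiskerRight] at h
    exact h)

@[simp]
lemma π_wdesc {W Z : C} (k : W ⊗ S.X ⊗ M.X ⟶ Z) (h) : W ◁ π f M ≫ wdesc k h = k :=
  relTensor.π_whiskerLeftDesc (M := algRight f) (N := M) _ _

variable {f M} in
lemma whisker_hom_ext {W Z : C} {a b : W ⊗ extLX f M ⟶ Z}
    (h : W ◁ π f M ≫ a = W ◁ π f M ≫ b) : a = b :=
  relTensor.whiskerLeft_hom_ext (M := algRight f) (N := M) h

def smul : S.X ⊗ extLX f M ⟶ extLX f M :=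
  wdesc ((α_ S.X S.X M.X).inv ≫ μ[S.X] ▷ M.X ≫ π f M) (by
    have h₁ : S.X ◁ (S.X ◁ f.hom) ▷ M.X ≫ S.X ◁ μ[S.X] ▷ M.X ≫
        (α_ S.X S.X M.X).inv ≫ μ[S.X] ▷ M.X =
        S.X ◁ (α_ S.X R.X M.X).hom ≫ (α_ S.X S.X (R.X ⊗ M.X)).inv ≫ μ[S.X] ▷ (R.X ⊗ M.X) ≫
          (α_ S.X R.X M.X).inv ≫ (S.X ◁ f.hom) ▷ M.X ≫ μ[S.X] ▷ M.X := by
      rw [associator_inv_naturality_middle_assoc, ← comp_whiskerRight, MonObj.mul_assoc_flip,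
        associator_inv_naturality_middle_assoc, comp_whiskerRight, comp_whiskerRight,
        ← comp_whiskerRight_assoc, associator_inv_naturality_right, comp_whiskerRight_assoc,
        ← comp_whiskerRight_assoc _ (μ[S.X] ▷ S.X), whisker_exchange]
      simp
    rw [reassoc_of% h₁, condition, associator_inv_naturality_right_assoc, whisker_exchange_assoc]
    simp)

@[simp]
lemma whiskerLeft_π_smul :
    S.X ◁ π f M ≫ smul f M = (α_ S.X S.X M.X).inv ≫ μ[S.X] ▷ M.X ≫ π f M :=
  π_wdesc _ _ _ _

@[simp]
lemma whiskerLeft_π_smul_assoc {T : C} (w : _ ⟶ T) :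
    S.X ◁ π f M ≫ smul f M ≫ w =
      (α_ S.X S.X M.X).inv ≫ μ[S.X] ▷ M.X ≫ π f M ≫ w :=
  (reassoc_of% (whiskerLeft_π_smul f M)) w

lemma one_smul : η[S.X] ▷ extLX f M ≫ smul f M = (λ_ _).hom := by
  apply whisker_hom_ext
  rw [whisker_exchange_assoc, whiskerLeft_π_smul, leftUnitor_naturality]
  simp [← comp_whiskerRight_assoc]

lemma mul_smul : μ[S.X] ▷ extLX f M ≫ smul f M =
    (α_ _ _ _).hom ≫ S.X ◁ smul f M ≫ smul f M := by
  apply whisker_hom_ext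
  rw [whisker_exchange_assoc, whiskerLeft_π_smul, associator_naturality_right_assoc,
    ← MonoidalCategory.whiskerLeft_comp_assoc, whiskerLeft_π_smul]
  simp only [MonoidalCategory.whiskerLeft_comp, Category.assoc, whiskerLeft_π_smul]
  simp [← comp_whiskerRight_assoc]

lemma smul_map {N : LMod R} (g : M ⟶ N) : smul f M ≫ map f g = S.X ◁ map f g ≫ smul f N := by
  apply whisker_hom_ext
  rw [whiskerLeft_π_smul_assoc, whiskerLeft_π_map_assoc, whiskerLeft_π_smul, π_map,
    associator_inv_naturality_right_assoc, whisker_exchange_assoc]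

end extLX

section
variable [∀ X : C, PreservesColimitsOfSize.{0, 0} (tensorLeft X)]

def extLObj {R S : Mon C} (f : R ⟶ S) (M : LMod R) : LMod S :=
  letI : ModObj S.X (extLX f M) :=
    { smul := extLX.smul f M
      one_smul := extLX.one_smul f M
      mul_smul := extLX.mul_smul f M }
  ⟨extLX f M⟩

/-- Extension of scalars `S ⊗_R -` for left modules. -/
def extL {R S : Mon C} (f : R ⟶ S) : LMod R ⥤ LMod S where
  obj M := extLObj f M
  map {M N} g := Mod.Hom.mk' (M := extLObj f M) (N := extLObj f N) (extLX.map f g)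
    (extLX.smul_map f M g)
  map_id M := by
    apply Mod.hom_ext
    change extLX.map f (𝟙 M) = 𝟙 (extLX f M)
    apply extLX.hom_ext
    simp
  map_comp {M N P} g h := by
    apply Mod.hom_ext
    change extLX.map f (g ≫ h) = extLX.map f g ≫ extLX.map f h
    apply extLX.hom_ext
    simp

end

section
variable {R S : Mon C} (f : R ⟶ S) {M : LMod R} {N : LMod S}

def adjLTo (k : extLX f M ⟶ N.X) : M.X ⟶ N.X := (λ_ M.X).inv ≫ η[S.X] ▷ M.X ≫ extLX.π f M ≫ k

def adjLInv (h : M.X ⟶ N.X) (hh : lact M ≫ h = R.X ◁ h ≫ f.hom ▷ N.X ≫ lact N) :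
    extLX f M ⟶ N.X :=
  extLX.desc (S.X ◁ h ≫ lact N) (by
    rw [← MonoidalCategory.whiskerLeft_comp_assoc, hh, ← whisker_exchange_assoc, mul_lact,
      ← whisker_exchange_assoc]
    simp)

@[simp]
lemma π_adjLInv (h : M.X ⟶ N.X) (hh) : extLX.π f M ≫ adjLInv f h hh = S.X ◁ h ≫ lact N :=
  extLX.π_desc _ _ _ _

@[simp]
lemma π_adjLInv_assoc (h : M.X ⟶ N.X) (hh) {T : C} (w : _ ⟶ T) :
    extLX.π f M ≫ adjLInv f h hh ≫ w =
      S.X ◁ h ≫ lact N ≫ w :=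
  (reassoc_of% (π_adjLInv f h hh)) w

@[simp]
lemma whisker_π_adjLInv (W : C) (h : M.X ⟶ N.X) (hh) :
    W ◁ extLX.π f M ≫ W ◁ adjLInv f h hh = W ◁ S.X ◁ h ≫ W ◁ lact N := by
  rw [← MonoidalCategory.whiskerLeft_comp, π_adjLInv, MonoidalCategory.whiskerLeft_comp]

@[simp]
lemma whisker_π_adjLInv_assoc (W : C) (h : M.X ⟶ N.X) (hh) {T : C} (w : _ ⟶ T) :
    W ◁ extLX.π f M ≫ W ◁ adjLInv f h hh ≫ w =
      W ◁ S.X ◁ h ≫ W ◁ lact N ≫ w :=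
  (reassoc_of% (whisker_π_adjLInv f W h hh)) w

lemma map_adjLInv {M' : LMod R} (g : M' ⟶ M) (h : M.X ⟶ N.X) (hh) (hh') :
    extLX.map f g ≫ adjLInv f h hh = adjLInv f (g.hom ≫ h) hh' := by
  apply extLX.hom_ext
  rw [π_adjLInv, extLX.π_map_assoc, π_adjLInv, MonoidalCategory.whiskerLeft_comp, Category.assoc]

lemma adjLTo_comp {N' : LMod S} (k : extLX f M ⟶ N.X) (b : N.X ⟶ N'.X) :
    adjLTo f (k ≫ b) = adjLTo f k ≫ b := by
  simp only [adjLTo, Category.assoc]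

lemma adjLTo_adjLInv (h : M.X ⟶ N.X) (hh) : adjLTo f (adjLInv f h hh) = h := by
  rw [adjLTo, π_adjLInv, ← whisker_exchange_assoc, one_lact]
  simp

variable [∀ X : C, PreservesColimitsOfSize.{0, 0} (tensorLeft X)]

lemma adjLTo_smul (k : extLX f M ⟶ N.X) (hk : extLX.smul f M ≫ k = S.X ◁ k ≫ lact N) :
    lact M ≫ adjLTo f k = R.X ◁ adjLTo f k ≫ f.hom ▷ N.X ≫ lact N := by
  have h₁ : lact M ≫ (λ_ M.X).inv ≫ η[S.X] ▷ M.X =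
      (λ_ _).inv ≫ η[S.X] ▷ (R.X ⊗ M.X) ≫ S.X ◁ lact M := by
    rw [leftUnitor_inv_naturality_assoc, whisker_exchange]
  have h₂ : S.X ◁ lact M ≫ extLX.π f M = (α_ S.X R.X M.X).inv ≫
      (S.X ◁ f.hom) ▷ M.X ≫ μ[S.X] ▷ M.X ≫ extLX.π f M := by
    rw [extLX.condition, Iso.inv_hom_id_assoc]
  have h₃ := unit_condition f M
  have h₄ := whiskerLeft_unit_mul S M.X
  rw [adjLTo, reassoc_of% h₁, reassoc_of% h₂, reassoc_of% h₃, whisker_exchange_assoc]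
  simp only [MonoidalCategory.whiskerLeft_comp, Category.assoc, ← hk,
    extLX.whiskerLeft_π_smul_assoc]
  rw [reassoc_of% h₄]

lemma adjLInv_smul (h : M.X ⟶ N.X) (hh) :
    extLX.smul f M ≫ adjLInv f h hh = S.X ◁ adjLInv f h hh ≫ lact N := by
  apply extLX.whisker_hom_ext
  rw [extLX.whiskerLeft_π_smul_assoc, π_adjLInv, whisker_π_adjLInv_assoc,
    ← whisker_exchange_assoc, mul_lact]
  simp

lemma adjLInv_adjLTo (k : extLX f M ⟶ N.X) (hk : extLX.smul f M ≫ k = S.X ◁ k ≫ lact N) :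
    adjLInv f (adjLTo f k) (adjLTo_smul f k hk) = k := by
  have h₄ := whiskerLeft_unit_mul S M.X
  apply extLX.hom_ext
  rw [π_adjLInv, adjLTo]
  simp only [MonoidalCategory.whiskerLeft_comp, Category.assoc, ← hk]
  rw [extLX.whiskerLeft_π_smul_assoc, reassoc_of% h₄]

end

variable [∀ X : C, PreservesColimitsOfSize.{0, 0} (tensorLeft X)]

def homEquivL {R S : Mon C} (f : R ⟶ S) (M : LMod R) (N : LMod S) :
    ((extL f).obj M ⟶ N) ≃ (M ⟶ (resL f).obj N) where
  toFun k := Mod.Hom.mk' (M := M) (N := (resL f).obj N) (adjLTo f k.hom)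
    (adjLTo_smul f k.hom (lact_hom k))
  invFun h := Mod.Hom.mk' (M := extLObj f M) (N := N)
    (adjLInv (N := N) f h.hom (lact_hom h)) (adjLInv_smul (N := N) f h.hom (lact_hom h))
  left_inv k := Mod.hom_ext _ _ (adjLInv_adjLTo f k.hom (lact_hom k))
  right_inv h := Mod.hom_ext _ _ (adjLTo_adjLInv (N := N) f h.hom (lact_hom h))

/-- `S ⊗_R -` is left adjoint to restriction of scalars. -/
def adjL {R S : Mon C} (f : R ⟶ S) : extL f ⊣ resL f :=
  Adjunction.mkOfHomEquiv
    { homEquiv M N := homEquivL f M N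
      homEquiv_naturality_left_symm := by
        intro M M' N g h
        exact Mod.hom_ext _ _
          (map_adjLInv (N := N) f g h.hom (lact_hom h) (lact_hom (g ≫ h))).symm
      homEquiv_naturality_right := by
        intro M N N' g h
        exact Mod.hom_ext _ _ (adjLTo_comp f g.hom h.hom) }

end ExtL

section ExtR

/-- The object `M ⊗_R S`. -/
def extRX {R S : Mon C} (f : R ⟶ S) (M : RMod R) : C := relTensor M (algLeft f)

namespace extRX
variable {R S : Mon C} (f : R ⟶ S) (M : RMod R)

def π : M.X ⊗ S.X ⟶ extRX f M := relTensor.π M (algLeft f)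

variable {f M} in
def desc {Z : C} (k : M.X ⊗ S.X ⟶ Z)
    (h : M.act ▷ S.X ≫ k = (α_ M.X R.X S.X).hom ≫ M.X ◁ f.hom ▷ S.X ≫ M.X ◁ μ[S.X] ≫ k) :
    extRX f M ⟶ Z :=
  relTensor.desc (M := M) (N := algLeft f) k (by
    rw [← MonoidalCategory.whiskerLeft_comp_assoc] at h
    exact h)

@[simp]
lemma π_desc {Z : C} (k : M.X ⊗ S.X ⟶ Z) (h) : π f M ≫ desc k h = k :=
  relTensor.π_desc (M := M) (N := algLeft f) _ _

variable {f M} in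
lemma hom_ext {Z : C} {a b : extRX f M ⟶ Z} (h : π f M ≫ a = π f M ≫ b) : a = b :=
  relTensor.hom_ext h

variable {M} in
def map {N : RMod R} (g : M ⟶ N) : extRX f M ⟶ extRX f N := relTensor.map g (𝟙 (algLeft f))

@[simp]
lemma π_map {N : RMod R} (g : M ⟶ N) : π f M ≫ map f g = g.hom ▷ S.X ≫ π f N := by
  have := relTensor.π_map g (𝟙 (algLeft f))
  simp only [Mod.id_hom', MonoidalCategory.whiskerLeft_id, Category.id_comp] at this
  exact this

@[simp]
lemma π_map_assoc {N : RMod R} (g : M ⟶ N) {T : C} (w : _ ⟶ T) :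
    π f M ≫ map f g ≫ w =
      g.hom ▷ S.X ≫ π f N ≫ w :=
  (reassoc_of% (π_map f M g)) w

@[simp]
lemma π_map_whiskerRight (W : C) {N : RMod R} (g : M ⟶ N) :
    π f M ▷ W ≫ map f g ▷ W = g.hom ▷ S.X ▷ W ≫ π f N ▷ W := by
  simp only [← comp_whiskerRight, π_map]

@[simp]
lemma π_map_whiskerRight_assoc (W : C) {N : RMod R} (g : M ⟶ N) {T : C} (w : _ ⟶ T) :
    π f M ▷ W ≫ map f g ▷ W ≫ w =
      g.hom ▷ S.X ▷ W ≫ π f N ▷ W ≫ w :=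
  (reassoc_of% (π_map_whiskerRight f M W g)) w

lemma condition : M.act ▷ S.X ≫ π f M =
    (α_ M.X R.X S.X).hom ≫ M.X ◁ f.hom ▷ S.X ≫ M.X ◁ μ[S.X] ≫ π f M := by
  have := relTensor.condition M (algLeft f)
  rw [← MonoidalCategory.whiskerLeft_comp_assoc]
  exact this

lemma condition_assoc {T : C} (w : _ ⟶ T) :
    M.act ▷ S.X ≫ π f M ≫ w =
      (α_ M.X R.X S.X).hom ≫ M.X ◁ f.hom ▷ S.X ≫ M.X ◁ μ[S.X] ≫ π f M ≫ w :=
  (reassoc_of% (condition f M)) w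

variable [∀ X : C, PreservesColimitsOfSize.{0, 0} (tensorRight X)]

variable {f M} in
def wdesc {W Z : C} (k : (M.X ⊗ S.X) ⊗ W ⟶ Z)
    (h : M.act ▷ S.X ▷ W ≫ k = (α_ M.X R.X S.X).hom ▷ W ≫ (M.X ◁ f.hom ▷ S.X) ▷ W ≫
      (M.X ◁ μ[S.X]) ▷ W ≫ k) : extRX f M ⊗ W ⟶ Z :=
  relTensor.whiskerRightDesc (M := M) (N := algLeft f) k (by
    rw [← comp_whiskerRight_assoc (M.X ◁ f.hom ▷ S.X), ← MonoidalCategory.whiskerLeft_comp] at h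
    exact h)

@[simp]
lemma π_wdesc {W Z : C} (k : (M.X ⊗ S.X) ⊗ W ⟶ Z) (h) : π f M ▷ W ≫ wdesc k h = k :=
  relTensor.π_whiskerRightDesc (M := M) (N := algLeft f) _ _

variable {f M} in
lemma whisker_hom_ext {W Z : C} {a b : extRX f M ⊗ W ⟶ Z}
    (h : π f M ▷ W ≫ a = π f M ▷ W ≫ b) : a = b :=
  relTensor.whiskerRight_hom_ext (M := M) (N := algLeft f) h

def smul : extRX f M ⊗ S.X ⟶ extRX f M :=
  wdesc ((α_ M.X S.X S.X).hom ≫ M.X ◁ μ[S.X] ≫ π f M) (by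
    have h₁ : (α_ M.X R.X S.X).hom ▷ S.X ≫ (M.X ◁ f.hom ▷ S.X) ▷ S.X ≫ (M.X ◁ μ[S.X]) ▷ S.X ≫
        (α_ M.X S.X S.X).hom ≫ M.X ◁ μ[S.X] =
        (α_ (M.X ⊗ R.X) S.X S.X).hom ≫ (M.X ⊗ R.X) ◁ μ[S.X] ≫
          (α_ M.X R.X S.X).hom ≫ M.X ◁ f.hom ▷ S.X ≫ M.X ◁ μ[S.X] := by
      rw [associator_naturality_middle_assoc, ← MonoidalCategory.whiskerLeft_comp,
        MonObj.mul_assoc, associator_naturality_middle_assoc, MonoidalCategory.whiskerLeft_comp,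
        MonoidalCategory.whiskerLeft_comp, ← MonoidalCategory.whiskerLeft_comp_assoc,
        associator_naturality_left, MonoidalCategory.whiskerLeft_comp_assoc,
        ← MonoidalCategory.whiskerLeft_comp_assoc _ _ (S.X ◁ μ[S.X]), ← whisker_exchange]
      simp
    rw [associator_naturality_left_assoc, ← whisker_exchange_assoc, condition, ← reassoc_of% h₁])

@[simp]
lemma π_whiskerRight_smul :
    π f M ▷ S.X ≫ smul f M = (α_ M.X S.X S.X).hom ≫ M.X ◁ μ[S.X] ≫ π f M :=
  π_wdesc _ _ _ _

@[simp]
lemma π_whiskerRight_smul_assoc {T : C} (w : _ ⟶ T) :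
    π f M ▷ S.X ≫ smul f M ≫ w =
      (α_ M.X S.X S.X).hom ≫ M.X ◁ μ[S.X] ≫ π f M ≫ w :=
  (reassoc_of% (π_whiskerRight_smul f M)) w

lemma smul_one : extRX f M ◁ η[S.X] ≫ smul f M = (ρ_ _).hom := by
  apply whisker_hom_ext
  rw [← whisker_exchange_assoc, π_whiskerRight_smul, rightUnitor_naturality]
  simp [← MonoidalCategory.whiskerLeft_comp_assoc]

lemma smul_mul : extRX f M ◁ μ[S.X] ≫ smul f M =
    (α_ _ _ _).inv ≫ smul f M ▷ S.X ≫ smul f M := by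
  apply whisker_hom_ext
  rw [← whisker_exchange_assoc, π_whiskerRight_smul, associator_inv_naturality_left_assoc,
    ← comp_whiskerRight_assoc, π_whiskerRight_smul]
  simp only [comp_whiskerRight, Category.assoc, π_whiskerRight_smul]
  rw [associator_naturality_right_assoc, ← MonoidalCategory.whiskerLeft_comp_assoc,
    MonObj.mul_assoc_flip]
  simp only [MonoidalCategory.whiskerLeft_comp, Category.assoc,
    associator_naturality_middle_assoc, pentagon_inv_hom_hom_hom_inv_assoc]

lemma smul_map {N : RMod R} (g : M ⟶ N) : smul f M ≫ map f g = map f g ▷ S.X ≫ smul f N := by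
  apply whisker_hom_ext
  rw [π_whiskerRight_smul_assoc, π_map_whiskerRight_assoc, π_whiskerRight_smul, π_map,
    associator_naturality_left_assoc, whisker_exchange_assoc]

end extRX

section
variable [∀ X : C, PreservesColimitsOfSize.{0, 0} (tensorRight X)]

def extRObj {R S : Mon C} (f : R ⟶ S) (M : RMod R) : RMod S where
  X := extRX f M
  act := extRX.smul f M
  act_one := extRX.smul_one f M
  act_mul := extRX.smul_mul f M

/-- Extension of scalars `- ⊗_R S` for right modules. -/
def extR {R S : Mon C} (f : R ⟶ S) : RMod R ⥤ RMod S where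
  obj M := extRObj f M
  map {M N} g := RMod.Hom.mk (M := extRObj f M) (N := extRObj f N) (extRX.map f g)
    (extRX.smul_map f M g)
  map_id M := by
    apply RMod.hom_ext
    change extRX.map f (𝟙 M) = 𝟙 (extRX f M)
    apply extRX.hom_ext
    simp
  map_comp {M N P} g h := by
    apply RMod.hom_ext
    change extRX.map f (g ≫ h) = extRX.map f g ≫ extRX.map f h
    apply extRX.hom_ext
    simp

end

section
variable {R S : Mon C} (f : R ⟶ S) {M : RMod R} {N : RMod S}

def adjRTo (k : extRX f M ⟶ N.X) : M.X ⟶ N.X := (ρ_ M.X).inv ≫ M.X ◁ η[S.X] ≫ extRX.π f M ≫ k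

def adjRInv (h : M.X ⟶ N.X) (hh : M.act ≫ h = h ▷ R.X ≫ N.X ◁ f.hom ≫ N.act) :
    extRX f M ⟶ N.X :=
  extRX.desc (h ▷ S.X ≫ N.act) (by
    rw [← comp_whiskerRight_assoc, hh, whisker_exchange_assoc, RMod.act_mul,
      whisker_exchange_assoc]
    simp)

@[simp]
lemma π_adjRInv (h : M.X ⟶ N.X) (hh) : extRX.π f M ≫ adjRInv f h hh = h ▷ S.X ≫ N.act :=
  extRX.π_desc _ _ _ _

@[simp]
lemma π_adjRInv_assoc (h : M.X ⟶ N.X) (hh) {T : C} (w : _ ⟶ T) :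
    extRX.π f M ≫ adjRInv f h hh ≫ w =
      h ▷ S.X ≫ N.act ≫ w :=
  (reassoc_of% (π_adjRInv f h hh)) w

@[simp]
lemma whisker_π_adjRInv (W : C) (h : M.X ⟶ N.X) (hh) :
    extRX.π f M ▷ W ≫ adjRInv f h hh ▷ W = h ▷ S.X ▷ W ≫ N.act ▷ W := by
  rw [← comp_whiskerRight, π_adjRInv, comp_whiskerRight]

@[simp]
lemma whisker_π_adjRInv_assoc (W : C) (h : M.X ⟶ N.X) (hh) {T : C} (w : _ ⟶ T) :
    extRX.π f M ▷ W ≫ adjRInv f h hh ▷ W ≫ w =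
      h ▷ S.X ▷ W ≫ N.act ▷ W ≫ w :=
  (reassoc_of% (whisker_π_adjRInv f W h hh)) w

lemma map_adjRInv {M' : RMod R} (g : M' ⟶ M) (h : M.X ⟶ N.X) (hh) (hh') :
    extRX.map f g ≫ adjRInv f h hh = adjRInv f (g.hom ≫ h) hh' := by
  apply extRX.hom_ext
  rw [π_adjRInv, extRX.π_map_assoc, π_adjRInv, comp_whiskerRight, Category.assoc]

lemma adjRTo_comp {N' : RMod S} (k : extRX f M ⟶ N.X) (b : N.X ⟶ N'.X) :
    adjRTo f (k ≫ b) = adjRTo f k ≫ b := by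
  simp only [adjRTo, Category.assoc]

lemma adjRTo_adjRInv (h : M.X ⟶ N.X) (hh) : adjRTo f (adjRInv f h hh) = h := by
  rw [adjRTo, π_adjRInv, whisker_exchange_assoc, RMod.act_one]
  simp

variable [∀ X : C, PreservesColimitsOfSize.{0, 0} (tensorRight X)]

lemma adjRTo_smul (k : extRX f M ⟶ N.X) (hk : extRX.smul f M ≫ k = k ▷ S.X ≫ N.act) :
    M.act ≫ adjRTo f k = adjRTo f k ▷ R.X ≫ N.X ◁ f.hom ≫ N.act := by
  have h₁ : M.act ≫ (ρ_ M.X).inv ≫ M.X ◁ η[S.X] =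
      (ρ_ _).inv ≫ (M.X ⊗ R.X) ◁ η[S.X] ≫ M.act ▷ S.X := by
    rw [rightUnitor_inv_naturality_assoc, whisker_exchange]
  have h₃ := unit_condition_right f M
  have h₄ := whiskerRight_unit_mul S M.X
  rw [adjRTo, reassoc_of% h₁, extRX.condition_assoc, reassoc_of% h₃, ← whisker_exchange_assoc]
  simp only [comp_whiskerRight, Category.assoc, ← hk, extRX.π_whiskerRight_smul_assoc]
  rw [reassoc_of% h₄]

lemma adjRInv_smul (h : M.X ⟶ N.X) (hh) :
    extRX.smul f M ≫ adjRInv f h hh = adjRInv f h hh ▷ S.X ≫ N.act := by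
  apply extRX.whisker_hom_ext
  rw [extRX.π_whiskerRight_smul_assoc, π_adjRInv, whisker_π_adjRInv_assoc,
    whisker_exchange_assoc, RMod.act_mul]
  simp

lemma adjRInv_adjRTo (k : extRX f M ⟶ N.X) (hk : extRX.smul f M ≫ k = k ▷ S.X ≫ N.act) :
    adjRInv f (adjRTo f k) (adjRTo_smul f k hk) = k := by
  have h₄ := whiskerRight_unit_mul S M.X
  apply extRX.hom_ext
  rw [π_adjRInv, adjRTo]
  simp only [comp_whiskerRight, Category.assoc, ← hk]
  rw [extRX.π_whiskerRight_smul_assoc, reassoc_of% h₄]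

end

variable [∀ X : C, PreservesColimitsOfSize.{0, 0} (tensorRight X)]

def homEquivR {R S : Mon C} (f : R ⟶ S) (M : RMod R) (N : RMod S) :
    ((extR f).obj M ⟶ N) ≃ (M ⟶ (resR f).obj N) where
  toFun k := RMod.Hom.mk (M := M) (N := (resR f).obj N) (adjRTo f k.hom)
    (adjRTo_smul f k.hom k.act_hom)
  invFun h := RMod.Hom.mk (M := extRObj f M) (N := N)
    (adjRInv (N := N) f h.hom h.act_hom) (adjRInv_smul (N := N) f h.hom h.act_hom)
  left_inv k := RMod.hom_ext _ _ (adjRInv_adjRTo f k.hom k.act_hom)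
  right_inv h := RMod.hom_ext _ _ (adjRTo_adjRInv (N := N) f h.hom h.act_hom)

/-- `- ⊗_R S` is left adjoint to restriction of scalars. -/
def adjR {R S : Mon C} (f : R ⟶ S) : extR f ⊣ resR f :=
  Adjunction.mkOfHomEquiv
    { homEquiv M N := homEquivR f M N
      homEquiv_naturality_left_symm := by
        intro M M' N g h
        exact RMod.hom_ext _ _
          (map_adjRInv (N := N) f g h.hom h.act_hom (g ≫ h).act_hom).symm
      homEquiv_naturality_right := by
        intro M N N' g h
        exact RMod.hom_ext _ _ (adjRTo_comp f g.hom h.hom) }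

end ExtR
end Tensor
end Modules

section Classes

/-- A category equipped with three classes of morphisms. -/
structure ModelClasses (D : Type u₁) [Category.{v₁} D] where
  weq : MorphismProperty D
  cof : MorphismProperty D
  fib : MorphismProperty D

namespace ModelClasses
variable {D : Type u₁} [Category.{v₁} D] (m : ModelClasses D)

/-- The three classes are the weak equivalences, cofibrations and fibrations of a model category
(complete and cocomplete, with functorial factorizations). -/
structure IsModel : Prop where
  hasLimits : HasLimits D
  hasColimits : HasColimits D
  two_of_three : m.weq.HasTwoOutOfThreeProperty
  isos_weq : MorphismProperty.isomorphisms D ≤ m.weq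
  isos_cof : MorphismProperty.isomorphisms D ≤ m.cof
  isos_fib : MorphismProperty.isomorphisms D ≤ m.fib
  retracts_weq : m.weq.IsStableUnderRetracts
  retracts_cof : m.cof.IsStableUnderRetracts
  retracts_fib : m.fib.IsStableUnderRetracts
  lift_trivial_cof : ∀ ⦃A B X Y : D⦄ (i : A ⟶ B) (p : X ⟶ Y),
    m.cof i → m.weq i → m.fib p → HasLiftingProperty i p
  lift_trivial_fib : ∀ ⦃A B X Y : D⦄ (i : A ⟶ B) (p : X ⟶ Y),
    m.cof i → m.fib p → m.weq p → HasLiftingProperty i p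
  factor_trivial_fib : MorphismProperty.HasFunctorialFactorization m.cof (m.fib ⊓ m.weq)
  factor_trivial_cof : MorphismProperty.HasFunctorialFactorization (m.cof ⊓ m.weq) m.fib

def IsCofibrant (X : D) : Prop := ∃ (E : D) (hE : IsInitial E), m.cof (hE.to X)

/-- The classes of the transferred structure: weak equivalences and fibrations are detected
by `U`, and cofibrations have the left lifting property against trivial fibrations. -/
def transfer {C : Type u} [Category.{v} C] [ModelCategory C] (U : D ⥤ C) : ModelClasses D where
  weq := (weakEquivalences C).inverseImage U
  fib := (fibrations C).inverseImage U
  cof := ((fibrations C).inverseImage U ⊓ (weakEquivalences C).inverseImage U).llp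

end ModelClasses

/-- The data of a pseudofunctor from `A` to the 2-category of categories with three classes of
morphisms and adjunctions `ext f ⊣ res f`. It is recorded by the pseudofunctor of right adjoints
together with a left adjoint of every right adjoint: the coherence isomorphisms between the left
adjoints are the mates of those of the right adjoints. -/
structure AdjDiagram (A : Type u₁) [Category.{v₁} A] where
  res : Pseudofunctor (LocallyDiscrete Aᵒᵖ) Cat.{v₂, u₂}
  ext : ∀ {a b : A} (_ : a ⟶ b), res.obj ⟨op a⟩ ⥤ res.obj ⟨op b⟩
  adj : ∀ {a b : A} (f : a ⟶ b), ext f ⊣ (res.map f.op.toLoc).toFunctor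
  classes : ∀ a : A, ModelClasses (res.obj ⟨op a⟩)

namespace AdjDiagram
variable {A : Type u₁} [Category.{v₁} A] (F : AdjDiagram.{v₁, u₁, v₂, u₂} A) (m : ModelClasses A)

/-- The diagram takes values in model categories and Quillen adjunctions. -/
structure IsModelDiagram : Prop where
  isModel : ∀ a : A, (F.classes a).IsModel
  ext_cof : ∀ ⦃a b : A⦄ (f : a ⟶ b) ⦃X Y : F.res.obj ⟨op a⟩⦄ (g : X ⟶ Y),
    (F.classes a).cof g → (F.classes b).cof ((F.ext f).map g)
  ext_trivial_cof : ∀ ⦃a b : A⦄ (f : a ⟶ b) ⦃X Y : F.res.obj ⟨op a⟩⦄ (g : X ⟶ Y),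
    (F.classes a).cof g → (F.classes a).weq g → (F.classes b).weq ((F.ext f).map g)

/-- `f_!` preserves weak equivalences for every trivial cofibration `f` of the base. -/
def IsLeftProper : Prop :=
  ∀ ⦃a b : A⦄ (f : a ⟶ b), m.cof f → m.weq f →
    ∀ ⦃X Y : F.res.obj ⟨op a⟩⦄ (g : X ⟶ Y),
      (F.classes a).weq g → (F.classes b).weq ((F.ext f).map g)

/-- `f^*` preserves weak equivalences for every trivial fibration `f` of the base. -/
def IsRightProper : Prop :=
  ∀ ⦃a b : A⦄ (f : a ⟶ b), m.fib f → m.weq f →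
    ∀ ⦃X Y : F.res.obj ⟨op b⟩⦄ (g : X ⟶ Y),
      (F.classes b).weq g → (F.classes a).weq ((F.res.map f.op.toLoc).toFunctor.map g)

/-- Left and right proper. -/
structure IsProper : Prop where
  left : F.IsLeftProper m
  right : F.IsRightProper m

/-- The Grothendieck construction: objects are pairs `(a, X)`, and a morphism `(a, X) ⟶ (b, Y)`
is a map `f : a ⟶ b` with a map `X ⟶ f^* Y`. -/
abbrev Total := Pseudofunctor.CoGrothendieck F.res

abbrev proj : F.Total ⥤ A := Pseudofunctor.CoGrothendieck.forget F.res

/-- The map `f_! X ⟶ Y` adjoint to the fibre component `X ⟶ f^* Y` of a morphism. -/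
def adjoint {X Y : F.Total} (φ : X ⟶ Y) : (F.ext φ.base).obj X.fiber ⟶ Y.fiber :=
  ((F.adj φ.base).homEquiv _ _).symm φ.fiber

/-- The weak equivalences, cofibrations and fibrations of the integral model structure. -/
def integral : ModelClasses F.Total where
  weq X Y φ := m.weq φ.base ∧
    ∃ (X' : F.res.obj ⟨op X.base⟩) (q : X' ⟶ X.fiber),
      (F.classes X.base).IsCofibrant X' ∧ (F.classes X.base).fib q ∧ (F.classes X.base).weq q ∧
        (F.classes Y.base).weq ((F.ext φ.base).map q ≫ F.adjoint φ)
  cof X Y φ := m.cof φ.base ∧ (F.classes Y.base).cof (F.adjoint φ)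
  fib X Y φ := m.fib φ.base ∧ (F.classes X.base).fib φ.fiber

end AdjDiagram

section Relative
variable {N : Type u₂} [Category.{v₂} N] {B : Type u₁} [Category.{v₁} B] (π : N ⥤ B)

/-- A cocone `t` on `δ` which lifts a cocone `s` on `δ ⋙ π`. -/
structure IsCoconeLift {I : Type w} [Category.{w} I] {δ : I ⥤ N} (s : Cocone (δ ⋙ π))
    (t : Cocone δ) : Prop where
  pt : π.obj t.pt = s.pt
  legs : ∀ i, π.IsHomLift (s.ι.app i) (t.ι.app i)

/-- A cone `t` on `δ` which lifts a cone `s` on `δ ⋙ π`. -/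
structure IsConeLift {I : Type w} [Category.{w} I] {δ : I ⥤ N} (s : Cone (δ ⋙ π))
    (t : Cone δ) : Prop where
  pt : π.obj t.pt = s.pt
  legs : ∀ i, π.IsHomLift (s.π.app i) (t.π.app i)

/-- The functor `π` has all relative colimits: among the lifts of a cocone there is an
initial one. -/
def RelativelyCocomplete : Prop :=
  ∀ (I : Type w) [Category.{w} I] (δ : I ⥤ N) (s : Cocone (δ ⋙ π)),
    ∃ t : Cocone δ, IsCoconeLift π s t ∧ ∀ t' : Cocone δ, IsCoconeLift π s t' →
      ∃! g : t.pt ⟶ t'.pt, π.IsHomLift (𝟙 s.pt) g ∧ ∀ i, t.ι.app i ≫ g = t'.ι.app i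

/-- The functor `π` has all relative limits: among the lifts of a cone there is a
terminal one. -/
def RelativelyComplete : Prop :=
  ∀ (I : Type w) [Category.{w} I] (δ : I ⥤ N) (s : Cone (δ ⋙ π)),
    ∃ t : Cone δ, IsConeLift π s t ∧ ∀ t' : Cone δ, IsConeLift π s t' →
      ∃! g : t'.pt ⟶ t.pt, π.IsHomLift (𝟙 s.pt) g ∧ ∀ i, g ≫ t.π.app i = t'.π.app i

/-- `(L, R)` is a `π`-weak factorization system relative to `(L', R')`. -/
structure IsRelativeWFS (L R : MorphismProperty N) (L' R' : MorphismProperty B) : Prop where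
  left_le : L ≤ L'.inverseImage π
  right_le : R ≤ R'.inverseImage π
  left_retract : ∀ ⦃X Y X' Y' : N⦄ (f : X ⟶ Y) (g : X' ⟶ Y'), Nonempty (RetractArrow f g) →
    L g → L' (π.map f) → L f
  right_retract : ∀ ⦃X Y X' Y' : N⦄ (f : X ⟶ Y) (g : X' ⟶ Y'), Nonempty (RetractArrow f g) →
    R g → R' (π.map f) → R f
  factor : ∀ ⦃X Y : N⦄ (φ : X ⟶ Y) ⦃b : B⦄ (h : π.obj X ⟶ b) (g : b ⟶ π.obj Y),
    h ≫ g = π.map φ → L' h → R' g →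
      ∃ (Z : N) (i : X ⟶ Z) (p : Z ⟶ Y), i ≫ p = φ ∧ L i ∧ R p ∧ π.obj Z = b ∧
        π.IsHomLift h i ∧ π.IsHomLift g p
  lift : ∀ ⦃X Y Z W : N⦄ (s : X ⟶ Z) (i : X ⟶ Y) (p : Z ⟶ W) (t : Y ⟶ W),
    s ≫ p = i ≫ t → L i → R p →
      ∀ u : π.obj Y ⟶ π.obj Z, π.map i ≫ u = π.map s → u ≫ π.map p = π.map t →
        ∃ k : Y ⟶ Z, i ≫ k = s ∧ k ≫ p = t ∧ π.map k = u

variable (n : ModelClasses N) (m : ModelClasses B)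

/-- The three classes are subcategories containing all objects. -/
structure ModelClasses.IsPreModel : Prop where
  weq : m.weq.IsMultiplicative
  cof : m.cof.IsMultiplicative
  fib : m.fib.IsMultiplicative

/-- `π` exhibits `N` as a model category relative to `B`. -/
structure IsRelativeModelCategory : Prop where
  preModel_base : m.IsPreModel
  preModel_total : n.IsPreModel
  cocomplete : RelativelyCocomplete.{w} π
  complete : RelativelyComplete.{w} π
  weq_comp : ∀ ⦃X Y Z : N⦄ (f : X ⟶ Y) (g : Y ⟶ Z), n.weq f → n.weq g →
    m.weq (π.map (f ≫ g)) → n.weq (f ≫ g)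
  weq_of_postcomp : ∀ ⦃X Y Z : N⦄ (f : X ⟶ Y) (g : Y ⟶ Z), n.weq g → n.weq (f ≫ g) →
    m.weq (π.map f) → n.weq f
  weq_of_precomp : ∀ ⦃X Y Z : N⦄ (f : X ⟶ Y) (g : Y ⟶ Z), n.weq f → n.weq (f ≫ g) →
    m.weq (π.map g) → n.weq g
  wfs_trivial_cof : IsRelativeWFS π (n.cof ⊓ n.weq) n.fib (m.cof ⊓ m.weq) m.fib
  wfs_trivial_fib : IsRelativeWFS π n.cof (n.fib ⊓ n.weq) m.cof (m.fib ⊓ m.weq)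

/-- The map to `X` from the initial object of the fibre over `π X` is a cofibration. -/
def IsRelativelyCofibrant (X : N) : Prop :=
  ∃ (E : π.Fiber (π.obj X)) (hE : IsInitial E), n.cof (hE.to (Functor.Fiber.mk rfl)).1

/-- The map from `X` to the terminal object of the fibre over `π X` is a fibration. -/
def IsRelativelyFibrant (X : N) : Prop :=
  ∃ (T : π.Fiber (π.obj X)) (hT : IsTerminal T), n.fib (hT.from (Functor.Fiber.mk rfl)).1

/-- `π` is a model fibration with respect to the classes `n` and `m`. -/
structure IsModelFibration : Prop where
  relative : IsRelativeModelCategory.{w} π n m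
  cartesian : ∀ (Y : N) ⦃b : B⦄ (f : b ⟶ π.obj Y),
    ∃ (X : N) (φ : X ⟶ Y), π.IsStronglyCartesian f φ
  cocartesian : ∀ (X : N) ⦃b : B⦄ (f : π.obj X ⟶ b),
    ∃ (Y : N) (φ : X ⟶ Y), π.IsStronglyCocartesian f φ
  weq_of_cocartesian : ∀ ⦃X Y : N⦄ (f : X ⟶ Y), π.IsStronglyCocartesian (π.map f) f →
    IsRelativelyCofibrant π n X → m.weq (π.map f) → n.weq f
  weq_of_cartesian : ∀ ⦃X Y : N⦄ (f : X ⟶ Y), π.IsStronglyCartesian (π.map f) f →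
    IsRelativelyFibrant π n Y → m.weq (π.map f) → n.weq f

end Relative
end Classes

section Monoidal
variable (C : Type u) [Category.{v} C] [ModelCategory C]

/-- A model category is combinatorial if it is complete, locally presentable and cofibrantly
generated. -/
structure IsCombinatorial : Prop where
  hasLimits : HasLimits C
  locallyPresentable : IsLocallyPresentable.{v} C
  cofibrantlyGenerated : ∃ I J : MorphismProperty C,
    MorphismProperty.IsSmall.{v} I ∧ MorphismProperty.IsSmall.{v} J ∧
      trivialFibrations C = I.rlp ∧ fibrations C = J.rlp

/-- A class of morphisms closed under pushouts, transfinite compositions and retracts. -/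
structure IsWeaklySaturated {D : Type u₁} [Category.{v₁} D] (P : MorphismProperty D) : Prop where
  pushouts : P.IsStableUnderCobaseChange
  transfinite : MorphismProperty.IsStableUnderTransfiniteComposition.{v₁} P
  retracts : P.IsStableUnderRetracts

/-- The smallest weakly saturated class containing `S`. -/
def weakSaturation {D : Type u₁} [Category.{v₁} D] (S : MorphismProperty D) :
    MorphismProperty D :=
  fun _ _ f ↦ ∀ P : MorphismProperty D, IsWeaklySaturated P → S ≤ P → P f

variable [MonoidalCategory C]

/-- The class of morphisms `f ⊗ X : K ⊗ X ⟶ L ⊗ X` with `f` a trivial cofibration. -/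
inductive trivialCofTensor : MorphismProperty C
  | mk {K L : C} (f : K ⟶ L) (X : C) (hf : trivialCofibrations C f) : trivialCofTensor (f ▷ X)

/-- Every map in the smallest weakly saturated class containing the maps `f ⊗ X`, with `f` a
trivial cofibration, is a weak equivalence. -/
def MonoidAxiom : Prop := weakSaturation (trivialCofTensor C) ≤ weakEquivalences C

/-- The pushout-product axiom. -/
structure PushoutProductAxiom : Prop where
  cof : ∀ ⦃X Y X' Y' : C⦄ (f : X ⟶ Y) (g : X' ⟶ Y'), cofibrations C f → cofibrations C g →
    cofibrations C ((MonoidalCategory.Arrow.pushoutProduct.obj (Arrow.mk f)).obj (Arrow.mk g)).hom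
  weq : ∀ ⦃X Y X' Y' : C⦄ (f : X ⟶ Y) (g : X' ⟶ Y'), cofibrations C f → cofibrations C g →
    weakEquivalences C f ∨ weakEquivalences C g →
    weakEquivalences C
      ((MonoidalCategory.Arrow.pushoutProduct.obj (Arrow.mk f)).obj (Arrow.mk g)).hom

variable {C}

/-- The classes on algebras. -/
abbrev algClasses : ModelClasses (Mon C) := .transfer (Mon.forget C)

/-- The classes on left modules. -/
abbrev lmodClasses (R : Mon C) : ModelClasses (LMod R) := .transfer (Mod.forget R.X)

/-- The classes on right modules. -/
abbrev rmodClasses (R : Mon C) : ModelClasses (RMod R) := .transfer (RMod.forget R)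

section
variable {R : Mon C}

/-- `- ⊗_R N` takes weak equivalences of right modules to weak equivalences. -/
def IsFlatLeft (N : LMod R) : Prop :=
  ∀ ⦃M M' : RMod R⦄ (g : M ⟶ M'), (rmodClasses R).weq g →
    weakEquivalences C (relTensor.map g (𝟙 N))

/-- `M ⊗_R -` takes weak equivalences of left modules to weak equivalences. -/
def IsFlatRight (M : RMod R) : Prop :=
  ∀ ⦃N N' : LMod R⦄ (g : N ⟶ N'), (lmodClasses R).weq g →
    weakEquivalences C (relTensor.map (𝟙 M) g)

/-- A map `g` of right modules such that `g ⊗_R O` is a weak equivalence for every `O`. -/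
def IsFlatEquivRight {M M' : RMod R} (g : M ⟶ M') : Prop :=
  ∀ O : LMod R, weakEquivalences C (relTensor.map g (𝟙 O))

/-- A map `g` of left modules such that `O ⊗_R g` is a weak equivalence for every `O`. -/
def IsFlatEquivLeft {N N' : LMod R} (g : N ⟶ N') : Prop :=
  ∀ O : RMod R, weakEquivalences C (relTensor.map (𝟙 O) g)

end

variable (C) in
/-- The monoid axiom holds and cofibrant modules are flat. -/
structure SchwedeShipley : Prop where
  monoidAxiom : MonoidAxiom C
  flat_left : ∀ (R : Mon C) (N : LMod R), (lmodClasses R).IsCofibrant N → IsFlatLeft N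
  flat_right : ∀ (R : Mon C) (M : RMod R), (rmodClasses R).IsCofibrant M → IsFlatRight M

section
variable (C) [∀ X : C, PreservesColimitsOfSize.{0, 0} (tensorLeft X)]
  [∀ X : C, PreservesColimitsOfSize.{0, 0} (tensorRight X)]

/-- The diagram `R ↦ LMod R`. -/
def lmodDiagram : AdjDiagram.{v, max u v, v, max u v} (Mon C) where
  res := LocallyDiscrete.mkPseudofunctor
    (fun R ↦ Cat.of (LMod R.unop))
    (fun f ↦ (resL f.unop).toCatHom)
    (fun R ↦ Cat.Hom.isoMk (resLId R.unop))
    (fun f g ↦ Cat.Hom.isoMk (resLComp g.unop f.unop))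
    (by
      intros
      ext M
      apply Mod.hom_ext
      rw [Cat.eqToHom_app]
      refine Eq.trans ?_ (eqToHom_homL _).symm
      refine Eq.trans ?_ (eqToHom_refl M.X rfl).symm
      change 𝟙 M.X ≫ 𝟙 M.X ≫ 𝟙 M.X ≫ 𝟙 M.X ≫ 𝟙 M.X = 𝟙 M.X
      simp)
    (by
      intros
      ext M
      apply Mod.hom_ext
      rw [Cat.eqToHom_app]
      refine Eq.trans ?_ (eqToHom_homL _).symm
      refine Eq.trans ?_ (eqToHom_refl M.X rfl).symm
      change 𝟙 M.X ≫ 𝟙 M.X ≫ 𝟙 M.X = 𝟙 M.X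
      simp)
    (by
      intros
      ext M
      apply Mod.hom_ext
      rw [Cat.eqToHom_app]
      refine Eq.trans ?_ (eqToHom_homL _).symm
      refine Eq.trans ?_ (eqToHom_refl M.X rfl).symm
      change 𝟙 M.X ≫ 𝟙 M.X ≫ 𝟙 M.X = 𝟙 M.X
      simp)
  ext f := extL f
  adj f := adjL f
  classes R := lmodClasses R

/-- The diagram `R ↦ RMod R`. -/
def rmodDiagram : AdjDiagram.{v, max u v, v, max u v} (Mon C) where
  res := LocallyDiscrete.mkPseudofunctor
    (fun R ↦ Cat.of (RMod R.unop))
    (fun f ↦ (resR f.unop).toCatHom)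
    (fun R ↦ Cat.Hom.isoMk (resRId R.unop))
    (fun f g ↦ Cat.Hom.isoMk (resRComp g.unop f.unop))
    (by
      intros
      ext M
      apply RMod.hom_ext
      rw [Cat.eqToHom_app]
      refine Eq.trans ?_ (eqToHom_homR _).symm
      refine Eq.trans ?_ (eqToHom_refl M.X rfl).symm
      change 𝟙 M.X ≫ 𝟙 M.X ≫ 𝟙 M.X ≫ 𝟙 M.X ≫ 𝟙 M.X = 𝟙 M.X
      simp)
    (by
      intros
      ext M
      apply RMod.hom_ext
      rw [Cat.eqToHom_app]
      refine Eq.trans ?_ (eqToHom_homR _).symm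
      refine Eq.trans ?_ (eqToHom_refl M.X rfl).symm
      change 𝟙 M.X ≫ 𝟙 M.X ≫ 𝟙 M.X = 𝟙 M.X
      simp)
    (by
      intros
      ext M
      apply RMod.hom_ext
      rw [Cat.eqToHom_app]
      refine Eq.trans ?_ (eqToHom_homR _).symm
      refine Eq.trans ?_ (eqToHom_refl M.X rfl).symm
      change 𝟙 M.X ≫ 𝟙 M.X ≫ 𝟙 M.X = 𝟙 M.X
      simp)
  ext f := extR f
  adj f := adjR f
  classes R := rmodClasses R

end
end Monoidal
end
end ModFib

set_option linter.unusedSectionVars false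
-- Everything rests on one fact. If `f : R ⟶ S` has the left lifting property against the fibrations
-- of algebras and `O` is any right `R`-module, then the unit `O ⟶ O ⊗_R S` lies in the weak
-- saturation of the maps `j ⊗ X` with `j` a trivial cofibration (`llp_le_extClass`). The monoid
-- axiom makes it a weak equivalence. For `O = R` this is the acyclicity condition that transfers
-- the model structure to algebras. For general `O` it says that `f` is a flat equivalence, and
-- two-out-of-three in the naturality square of the unit gives left properness. Left modules are
-- reached through opposite algebras. Right properness is immediate, since restriction of scalars
-- does not change underlying maps.
--
-- The class `extClass` of good algebra maps is closed under retracts and transfinite compositions,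
-- because `O ⊗_R -` preserves sifted colimits of algebras and extension of scalars is associative.
-- By the small object argument it is enough to treat a pushout `R ⟶ P` of the free map on a trivial
-- cofibration `j : K ⟶ L` (`IsFreePushout.unit_mem`). A right `P`-module is an `R`-module `M` with
-- a map `M ⊗ L ⟶ M` extending the action of `K`. Such an `M` is built from `O` as the colimit of a
-- sequence over `O ⊗_R P`, each step freely attaching those products with `L` that are not yet
-- defined. The attached cells are free modules on pushout-products of the previous step with `j`,
-- which the pushout-product axiom keeps among the pushouts of maps `j' ⊗ X` (`gap_mem`). By
-- universal properties `O ⊗_R P` is a retract of `M` under `O`, so no filtration of `P` by words is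
-- needed.
--
-- For the Grothendieck construction let `π` be the projection and `V` the functor `(R, M) ↦ M`.
-- Flatness of cofibrant modules turns the derived condition on weak equivalences into: `π φ` and `V
-- φ` are weak equivalences (`weq_iff_of_cofibrant`). Fibrations are also detected by `π` and `V`,
-- and `V` inverts Cartesian maps, so lifting and factorization reduce to the base and the fibres by
-- transport along Cartesian and coCartesian maps. The one point that is not formal is
-- `IsDetected.trivial_cof_eq`: trivial cofibrations are the maps over trivial cofibrations that
-- lift against vertical fibrations. It uses that coCartesian maps over trivial cofibrations are
-- weak equivalences, that is, the fact above. It also supplies acyclicity for the two right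
-- adjoints `π ⋙ U` and `V` to `C`, where `U` forgets the algebra structure, so that
-- `ModelClasses.isModel_of_family` gives the integral model structure.
namespace ModFib
noncomputable section

/-! ### The small object argument for generators moved along left adjoints. -/

section SmallObject
open MorphismProperty

/-- A small family of presentable objects is uniformly presentable. -/
lemma exists_isCardinalPresentable {C : Type u} [Category.{v} C] {T : Type u₁} [Small.{w} T]
    (X : T → C) [∀ i, IsPresentable.{w} (X i)] :
    ∃ (κ : Cardinal.{w}) (_ : Fact κ.IsRegular), ∀ i, IsCardinalPresentable (X i) κ := by
  choose c hc hc' using fun i ↦ Functor.IsAccessible.exists_cardinal (F := coyoneda.obj (op (X i)))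
  obtain ⟨κ, h₁, h₂⟩ := HasCardinalLT.exists_regular_cardinal_forall.{w} (fun i ↦ (c i).ord.ToType)
  have : Fact κ.IsRegular := ⟨h₁⟩
  refine ⟨κ, this, fun i ↦ ?_⟩
  have := hc' i
  exact isCardinalPresentable_of_le (κ := c i) (X i)
    (le_of_lt (by simpa [hasCardinalLT_iff_cardinal_mk_lt] using h₂ i))

variable {C : Type u} [Category.{v} C] {D : Type u₁} [Category.{v} D]
  {K : Type} (U : K → D ⥤ C) (F : K → C ⥤ D) (adj : ∀ k, F k ⊣ U k) (J : MorphismProperty C)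

/-- The images of the maps in `J` under a family of functors. -/
def generators : MorphismProperty D :=
  ofHoms (fun (x : K × J.toSet) ↦ (F x.1).map x.2.1.hom)

instance [Small.{v} K] [IsSmall.{v} J] : IsSmall.{v} (generators F J) := by
  unfold generators; infer_instance

lemma generators_mk (k : K) {A B : C} (j : A ⟶ B) (hj : J j) :
    generators F J ((F k).map j) :=
  ofHoms.mk (f := fun (x : K × J.toSet) ↦ (F x.1).map x.2.1.hom) (k, ⟨Arrow.mk j, hj⟩)

include adj in
lemma rlp_generators_iff {X Y : D} (p : X ⟶ Y) :
    (generators F J).rlp p ↔ ∀ k, J.rlp ((U k).map p) := by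
  constructor
  · intro h k A B j hj
    exact ((adj k).hasLiftingProperty_iff _ _).1 (h _ (generators_mk F J k j hj))
  · rintro h _ _ _ ⟨k, j, hj⟩
    exact ((adj k).hasLiftingProperty_iff _ _).2 (h k _ hj)

-- A left adjoint of an accessible functor preserves presentable objects, so the sources of the
-- generators are `κ`-presentable, with one regular `κ` serving the whole small family.
include adj in
lemma hasSmallObjectArgument_generators [Small.{v} K] [IsSmall.{v} J]
    [IsLocallyPresentable.{v} C] [HasColimitsOfSize.{v, v} D]
    [∀ k, PreservesFilteredColimitsOfSize.{v, v} (U k)] :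
    HasSmallObjectArgument.{v} (generators F J) := by
  obtain ⟨κ, hκ, h⟩ := exists_isCardinalPresentable.{v} (fun (x : J.toSet) ↦ x.1.left)
  have h' (k : K) (x : J.toSet) : IsCardinalPresentable ((F k).obj x.1.left) κ := by
    have := h x
    have : (U k).IsCardinalAccessible κ := ⟨fun T _ _ ↦ by
      have := isFiltered_of_isCardinalFiltered T κ
      exact PreservesFilteredColimitsOfSize.preserves_filtered_colimits T⟩
    exact (adj k).isCardinalPresentable_leftAdjoint_obj κ _
  have hne : Nonempty κ.ord.ToType := by
    have := IsCardinalFiltered.nonempty κ.ord.ToType κ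
    infer_instance
  let : OrderBot κ.ord.ToType := WellFoundedLT.toOrderBot κ.ord.ToType
  refine ⟨κ, hκ, inferInstance, ?_⟩
  have : HasColimitsOfSize.{0, 0} D := hasColimitsOfSizeShrink.{0, 0, v, v} D
  refine { preservesColimit := ?_ }
  rintro _ _ _ _ _ ⟨k, j⟩ f hf
  have := h' k j
  have := preservesColimitsOfShape_of_isCardinalPresentable ((F k).obj j.1.left) κ κ.ord.ToType
  infer_instance

end SmallObject

lemma IsCombinatorial.hasColimits {C : Type u} [Category.{v} C] [ModelCategory C]
    (hC : IsCombinatorial C) : HasColimits C := by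
  obtain ⟨κ, _, h⟩ := hC.locallyPresentable
  exact h.toHasColimitsOfSize

/-! ### Transfer of model structures along families of right adjoints. -/

section Transfer

/-- The image of a class of maps stable under coproducts under a functor preserving coproducts
is stable under coproducts. -/
lemma isStableUnderCoproducts_map {C : Type u} [Category.{v} C] {D : Type u₁} [Category.{v₁} D]
    (F : C ⥤ D) (W : MorphismProperty C) [MorphismProperty.IsStableUnderCoproducts.{w} W]
    [HasCoproducts.{w} C] [HasCoproducts.{w} D] [PreservesColimitsOfSize.{w, w} F] :
    MorphismProperty.IsStableUnderCoproducts.{w} (W.map F) where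
  isStableUnderCoproductsOfShape T := by
    apply MorphismProperty.IsStableUnderCoproductsOfShape.mk
    intro X₁ X₂ _ _ f hf
    choose A B a ha e using hf
    replace e t := (e t).some
    refine ⟨_, _, Limits.Sigma.map a,
      MorphismProperty.colimMap _ (fun ⟨t⟩ ↦ ha t), ⟨?_⟩⟩
    let l (t : T) : F.obj (A t) ≅ X₁ t := Arrow.leftFunc.mapIso (e t)
    let r (t : T) : F.obj (B t) ≅ X₂ t := Arrow.rightFunc.mapIso (e t)
    have h₁ (t : T) : (l t).hom ≫ f t = F.map (a t) ≫ (r t).hom := (e t).hom.w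
    have h₂ (A : T → C) (t : T) : F.map (Sigma.ι A t) ≫ (PreservesCoproduct.iso F A).hom =
        Sigma.ι (fun j ↦ F.obj (A j)) t := by
      rw [← ι_comp_sigmaComparison, ← PreservesCoproduct.inv_hom, Category.assoc,
        Iso.inv_hom_id, Category.comp_id]
    refine Arrow.isoMk (PreservesCoproduct.iso F A ≪≫ Sigma.mapIso l)
      (PreservesCoproduct.iso F B ≪≫ Sigma.mapIso r) ?_
    rw [← cancel_epi (PreservesCoproduct.iso F A).inv]
    apply Sigma.hom_ext
    intro t
    simp only [PreservesCoproduct.inv_hom, ι_comp_sigmaComparison_assoc]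
    dsimp
    simp only [Category.assoc]
    rw [reassoc_of% h₂, ← Functor.map_comp_assoc, Sigma.ι_map, Functor.map_comp_assoc,
      reassoc_of% h₂]
    simp [reassoc_of% h₁]

variable {C : Type u} [Category.{v} C] [ModelCategory C] {D : Type u₁} [Category.{v} D]
  {K : Type} [Small.{v} K] {U : K → D ⥤ C} {F : K → C ⥤ D}

/-- Classes of fibrations and weak equivalences which are detected by a small family of right
adjoints to a combinatorial model category form a model structure if they satisfy the
acyclicity condition. -/
theorem ModelClasses.isModel_of_family (adj : ∀ k, F k ⊣ U k) (hC : IsCombinatorial C)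
    [HasLimits D] [HasColimits D] [∀ k, PreservesFilteredColimitsOfSize.{v, v} (U k)]
    (m : ModelClasses D)
    (hweq : ∀ ⦃X Y : D⦄ (f : X ⟶ Y), m.weq f ↔ ∀ k, weakEquivalences C ((U k).map f))
    (hfib : ∀ ⦃X Y : D⦄ (f : X ⟶ Y), m.fib f ↔ ∀ k, fibrations C ((U k).map f))
    (hcof : m.cof = (m.fib ⊓ m.weq).llp) (hacyclic : m.fib.llp ≤ m.weq) : m.IsModel := by
  obtain ⟨I, J, _, _, hI, hJ⟩ := hC.cofibrantlyGenerated
  have := hC.locallyPresentable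
  have := hasSmallObjectArgument_generators U F adj I
  have := hasSmallObjectArgument_generators U F adj J
  have hJ' : (generators F J).rlp = m.fib := by
    ext X Y p
    rw [rlp_generators_iff U F adj J, hfib, hJ]
  have hI' : (generators F I).rlp = m.fib ⊓ m.weq := by
    ext X Y p
    rw [rlp_generators_iff U F adj I]
    change _ ↔ m.fib p ∧ m.weq p
    rw [hfib, hweq, ← forall_and, ← hI]
    rfl
  have hw : m.weq = ⨅ k, (weakEquivalences C).inverseImage (U k) := by
    ext X Y f
    simp only [hweq, MorphismProperty.iInf_iff]
    rfl
  have hff : m.fib = ⨅ k, (fibrations C).inverseImage (U k) := by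
    ext X Y f
    simp only [hfib, MorphismProperty.iInf_iff]
    rfl
  have htwo : m.weq.HasTwoOutOfThreeProperty :=
    { comp_mem f g hf hg := by
        rw [hweq] at hf hg ⊢
        intro k
        rw [Functor.map_comp]
        exact MorphismProperty.comp_mem _ _ _ (hf k) (hg k)
      of_postcomp f g hg hfg := by
        rw [hweq] at hg hfg ⊢
        intro k
        have := hfg k
        rw [Functor.map_comp] at this
        exact MorphismProperty.of_postcomp _ _ _ (hg k) this
      of_precomp f g hf hfg := by
        rw [hweq] at hf hfg ⊢
        intro k
        have := hfg k
        rw [Functor.map_comp] at this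
        exact MorphismProperty.of_precomp _ _ _ (hf k) this }
  have f₁ : MorphismProperty.HasFunctorialFactorization m.cof (m.fib ⊓ m.weq) := by
    rw [hcof, ← hI']
    infer_instance
  have f₂ : MorphismProperty.HasFunctorialFactorization m.fib.llp m.fib := by
    rw [← hJ']
    infer_instance
  have hcof' : m.fib.llp ≤ m.cof := by
    rw [hcof]
    exact MorphismProperty.antitone_llp inf_le_left
  exact
    { hasLimits := inferInstance
      hasColimits := inferInstance
      two_of_three := htwo
      isos_weq := fun X Y f (_ : IsIso f) ↦ (hweq f).2 fun k ↦
        MorphismProperty.of_isIso _ _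
      isos_cof := by
        rw [hcof]
        exact fun X Y f (_ : IsIso f) ↦ MorphismProperty.llp_of_isIso _ f
      isos_fib := fun X Y f (_ : IsIso f) ↦ (hfib f).2 fun k ↦ MorphismProperty.of_isIso _ _
      retracts_weq := ⟨fun h hf ↦ (hweq _).2 fun k ↦
        MorphismProperty.of_retract (h.map (U k)) ((hweq _).1 hf k)⟩
      retracts_cof := by rw [hcof]; infer_instance
      retracts_fib := ⟨fun h hf ↦ (hfib _).2 fun k ↦
        MorphismProperty.of_retract (h.map (U k)) ((hfib _).1 hf k)⟩
      lift_trivial_cof := by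
        intro A B X Y i p hi hi' hp
        -- Retract argument: by acyclicity and two-out-of-three `d.p` is a trivial fibration, so `i`
        -- lifts against it and is a retract of `d.i`, which lifts against all fibrations.
        let d := MorphismProperty.factorizationData m.fib.llp m.fib i
        have hdp : m.weq d.p := m.weq.of_precomp d.i d.p (hacyclic _ d.hi)
          (by rwa [d.fac])
        rw [hcof] at hi
        have := hi d.p ⟨d.hp, hdp⟩
        have := d.hi p hp
        exact (RetractArrow.ofLeftLiftingProperty d.fac).leftLiftingProperty p
      lift_trivial_fib := by
        intro A B X Y i p hi hp hp'
        rw [hcof] at hi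
        exact hi p ⟨hp, hp'⟩
      factor_trivial_fib := f₁
      factor_trivial_cof :=
        ⟨⟨(MorphismProperty.functorialFactorizationData m.fib.llp m.fib).ofLE
          (fun _ _ f hf ↦ ⟨hcof' f hf, hacyclic f hf⟩) le_rfl⟩⟩ }

/-- Maps with the left lifting property against the maps detected to be fibrations by a
right adjoint `U`, as cell complexes. -/
lemma llp_fibrations_le {U : D ⥤ C} {F : C ⥤ D} (adj : F ⊣ U) (hC : IsCombinatorial C)
    [HasColimits D] [PreservesFilteredColimitsOfSize.{v, v} U] (P : MorphismProperty D)
    [P.IsStableUnderRetracts] [MorphismProperty.IsStableUnderTransfiniteComposition.{v} P]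
    (h : ((trivialCofibrations C).map F).pushouts ≤ P) :
    ((fibrations C).inverseImage U).llp ≤ P := by
  obtain ⟨I, J, _, _, hI, hJ⟩ := hC.cofibrantlyGenerated
  have := hC.locallyPresentable
  have := hasSmallObjectArgument_generators (fun _ : Unit ↦ U) (fun _ ↦ F) (fun _ ↦ adj) J
  have hJ' : (generators (fun _ : Unit ↦ F) J).rlp = (fibrations C).inverseImage U := by
    ext X Y p
    rw [rlp_generators_iff (fun _ : Unit ↦ U) (fun _ ↦ F) (fun _ ↦ adj) J, ← hJ]
    exact ⟨fun h ↦ h (), fun h _ ↦ h⟩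
  rw [← hJ', MorphismProperty.llp_rlp_of_hasSmallObjectArgument.{v}]
  have := hC.hasColimits
  have : PreservesColimits F := adj.leftAdjoint_preservesColimits
  -- `J` lies in the left class of its own right lifting class, which consists of the trivial
  -- cofibrations.
  have hg : generators (fun _ : Unit ↦ F) J ≤ (trivialCofibrations C).map F := by
    rintro _ _ _ ⟨k, j, hj⟩
    refine MorphismProperty.map_mem_map _ _ _ ?_
    rw [← fibrations_llp, hJ]
    exact MorphismProperty.le_llp_rlp _ _ hj
  have : MorphismProperty.IsStableUnderCoproducts.{v} (trivialCofibrations C) := {}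
  have : MorphismProperty.IsStableUnderCoproducts.{v} ((trivialCofibrations C).map F) :=
    isStableUnderCoproducts_map F _
  -- The coproducts in the small object argument are absorbed here: a coproduct of maps `F j` is
  -- again `F` of a trivial cofibration. Hence `P` need not be stable under coproducts, and only
  -- pushouts of single maps `F j` have to be checked.
  have hc : MorphismProperty.coproducts.{v} (generators (fun _ : Unit ↦ F) J) ≤
      (trivialCofibrations C).map F := MorphismProperty.coproducts_le_iff.2 hg
  refine (MorphismProperty.retracts_monotone ?_).trans P.retracts_le
  refine (MorphismProperty.transfiniteCompositions_monotone
    ((MorphismProperty.pushouts_monotone hc).trans h)).trans ?_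
  exact (MorphismProperty.transfiniteCompositions_le_iff.{v}).2 le_rfl

end Transfer

/-! ### The tensor algebra. -/

namespace FreeMon
variable {C : Type u} [Category.{v} C] [MonoidalCategory C] (X : C)

/-- The tensor powers of an object. -/
def power : ℕ → C
  | 0 => 𝟙_ C
  | n + 1 => X ⊗ power n

variable [HasCoproductsOfShape ℕ C]

/-- The tensor algebra of an object. -/
def obj : C := ∐ power X

def incl (n : ℕ) : power X n ⟶ obj X := Sigma.ι (power X) n

def one : 𝟙_ C ⟶ obj X := incl X 0

section Right
variable [∀ Y : C, PreservesColimitsOfShape (Discrete ℕ) (tensorRight Y)]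

variable {X} in
lemma whiskerRight_hom_ext {Y M : C} {a b : obj X ⊗ Y ⟶ M}
    (h : ∀ n, incl X n ▷ Y ≫ a = incl X n ▷ Y ≫ b) : a = b :=
  Cofan.IsColimit.hom_ext (isColimitCofanMkObjOfIsColimit (tensorRight Y) _ _
    (coproductIsCoproduct (power X))) _ _ h

variable {X} in
def whiskerRightDesc {Y M : C} (k : ∀ n, power X n ⊗ Y ⟶ M) : obj X ⊗ Y ⟶ M :=
  Cofan.IsColimit.desc (isColimitCofanMkObjOfIsColimit (tensorRight Y) _ _
    (coproductIsCoproduct (power X))) k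

variable {X} in
@[simp]
lemma incl_whiskerRightDesc {Y M : C} (k : ∀ n, power X n ⊗ Y ⟶ M) (n : ℕ) :
    incl X n ▷ Y ≫ whiskerRightDesc k = k n :=
  Cofan.IsColimit.fac (isColimitCofanMkObjOfIsColimit (tensorRight Y) _ _
    (coproductIsCoproduct (power X))) k n

end Right

section
variable [∀ Y : C, PreservesColimitsOfShape (Discrete ℕ) (tensorLeft Y)]

/-- Multiplication by a generator. -/
def cons : X ⊗ obj X ⟶ obj X :=
  Cofan.IsColimit.desc (isColimitCofanMkObjOfIsColimit (tensorLeft X) _ _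
    (coproductIsCoproduct (power X))) fun n ↦ incl X (n + 1)

@[simp]
lemma whiskerLeft_incl_cons (n : ℕ) : X ◁ incl X n ≫ cons X = incl X (n + 1) :=
  Cofan.IsColimit.fac (isColimitCofanMkObjOfIsColimit (tensorLeft X) _ _
    (coproductIsCoproduct (power X))) _ n

variable [∀ Y : C, PreservesColimitsOfShape (Discrete ℕ) (tensorRight Y)]
variable {X} {Y M : C} (b : X ⊗ M ⟶ M) (c : Y ⟶ M)

def liftPower : ∀ n, power X n ⊗ Y ⟶ M
  | 0 => (λ_ Y).hom ≫ c
  | n + 1 => (α_ X (power X n) Y).hom ≫ X ◁ liftPower n ≫ b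

/-- `obj X ⊗ Y` is the free `X ⊗ -`-algebra on `Y`. -/
def lift : obj X ⊗ Y ⟶ M := whiskerRightDesc (liftPower b c)

lemma one_lift : one X ▷ Y ≫ lift b c = (λ_ Y).hom ≫ c :=
  incl_whiskerRightDesc _ _

lemma cons_lift : cons X ▷ Y ≫ lift b c = (α_ X (obj X) Y).hom ≫ X ◁ lift b c ≫ b := by
  have (n : ℕ) : incl X n ▷ Y ≫ lift b c = liftPower b c n := incl_whiskerRightDesc _ _
  rw [← cancel_epi (α_ X (obj X) Y).inv, Iso.inv_hom_id_assoc]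
  refine Cofan.IsColimit.hom_ext (isColimitCofanMkObjOfIsColimit
    (tensorRight Y ⋙ tensorLeft X) _ _ (coproductIsCoproduct (power X))) _ _ fun n ↦ ?_
  change X ◁ incl X n ▷ Y ≫ _ = X ◁ incl X n ▷ Y ≫ _
  have h : (X ◁ incl X n ≫ cons X) ▷ Y ≫ lift b c =
      (α_ X (power X n) Y).hom ≫ X ◁ liftPower b c n ≫ b := by
    rw [whiskerLeft_incl_cons]
    exact this (n + 1)
  rw [associator_inv_naturality_middle_assoc, ← comp_whiskerRight_assoc, h,
    ← MonoidalCategory.whiskerLeft_comp_assoc, this, Iso.inv_hom_id_assoc]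

variable {b c} in
lemma eq_lift {h : obj X ⊗ Y ⟶ M} (h₁ : one X ▷ Y ≫ h = (λ_ Y).hom ≫ c)
    (h₂ : cons X ▷ Y ≫ h = (α_ X (obj X) Y).hom ≫ X ◁ h ≫ b) : h = lift b c := by
  apply whiskerRight_hom_ext
  intro n
  rw [show incl X n ▷ Y ≫ lift b c = liftPower b c n from incl_whiskerRightDesc _ _]
  induction n with
  | zero => exact h₁
  | succ n ih =>
    have : (X ◁ incl X n ≫ cons X) ▷ Y ≫ h =
        (α_ X (power X n) Y).hom ≫ X ◁ liftPower b c n ≫ b := by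
      rw [comp_whiskerRight_assoc, h₂, ← ih]
      simp
    rwa [whiskerLeft_incl_cons] at this

/-- This is induction on word length in diagrammatic form. The right unit law, associativity and
multiplicativity of induced maps are all proved by comparing two maps on the empty word and on
`cons`. -/
lemma lift_hom_ext (b : X ⊗ M ⟶ M) {h h' : obj X ⊗ Y ⟶ M} (h₁ : one X ▷ Y ≫ h = one X ▷ Y ≫ h')
    (h₂ : cons X ▷ Y ≫ h = (α_ X (obj X) Y).hom ≫ X ◁ h ≫ b)
    (h₃ : cons X ▷ Y ≫ h' = (α_ X (obj X) Y).hom ≫ X ◁ h' ≫ b) : h = h' :=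
  (eq_lift (b := b) (c := (λ_ Y).inv ≫ one X ▷ Y ≫ h') (by simp [h₁]) h₂).trans
    (eq_lift (by simp) h₃).symm

variable (X) in
def mul : obj X ⊗ obj X ⟶ obj X := lift (cons X) (𝟙 _)

lemma one_mul : one X ▷ obj X ≫ mul X = (λ_ _).hom := by
  simp [mul, one_lift]

lemma cons_mul : cons X ▷ obj X ≫ mul X = (α_ _ _ _).hom ≫ X ◁ mul X ≫ cons X :=
  cons_lift _ _

lemma mul_one : obj X ◁ one X ≫ mul X = (ρ_ _).hom := by
  refine lift_hom_ext (cons X) ?_ ?_ ?_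
  · rw [← whisker_exchange_assoc, one_mul]
    simp [unitors_equal]
  · rw [← whisker_exchange_assoc, cons_mul]
    simp
  · simp

lemma mul_assoc :
    mul X ▷ obj X ≫ mul X = (α_ _ _ _).hom ≫ obj X ◁ mul X ≫ mul X := by
  rw [← cancel_epi (α_ _ _ _).inv, Iso.inv_hom_id_assoc]
  refine lift_hom_ext (cons X) ?_ ?_ ?_
  · rw [← whisker_exchange_assoc, one_mul, associator_inv_naturality_left_assoc,
      ← comp_whiskerRight_assoc, one_mul]
    simp
  · rw [associator_inv_naturality_left_assoc, ← comp_whiskerRight_assoc, cons_mul]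
    simp only [comp_whiskerRight, Category.assoc, cons_mul]
    simp
  · rw [← whisker_exchange_assoc, cons_mul]
    simp

variable (X) in
/-- The free algebra on an object. -/
def mon : Mon C :=
  letI : MonObj (obj X) :=
    { one := one X
      mul := mul X
      one_mul := one_mul
      mul_one := mul_one
      mul_assoc := mul_assoc }
  ⟨obj X⟩

variable (X) in
def unit : X ⟶ obj X := (ρ_ X).inv ≫ X ◁ one X ≫ cons X

lemma unit_mul : unit X ▷ obj X ≫ mul X = cons X := by
  simp only [unit, comp_whiskerRight, Category.assoc, cons_mul]
  rw [associator_naturality_middle_assoc, ← MonoidalCategory.whiskerLeft_comp_assoc, one_mul]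
  simp

variable {A : Mon C}

/-- The recursion is applied with `Y` the unit object: `f` followed by multiplication makes `A` an
algebra for `X ⊗ -`, and the empty word goes to the unit of `A`. -/
def descX (f : X ⟶ A.X) : obj X ⟶ A.X :=
  (ρ_ _).inv ≫ lift (f ▷ A.X ≫ μ[A.X]) η[A.X]

lemma one_descX (f : X ⟶ A.X) : one X ≫ descX f = η[A.X] := by
  rw [descX, rightUnitor_inv_naturality_assoc, one_lift]
  simp [unitors_equal]

lemma cons_descX (f : X ⟶ A.X) : cons X ≫ descX f = X ◁ descX f ≫ f ▷ A.X ≫ μ[A.X] := by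
  rw [descX, rightUnitor_inv_naturality_assoc, cons_lift]
  simp

lemma mul_descX (f : X ⟶ A.X) : mul X ≫ descX f = (descX f ⊗ₘ descX f) ≫ μ[A.X] := by
  refine lift_hom_ext (f ▷ A.X ≫ μ[A.X]) ?_ ?_ ?_
  · rw [reassoc_of% (one_mul (X := X)), MonoidalCategory.tensorHom_def, Category.assoc,
      ← comp_whiskerRight_assoc, one_descX, ← whisker_exchange_assoc, MonObj.one_mul]
    simp
  · rw [reassoc_of% (cons_mul (X := X)), cons_descX]
    simp
  · rw [MonoidalCategory.tensorHom_def, Category.assoc, ← comp_whiskerRight_assoc, cons_descX]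
    simp only [comp_whiskerRight, Category.assoc, ← whisker_exchange_assoc, MonObj.mul_assoc,
      MonoidalCategory.whiskerLeft_comp]
    simp [whisker_exchange_assoc]

def desc (f : X ⟶ A.X) : mon X ⟶ A :=
  { hom := descX f
    isMonHom_hom := ⟨one_descX f, mul_descX f⟩ }

lemma unit_descX (f : X ⟶ A.X) : unit X ≫ descX f = f := by
  simp only [unit, Category.assoc, cons_descX]
  rw [← MonoidalCategory.whiskerLeft_comp_assoc, one_descX, whisker_exchange_assoc, MonObj.mul_one]
  simp

/-- `cons` is multiplication by a generator (`unit_mul`), so a multiplicative map satisfies the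
recursion that characterizes `lift`. -/
lemma eq_descX {k : obj X ⟶ A.X} (h₁ : one X ≫ k = η[A.X])
    (h₂ : mul X ≫ k = (k ⊗ₘ k) ≫ μ[A.X]) : k = descX (unit X ≫ k) := by
  suffices (ρ_ (obj X)).hom ≫ k = lift ((unit X ≫ k) ▷ A.X ≫ μ[A.X]) η[A.X] by
    rw [descX, ← this, Iso.inv_hom_id_assoc]
  apply eq_lift
  · rw [rightUnitor_naturality_assoc, h₁]
    simp [unitors_equal]
  · rw [rightUnitor_naturality_assoc, ← unit_mul, Category.assoc, h₂,
      tensorHom_def']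
    simp [whisker_exchange_assoc]

lemma hom_ext {g g' : mon X ⟶ A} (h : unit X ≫ g.hom = unit X ≫ g'.hom) : g = g' := by
  have key (g : mon X ⟶ A) : g.hom = descX (unit X ≫ g.hom) :=
    eq_descX (IsMonHom.one_hom g.hom) (IsMonHom.mul_hom g.hom)
  ext
  rw [key g, h, ← key g']

def homEquiv (X : C) (A : Mon C) : (mon X ⟶ A) ≃ (X ⟶ (Mon.forget C).obj A) where
  toFun g := unit X ≫ g.hom
  invFun f := desc f
  left_inv g := hom_ext (unit_descX _)
  right_inv f := unit_descX f

variable (C) in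
/-- The free algebra functor. -/
def free : C ⥤ Mon C :=
  Adjunction.leftAdjointOfEquiv (G := Mon.forget C) homEquiv
    fun _ _ _ _ _ ↦ (Category.assoc _ _ _).symm

variable (C) in
/-- The free algebra functor is left adjoint to the forgetful functor. -/
def adj : free C ⊣ Mon.forget C :=
  Adjunction.adjunctionOfEquivLeft (G := Mon.forget C) homEquiv
    fun _ _ _ _ _ ↦ (Category.assoc _ _ _).symm

end
end FreeMon

/-! ### The reflexive pair is sifted. -/

section Sifted
open WalkingReflexivePair

/-- Every cospan can be moved to one with apex `zero`. Two cospans over `zero` are linked through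
apex `one`, whose two maps to `zero` yield both. -/
lemma isConnected_structuredArrow_diag (x y : WalkingReflexivePair) :
    IsConnected (StructuredArrow (x, y) (Functor.diag WalkingReflexivePair)) := by
  let mk (z : WalkingReflexivePair) (f : x ⟶ z) (g : y ⟶ z) :
    StructuredArrow (x, y) (Functor.diag WalkingReflexivePair) :=
    StructuredArrow.mk (Y := z) ((f, g) : (x, y) ⟶ (z, z))
  let hom {z z' : WalkingReflexivePair} (f : x ⟶ z) (g : y ⟶ z) (h : z ⟶ z') :
    mk z f g ⟶ mk z' (f ≫ h) (g ≫ h) := StructuredArrow.homMk h rfl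
  have mk_surj (t : StructuredArrow (x, y) (Functor.diag WalkingReflexivePair)) :
      t = mk t.right t.hom.1 t.hom.2 := rfl
  have toZero (z : WalkingReflexivePair) (f : x ⟶ z) (g : y ⟶ z) :
      ∃ (f' : x ⟶ zero) (g' : y ⟶ zero), Zigzag (mk z f g) (mk zero f' g') := by
    cases z
    · exact ⟨f, g, Relation.ReflTransGen.refl⟩
    · exact ⟨_, _, Zigzag.of_hom (hom f g .left)⟩
  have span (f : x ⟶ one) (g : y ⟶ one) :
      Zigzag (mk zero (f ≫ .left) (g ≫ .left)) (mk zero (f ≫ .right) (g ≫ .right)) :=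
    (Zigzag.of_inv (hom f g .left)).trans (Zigzag.of_hom (hom f g .right))
  have zero_zero (f f' : x ⟶ zero) (g g' : y ⟶ zero) :
      Zigzag (mk zero f g) (mk zero f' g') := by
    cases x <;> cases y
    · rcases f; rcases f'; rcases g; rcases g'
      exact Relation.ReflTransGen.refl
    · rcases f; rcases f'
      have h := span .reflexion (𝟙 _)
      rcases g <;> rcases g'
      exacts [Relation.ReflTransGen.refl, h, h.symm, Relation.ReflTransGen.refl]
    · rcases g; rcases g'
      have h := span (𝟙 _) .reflexion
      rcases f <;> rcases f'
      exacts [Relation.ReflTransGen.refl, h, h.symm, Relation.ReflTransGen.refl]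
    · have h₁ : Zigzag (mk zero .left .left) (mk zero .right .right) := span (𝟙 _) (𝟙 _)
      -- Here the reflexion is essential: `left ≫ reflexion` followed by either map to `zero` is
      -- `left`, so one coordinate stays fixed while the other moves.
      have h₂ : Zigzag (mk zero .left .left) (mk zero .right .left) :=
        span (𝟙 _) .leftCompReflexion
      have h₃ : Zigzag (mk zero .left .left) (mk zero .left .right) :=
        span .leftCompReflexion (𝟙 _)
      have key (f : one ⟶ zero) (g : one ⟶ zero) :
          Zigzag (mk zero .left .left) (mk zero f g) := by
        rcases f <;> rcases g
        exacts [Relation.ReflTransGen.refl, h₃, h₂, h₁]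
      exact (key f g).symm.trans (key f' g')
  have : Nonempty (StructuredArrow (x, y) (Functor.diag WalkingReflexivePair)) := by
    have (x : WalkingReflexivePair) : Nonempty (x ⟶ zero) := by
      cases x
      exacts [⟨𝟙 _⟩, ⟨.left⟩]
    exact ⟨mk zero (this x).some (this y).some⟩
  refine zigzag_isConnected fun s t ↦ ?_
  obtain ⟨f, g, h⟩ := toZero s.right s.hom.1 s.hom.2
  obtain ⟨f', g', h'⟩ := toZero t.right t.hom.1 t.hom.2
  exact (h.trans (zero_zero f f' g g')).trans h'.symm

instance : IsSifted WalkingReflexivePair where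
  out := fun ⟨x, y⟩ ↦ isConnected_structuredArrow_diag x y
  nonempty := ⟨zero⟩

end Sifted

/-! ### Sifted colimits of algebras are computed in the ambient category. -/

section MonColimits
variable {C : Type u} [Category.{v} C] [MonoidalCategory C]
  {J : Type u₁} [Category.{v₁} J] [IsSifted J]
  [∀ X : C, PreservesColimitsOfShape J (tensorLeft X)]
  [∀ X : C, PreservesColimitsOfShape J (tensorRight X)]

instance (X : C) : PreservesColimitsOfShape J ((curriedTensor C).obj X) :=
  inferInstanceAs (PreservesColimitsOfShape J (tensorLeft X))
instance (X : C) : PreservesColimitsOfShape J ((curriedTensor C).flip.obj X) :=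
  inferInstanceAs (PreservesColimitsOfShape J (tensorRight X))

/-- The tensor product of two sifted colimits. -/
def isColimitTensor {F G : J ⥤ C} {c : Cocone F} {d : Cocone G} (hc : IsColimit c)
    (hd : IsColimit d) : IsColimit (c.tensor d) := hc.tensor hd

namespace MonColimit
variable (F : J ⥤ Mon C) {c : Cocone (F ⋙ Mon.forget C)} (hc : IsColimit c)

variable (c) in
def leg (j : J) : (F.obj j).X ⟶ c.pt := c.ι.app j

lemma w {i j : J} (f : i ⟶ j) : (F.map f).hom ≫ leg F c j = leg F c i := c.w f

variable {F} in
include hc in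
lemma hom_ext {Z : C} {a b : c.pt ⟶ Z} (h : ∀ j, leg F c j ≫ a = leg F c j ≫ b) : a = b :=
  hc.hom_ext h

variable {F} in
include hc in
lemma hom_ext₂ {Z : C} {a b : c.pt ⊗ c.pt ⟶ Z}
    (h : ∀ j, (leg F c j ⊗ₘ leg F c j) ≫ a = (leg F c j ⊗ₘ leg F c j) ≫ b) : a = b :=
  (isColimitTensor hc hc).hom_ext h

variable {F} in
include hc in
lemma hom_ext₃ {Z : C} {a b : (c.pt ⊗ c.pt) ⊗ c.pt ⟶ Z}
    (h : ∀ j, ((leg F c j ⊗ₘ leg F c j) ⊗ₘ leg F c j) ≫ a =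
      ((leg F c j ⊗ₘ leg F c j) ⊗ₘ leg F c j) ≫ b) : a = b :=
  (isColimitTensor (isColimitTensor hc hc) hc).hom_ext h

variable (c) in
def one : 𝟙_ C ⟶ c.pt := η[(F.obj (Classical.choice IsSifted.nonempty)).X] ≫ leg F c _

def mul : c.pt ⊗ c.pt ⟶ c.pt :=
  (isColimitTensor hc hc).desc (Cocone.mk c.pt
    { app j := μ[(F.obj j).X] ≫ leg F c j
      naturality i j f := by
        refine Eq.trans ?_ (Category.comp_id _).symm
        change ((F.map f).hom ⊗ₘ (F.map f).hom) ≫ μ[(F.obj j).X] ≫ leg F c j =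
          μ[(F.obj i).X] ≫ leg F c i
        rw [← IsMonHom.mul_hom_assoc, w] })

lemma fac (j : J) : (leg F c j ⊗ₘ leg F c j) ≫ mul F hc = μ[(F.obj j).X] ≫ leg F c j :=
  (isColimitTensor hc hc).fac (Cocone.mk c.pt _) j

/-- The unit was defined through an arbitrary index. The composites agree along every morphism of
`J`, and a sifted category is connected. -/
lemma one_eq (j : J) : one F c = η[(F.obj j).X] ≫ leg F c j := by
  refine constant_of_preserves_morphisms (fun j ↦ η[(F.obj j).X] ≫ leg F c j) (fun i j f ↦ ?_) _ _
  rw [← w F f, IsMonHom.one_hom_assoc]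

/-- The algebra structure on a sifted colimit of algebras. -/
def pt : Mon C :=
  letI : MonObj c.pt :=
    { one := one F c
      mul := mul F hc
      one_mul := by
        rw [← cancel_epi (λ_ c.pt).inv]
        refine hom_ext hc fun j ↦ ?_
        rw [leftUnitor_inv_naturality_assoc, whisker_exchange_assoc, one_eq F j,
          comp_whiskerRight_assoc, ← tensorHom_def_assoc, fac]
        simp
      mul_one := by
        rw [← cancel_epi (ρ_ c.pt).inv]
        refine hom_ext hc fun j ↦ ?_
        rw [rightUnitor_inv_naturality_assoc, ← whisker_exchange_assoc, one_eq F j,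
          MonoidalCategory.whiskerLeft_comp_assoc, ← tensorHom_def'_assoc, fac]
        simp
      mul_assoc := by
        refine hom_ext₃ hc fun j ↦ ?_
        have h := fac F hc j
        have h₁ : μ[(F.obj j).X] ≫ leg F c j ⊗ₘ leg F c j =
          μ[(F.obj j).X] ▷ (F.obj j).X ≫ (leg F c j ⊗ₘ leg F c j) := by
          simp [MonoidalCategory.tensorHom_def]
        have h₂ : leg F c j ⊗ₘ μ[(F.obj j).X] ≫ leg F c j =
          (F.obj j).X ◁ μ[(F.obj j).X] ≫ (leg F c j ⊗ₘ leg F c j) := by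
          simp [tensorHom_def']
        rw [associator_naturality_assoc, ← tensorHom_id, ← id_tensorHom,
          tensorHom_comp_tensorHom_assoc, tensorHom_comp_tensorHom_assoc, h, Category.comp_id,
          h₁, h₂, Category.assoc, Category.assoc, h]
        simp }
  ⟨c.pt⟩

/-- The cocone of algebras on a sifted colimit. -/
def cocone : Cocone F :=
  Cocone.mk (pt F hc)
    { app j :=
        { hom := c.ι.app j
          isMonHom_hom := ⟨(one_eq F j).symm, (fac F hc j).symm⟩ }
      naturality i j f := by
        ext
        exact c.ι.naturality f }

def desc (s : Cocone F) : c.pt ⟶ s.pt.X := hc.desc ((Mon.forget C).mapCocone s)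

lemma leg_desc (s : Cocone F) (j : J) : leg F c j ≫ desc F hc s = (s.ι.app j).hom := hc.fac _ j

def isColimitCocone : IsColimit (cocone F hc) where
  desc s :=
    { hom := desc F hc s
      isMonHom_hom :=
        { one_hom := by
            have j : J := Classical.choice IsSifted.nonempty
            change one F c ≫ _ = _
            rw [one_eq F j, Category.assoc, leg_desc]
            exact IsMonHom.one_hom (s.ι.app j).hom
          mul_hom := by
            refine hom_ext₂ hc fun j ↦ ?_
            change (leg F c j ⊗ₘ leg F c j) ≫ mul F hc ≫ desc F hc s =
              (leg F c j ⊗ₘ leg F c j) ≫ (desc F hc s ⊗ₘ desc F hc s) ≫ μ[s.pt.X]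
            rw [reassoc_of% (fac F hc j), leg_desc, tensorHom_comp_tensorHom_assoc, leg_desc]
            exact IsMonHom.mul_hom (s.ι.app j).hom } }
  fac s j := by
    ext
    exact hc.fac _ j
  uniq s m h := by
    ext
    exact hc.uniq ((Mon.forget C).mapCocone s) _ fun j ↦ congr_arg Mon.Hom.hom (h j)

end MonColimit

instance : CreatesColimitsOfShape J (Mon.forget C) where
  CreatesColimit {F} := createsColimitOfReflectsIso fun _ hc ↦
    { liftedCocone := MonColimit.cocone F hc
      validLift := Cocone.ext (Iso.refl _) (fun _ ↦ Category.comp_id _)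
      makesColimit := MonColimit.isColimitCocone F hc }

end MonColimits

/-! ### All colimits of algebras. -/

section MonHasColimits
variable {C : Type u} [Category.{v} C] [MonoidalCategory C]
  [HasColimitsOfShape WalkingReflexivePair C]
  [∀ X : C, PreservesColimitsOfShape WalkingReflexivePair (tensorLeft X)]
  [∀ X : C, PreservesColimitsOfShape WalkingReflexivePair (tensorRight X)]

instance hasReflexiveCoequalizers_mon : HasReflexiveCoequalizers (Mon C) :=
  hasReflexiveCoequalizers_iff.1
    (hasColimitsOfShape_of_hasColimitsOfShape_createsColimitsOfShape (Mon.forget C))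

/-- A coequalizer of a reflexive pair is a colimit over the walking reflexive pair, hence a sifted
colimit. -/
lemma preservesColimit_reflexive {A B : Mon C} (f g : A ⟶ B) [IsReflexivePair f g] :
    PreservesColimit (parallelPair f g) (Mon.forget C) := by
  have : PreservesColimit (WalkingParallelPair.inclusionWalkingReflexivePair ⋙
    ofIsReflexivePair f g) (Mon.forget C) := inferInstance
  exact preservesColimit_of_iso_diagram _ (inclusionWalkingReflexivePairOfIsReflexivePairIso f g)

variable [HasCoproductsOfShape ℕ C]
  [∀ Y : C, PreservesColimitsOfShape (Discrete ℕ) (tensorLeft Y)]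
  [∀ Y : C, PreservesColimitsOfShape (Discrete ℕ) (tensorRight Y)]
  {J : Type u₁} [Category.{v₁} J]

open Functor in
/-- Every diagram of algebras has a functorial presentation by free algebras. -/
def regularEpiCounit (G : J ⥤ Mon C) :
    RegularEpi (((FreeMon.adj C).whiskerRight J).counit.app G) where
  W := ((G ⋙ Mon.forget C) ⋙ FreeMon.free C ⋙ Mon.forget C) ⋙ FreeMon.free C
  left := whiskerRight (whiskerRight (((FreeMon.adj C).whiskerRight J).counit.app G)
    (Mon.forget C)) (FreeMon.free C)
  right := ((FreeMon.adj C).whiskerRight J).counit.app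
    ((G ⋙ Mon.forget C) ⋙ FreeMon.free C)
  w := by
    ext j : 2
    have := (FreeMon.adj C).counit_naturality ((FreeMon.adj C).counit.app (G.obj j))
    simpa using this
  isColimit := by
    refine evaluationJointlyReflectsColimits _ fun j ↦ ?_
    -- The canonical presentation of an algebra by free ones is a reflexive pair, so the
    -- conservative forgetful functor preserves and hence reflects its coequalizer.
    have := preservesColimit_reflexive
      ((FreeMon.free C).map ((Mon.forget C).map ((FreeMon.adj C).counit.app (G.obj j))))
      ((FreeMon.adj C).counit.app ((FreeMon.free C).obj ((Mon.forget C).obj (G.obj j))))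
    have : ReflectsColimit (parallelPair
      ((FreeMon.free C).map ((Mon.forget C).map ((FreeMon.adj C).counit.app (G.obj j))))
      ((FreeMon.adj C).counit.app ((FreeMon.free C).obj ((Mon.forget C).obj (G.obj j)))))
      (Mon.forget C) := reflectsColimit_of_reflectsIsomorphisms _ _
    have h := Monad.MonadicityInternal.counitCoequalizerOfReflectsCoequalizer
      (adj := FreeMon.adj C) (G.obj j)
    refine (isColimitMapCoconeCoforkEquiv ((evaluation J (Mon C)).obj j) _).symm ?_
    refine (Cofork.isColimitOfIsos _ h _ (Iso.refl _) (Iso.refl _) (Iso.refl _) ?_ ?_ ?_)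
    · simp
    · simp
    · simp only [Adjunction.whiskerRight_counit_app_app, evaluation_obj_map, Cofork.π_ofπ, Iso.refl_inv, Iso.refl_hom]
      exact (Category.id_comp _).trans (Category.comp_id _)

/-- Adjoint triangle theorem: the constant-diagram functor followed by the pointwise forgetful
functor is `Mon.forget C ⋙ Functor.const J`, a composite of right adjoints. The left adjoint lifts
because the pointwise counits are regular epimorphisms and reflexive coequalizers of algebras exist.
-/
lemma hasColimitsOfShape_mon [HasColimitsOfShape J C] : HasColimitsOfShape J (Mon C) := by
  rw [hasColimitsOfShape_iff_isRightAdjoint_const]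
  have := (FreeMon.adj C).isRightAdjoint
  have : (Functor.const J : C ⥤ J ⥤ C).IsRightAdjoint :=
    hasColimitsOfShape_iff_isRightAdjoint_const.1 inferInstance
  have : (Functor.const J ⋙ (Functor.whiskeringRight J _ _).obj (Mon.forget C)).IsRightAdjoint :=
    inferInstanceAs (Mon.forget C ⋙ Functor.const J).IsRightAdjoint
  exact isRightAdjoint_triangle_lift _ ((FreeMon.adj C).whiskerRight J) regularEpiCounit

end MonHasColimits

/-! ### Right modules as algebras over a monad. -/

namespace RMod
variable {C : Type u} [Category.{v} C] [MonoidalCategory C] (R : Mon C)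

/-- The monad `- ⊗ R`. -/
def monad : Monad C :=
  CategoryTheory.Monad.mk (tensorRight R.X) {
      app X := (ρ_ X).inv ≫ X ◁ η[R.X]
      naturality X Y f := by
        change f ≫ (ρ_ Y).inv ≫ Y ◁ η[R.X] = ((ρ_ X).inv ≫ X ◁ η[R.X]) ≫ f ▷ R.X
        rw [Category.assoc, whisker_exchange, rightUnitor_inv_naturality_assoc] }
    {
      app X := (α_ X R.X R.X).hom ≫ X ◁ μ[R.X]
      naturality X Y f := by
        change f ▷ R.X ▷ R.X ≫ (α_ Y R.X R.X).hom ≫ Y ◁ μ[R.X] =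
          ((α_ X R.X R.X).hom ≫ X ◁ μ[R.X]) ≫ f ▷ R.X
        rw [Category.assoc, whisker_exchange, associator_naturality_left_assoc] }
    (assoc := fun X ↦ by
      change ((α_ X R.X R.X).hom ≫ X ◁ μ[R.X]) ▷ R.X ≫ (α_ X R.X R.X).hom ≫ X ◁ μ[R.X] =
        ((α_ (X ⊗ R.X) R.X R.X).hom ≫ (X ⊗ R.X) ◁ μ[R.X]) ≫ (α_ X R.X R.X).hom ≫ X ◁ μ[R.X]
      simp only [comp_whiskerRight, Category.assoc, associator_naturality_middle_assoc,
        associator_naturality_right_assoc, ← MonoidalCategory.whiskerLeft_comp, MonObj.mul_assoc]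
      simp)
    (left_unit := fun X ↦ by
      change ((ρ_ (X ⊗ R.X)).inv ≫ (X ⊗ R.X) ◁ η[R.X]) ≫ (α_ X R.X R.X).hom ≫ X ◁ μ[R.X] = 𝟙 _
      simp [← MonoidalCategory.whiskerLeft_comp])
    (right_unit := fun X ↦ by
      change ((ρ_ X).inv ≫ X ◁ η[R.X]) ▷ R.X ≫ (α_ X R.X R.X).hom ≫ X ◁ μ[R.X] = 𝟙 _
      rw [comp_whiskerRight_assoc, whiskerRight_unit_mul])

/-- Right modules are algebras over the monad `- ⊗ R`. -/
def equivAlgebra : RMod R ≌ (monad R).Algebra where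
  functor :=
    { obj M :=
        { A := M.X
          a := M.act
          unit := by
            change ((ρ_ M.X).inv ≫ M.X ◁ η[R.X]) ≫ M.act = 𝟙 _
            simp
          assoc := by
            change ((α_ M.X R.X R.X).hom ≫ M.X ◁ μ[R.X]) ≫ M.act = M.act ▷ R.X ≫ M.act
            simp }
      map f := { f := f.hom, h := f.act_hom.symm } }
  inverse :=
    { obj M :=
        { X := M.A
          act := M.a
          act_one := by
            have h : ((ρ_ M.A).inv ≫ M.A ◁ η[R.X]) ≫ M.a = 𝟙 _ := M.unit
            rw [← cancel_epi (ρ_ M.A).inv]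
            exact ((Category.assoc _ _ _).symm.trans h).trans (Iso.inv_hom_id _).symm
          act_mul := by
            have h : ((α_ M.A R.X R.X).hom ≫ M.A ◁ μ[R.X]) ≫ M.a = M.a ▷ R.X ≫ M.a := M.assoc
            rw [← cancel_epi (α_ M.A R.X R.X).hom]
            exact ((Category.assoc _ _ _).symm.trans h).trans (Iso.hom_inv_id_assoc _ _).symm }
      map f := { hom := f.f, act_hom := f.h.symm } }
  unitIso := Iso.refl _
  counitIso := Iso.refl _

def equivAlgebraForget : (equivAlgebra R).functor ⋙ (monad R).forget ≅ forget R := Iso.refl _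

/-- Free right modules. -/
def free : C ⥤ RMod R := (monad R).free ⋙ (equivAlgebra R).inverse

/-- The adjunction between free right modules and the forgetful functor. -/
def adj : free R ⊣ forget R :=
  ((monad R).adj.comp (equivAlgebra R).symm.toAdjunction).ofNatIsoRight (equivAlgebraForget R)

instance : CreatesLimitsOfSize.{v₁, u₁} (forget R) :=
  inferInstanceAs (CreatesLimitsOfSize.{v₁, u₁} ((equivAlgebra R).functor ⋙ (monad R).forget))

instance createsColimitsOfShape {J : Type u₁} [Category.{v₁} J]
    [∀ X : C, PreservesColimitsOfShape J (tensorRight X)] :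
    CreatesColimitsOfShape J (forget R) := by
  have : PreservesColimitsOfShape J (monad R).toFunctor :=
    inferInstanceAs (PreservesColimitsOfShape J (tensorRight R.X))
  exact inferInstanceAs (CreatesColimitsOfShape J ((equivAlgebra R).functor ⋙ (monad R).forget))

end RMod

/-! ### Opposite algebras, exchanging left and right modules. -/

section Reverse
variable {C : Type u} [Category.{v} C] [MonoidalCategory C] [SymmetricCategory C]

/-- The opposite algebra. -/
def rev (R : Mon C) : Mon C :=
  letI : MonObj R.X :=
    { one := η[R.X]
      mul := (β_ R.X R.X).hom ≫ μ[R.X]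
      one_mul := by simp
      mul_one := by simp
      mul_assoc := by
        -- Reversing three factors does not depend on which adjacent pair is swapped first: the
        -- hexagons and Yang–Baxter.
        have h : (β_ (R.X ⊗ R.X) R.X).hom ≫ R.X ◁ (β_ R.X R.X).hom =
          (α_ R.X R.X R.X).hom ≫ (β_ R.X (R.X ⊗ R.X)).hom ≫ (β_ R.X R.X).hom ▷ R.X ≫
            (α_ R.X R.X R.X).hom := by
          rw [BraidedCategory.braiding_tensor_right_hom, BraidedCategory.braiding_tensor_left_hom]
          simp only [Category.assoc, ← BraidedCategory.yang_baxter]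
        simp only [comp_whiskerRight, MonoidalCategory.whiskerLeft_comp, Category.assoc,
          BraidedCategory.braiding_naturality_left_assoc,
          BraidedCategory.braiding_naturality_right_assoc, MonObj.mul_assoc]
        rw [reassoc_of% h] }
  ⟨R.X⟩

def revMap {R S : Mon C} (f : R ⟶ S) : rev R ⟶ rev S :=
  { hom := f.hom
    isMonHom_hom :=
      { one_hom := IsMonHom.one_hom f.hom
        mul_hom := by
          change ((β_ R.X R.X).hom ≫ μ[R.X]) ≫ f.hom = (f.hom ⊗ₘ f.hom) ≫ (β_ S.X S.X).hom ≫ μ[S.X]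
          rw [BraidedCategory.braiding_naturality_assoc, Category.assoc, IsMonHom.mul_hom] } }

/-- A left module as a right module over the opposite algebra. -/
def toRMod {R : Mon C} (M : LMod R) : RMod (rev R) where
  X := M.X
  act := (β_ M.X R.X).hom ≫ lact M
  act_one := by
    change M.X ◁ η[R.X] ≫ (β_ M.X R.X).hom ≫ lact M = (ρ_ M.X).hom
    simp [BraidedCategory.braiding_naturality_right_assoc]
  act_mul := by
    change M.X ◁ ((β_ R.X R.X).hom ≫ μ[R.X]) ≫ (β_ M.X R.X).hom ≫ lact M =
      (α_ M.X R.X R.X).inv ≫ ((β_ M.X R.X).hom ≫ lact M) ▷ R.X ≫ (β_ M.X R.X).hom ≫ lact M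
    have h : (β_ M.X (R.X ⊗ R.X)).hom ≫ (β_ R.X R.X).hom ▷ M.X ≫ (α_ R.X R.X M.X).hom =
        (α_ M.X R.X R.X).inv ≫ (β_ (M.X ⊗ R.X) R.X).hom ≫ R.X ◁ (β_ M.X R.X).hom := by
      rw [BraidedCategory.braiding_tensor_right_hom, BraidedCategory.braiding_tensor_left_hom]
      simp only [Category.assoc, Iso.inv_hom_id_assoc, BraidedCategory.yang_baxter]
    simp only [comp_whiskerRight, MonoidalCategory.whiskerLeft_comp, Category.assoc,
      BraidedCategory.braiding_naturality_left_assoc,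
      BraidedCategory.braiding_naturality_right_assoc, mul_lact]
    rw [reassoc_of% h]

section
variable {R : Mon C}

/-- The action on a right module over the opposite algebra. -/
def ract (N : RMod (rev R)) : N.X ⊗ R.X ⟶ N.X := N.act

lemma ract_one (N : RMod (rev R)) : N.X ◁ η[R.X] ≫ ract N = (ρ_ N.X).hom := N.act_one

lemma ract_mul (N : RMod (rev R)) : N.X ◁ μ[R.X] ≫ ract N =
    N.X ◁ (β_ R.X R.X).hom ≫ (α_ N.X R.X R.X).inv ≫ ract N ▷ R.X ≫ ract N := by
  have h : N.X ◁ ((β_ R.X R.X).hom ≫ μ[R.X]) ≫ ract N =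
    (α_ N.X R.X R.X).inv ≫ ract N ▷ R.X ≫ ract N := N.act_mul
  rw [← h, ← MonoidalCategory.whiskerLeft_comp_assoc, SymmetricCategory.symmetry_assoc]

lemma ract_hom {M N : RMod (rev R)} (f : M ⟶ N) : ract M ≫ f.hom = f.hom ▷ R.X ≫ ract N :=
  f.act_hom

end

/-- A right module over the opposite algebra as a left module. -/
def ofRMod {R : Mon C} (N : RMod (rev R)) : LMod R :=
  letI : ModObj R.X N.X :=
    { smul := (β_ R.X N.X).hom ≫ ract N
      one_smul := by
        change η[R.X] ▷ N.X ≫ (β_ R.X N.X).hom ≫ ract N = (λ_ N.X).hom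
        rw [BraidedCategory.braiding_naturality_left_assoc, ract_one]
        simp
      mul_smul := by
        change μ[R.X] ▷ N.X ≫ (β_ R.X N.X).hom ≫ ract N = (α_ R.X R.X N.X).hom ≫
          R.X ◁ ((β_ R.X N.X).hom ≫ ract N) ≫ (β_ R.X N.X).hom ≫ ract N
        have h : (β_ (R.X ⊗ R.X) N.X).hom ≫ N.X ◁ (β_ R.X R.X).hom ≫ (α_ N.X R.X R.X).inv =
            (α_ R.X R.X N.X).hom ≫ R.X ◁ (β_ R.X N.X).hom ≫ (β_ R.X (N.X ⊗ R.X)).hom := by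
          rw [BraidedCategory.braiding_tensor_right_hom, BraidedCategory.braiding_tensor_left_hom]
          simp only [Category.assoc]
        rw [BraidedCategory.braiding_naturality_left_assoc, ract_mul, reassoc_of% h]
        simp }
  ⟨N.X⟩

/-- Left modules are right modules over the opposite algebra. -/
def revEquiv (R : Mon C) : LMod R ≌ RMod (rev R) where
  functor :=
    { obj M := toRMod M
      map {M N} f :=
        { hom := f.hom
          act_hom := by
            change ((β_ M.X R.X).hom ≫ lact M) ≫ f.hom =
              f.hom ▷ R.X ≫ (β_ N.X R.X).hom ≫ lact N
            rw [BraidedCategory.braiding_naturality_left_assoc, Category.assoc, lact_hom] } }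
  inverse :=
    { obj N := ofRMod N
      map {M N} f := Mod.Hom.mk' (M := ofRMod M) (N := ofRMod N) f.hom (by
        change ((β_ R.X M.X).hom ≫ ract M) ≫ f.hom = R.X ◁ f.hom ≫ (β_ R.X N.X).hom ≫ ract N
        rw [BraidedCategory.braiding_naturality_right_assoc, Category.assoc,
          ract_hom]) }
  unitIso := NatIso.ofComponents (fun M ↦
    { hom := Mod.Hom.mk' (M := M) (N := ofRMod (toRMod M)) (𝟙 M.X) (by
        change lact M ≫ 𝟙 M.X = R.X ◁ 𝟙 M.X ≫ (β_ R.X M.X).hom ≫ (β_ M.X R.X).hom ≫ lact M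
        simp)
      inv := Mod.Hom.mk' (M := ofRMod (toRMod M)) (N := M) (𝟙 M.X) (by
        change ((β_ R.X M.X).hom ≫ (β_ M.X R.X).hom ≫ lact M) ≫ 𝟙 M.X = R.X ◁ 𝟙 M.X ≫ lact M
        simp)
      hom_inv_id := Mod.hom_ext _ _ (Category.comp_id _)
      inv_hom_id := Mod.hom_ext _ _ (Category.comp_id _) })
    (fun g ↦ Mod.hom_ext _ _ ((Category.comp_id _).trans (Category.id_comp _).symm))
  counitIso := NatIso.ofComponents (fun N ↦
    { hom := RMod.Hom.mk (M := toRMod (ofRMod N)) (N := N) (𝟙 N.X) (by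
        change ((β_ N.X R.X).hom ≫ (β_ R.X N.X).hom ≫ ract N) ≫ 𝟙 N.X =
          𝟙 N.X ▷ R.X ≫ ract N
        simp)
      inv := RMod.Hom.mk (M := N) (N := toRMod (ofRMod N)) (𝟙 N.X) (by
        change ract N ≫ 𝟙 N.X = 𝟙 N.X ▷ R.X ≫ (β_ N.X R.X).hom ≫ (β_ R.X N.X).hom ≫ ract N
        simp)
      hom_inv_id := RMod.hom_ext _ _ (Category.comp_id _)
      inv_hom_id := RMod.hom_ext _ _ (Category.comp_id _) })
    (fun g ↦ RMod.hom_ext _ _ ((Category.comp_id _).trans (Category.id_comp _).symm))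
  functor_unitIso_comp M := RMod.hom_ext _ _ (Category.comp_id _)

variable (R : Mon C)

def revEquivForget : (revEquiv R).functor ⋙ RMod.forget (rev R) ≅ Mod.forget R.X := Iso.refl _

/-- Free left modules. -/
def freeL : C ⥤ LMod R := RMod.free (rev R) ⋙ (revEquiv R).inverse

/-- The adjunction between free left modules and the forgetful functor. -/
def adjFreeL : freeL R ⊣ Mod.forget R.X :=
  ((RMod.adj (rev R)).comp (revEquiv R).symm.toAdjunction).ofNatIsoRight (revEquivForget R)

instance createsLimitsModForget : CreatesLimitsOfSize.{v₁, u₁} (Mod.forget (D := C) R.X) :=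
  inferInstanceAs (CreatesLimitsOfSize.{v₁, u₁} ((revEquiv R).functor ⋙ RMod.forget (rev R)))

instance createsColimitsModForget {J : Type u₁} [Category.{v₁} J]
    [∀ X : C, PreservesColimitsOfShape J (tensorRight X)] :
    CreatesColimitsOfShape J (Mod.forget (D := C) R.X) :=
  inferInstanceAs (CreatesColimitsOfShape J ((revEquiv R).functor ⋙ RMod.forget (rev R)))

end Reverse

/-! ### Closure properties of the weak saturation. -/

section WeakSaturation
variable {D : Type u₁} [Category.{v₁} D] (S : MorphismProperty D)

lemma le_weakSaturation : S ≤ weakSaturation S := fun _ _ f hf _ _ h ↦ h f hf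

instance : (weakSaturation S).IsStableUnderCobaseChange where
  of_isPushout sq hf P hP h :=
    have := hP.pushouts
    P.of_isPushout sq (hf P hP h)

instance : (weakSaturation S).IsStableUnderRetracts where
  of_retract r hf P hP h :=
    have := hP.retracts
    P.of_retract r (hf P hP h)

instance : MorphismProperty.IsStableUnderTransfiniteComposition.{v₁} (weakSaturation S) where
  isStableUnderTransfiniteCompositionOfShape J _ _ _ _ := by
    refine ⟨fun _ _ f hf P hP h ↦ ?_⟩
    have := hP.transfinite
    obtain ⟨hf⟩ := hf
    exact MorphismProperty.transfiniteCompositionsOfShape_le P J _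
      ⟨{ hf.toTransfiniteCompositionOfShape with map_mem := fun j hj ↦ hf.map_mem j hj P hP h }⟩

lemma pushouts_le_weakSaturation : S.pushouts ≤ weakSaturation S :=
  MorphismProperty.pushouts_le_iff.2 (le_weakSaturation S)

end WeakSaturation

/-! ### Cells and pushout-products. -/

section Cells
variable {C : Type u} [Category.{v} C] [ModelCategory C] [MonoidalCategory C]

variable (C) in
/-- Pushouts of maps `f ⊗ X` with `f` a trivial cofibration. -/
abbrev tensorCells : MorphismProperty C := (trivialCofTensor C).pushouts

lemma trivialCofTensor_le_tensorCells : trivialCofTensor C ≤ tensorCells C :=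
  MorphismProperty.le_pushouts _

/-- Tensoring preserves pushouts, and `(f ⊗ Y) ⊗ X` is `f ⊗ (Y ⊗ X)`, again one of the generating
maps. -/
lemma tensorCells_whiskerRight [∀ X : C, PreservesColimitsOfSize.{0, 0} (tensorRight X)] {A B : C}
    {q : A ⟶ B} (hq : tensorCells C q) (X : C) : tensorCells C (q ▷ X) := by
  obtain ⟨_, _, _, _, _, hf, sq⟩ := hq
  cases hf with
  | mk f Y hf =>
    refine (tensorCells C).of_isPushout (sq.map (tensorRight X)) ?_
    exact ((tensorCells C).arrow_mk_iso_iff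
      (Arrow.isoMk (f := Arrow.mk (f ▷ Y ▷ X)) (g := Arrow.mk (f ▷ (Y ⊗ X)))
        (α_ _ _ _) (α_ _ _ _) (by simp))).2
      (trivialCofTensor_le_tensorCells _ (.mk f (Y ⊗ X) hf))

variable [BraidedCategory C]

lemma tensorCells_whiskerLeft (X : C) {K L : C} (j : K ⟶ L) (hj : trivialCofibrations C j) :
    tensorCells C (X ◁ j) :=
  ((tensorCells C).arrow_mk_iso_iff
    (Arrow.isoMk (β_ _ _) (β_ _ _) (by simp))).2
    (trivialCofTensor_le_tensorCells _ (.mk j X hj))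

/-- The gap map of a square obtained from maps `A ⟶ B` and `K ⟶ L`. -/
def gap {A B K L Q : C} {g : A ⟶ B} {j : K ⟶ L} {a : B ⊗ K ⟶ Q} {b : A ⊗ L ⟶ Q}
    (sq : IsPushout (g ▷ K) (A ◁ j) a b) : Q ⟶ B ⊗ L :=
  sq.desc (B ◁ j) (g ▷ L) (whisker_exchange _ _).symm

section
variable {A B K L Q : C} {g : A ⟶ B} {j : K ⟶ L} {a : B ⊗ K ⟶ Q} {b : A ⊗ L ⟶ Q}
    (sq : IsPushout (g ▷ K) (A ◁ j) a b)

@[simp] lemma inl_gap : a ≫ gap sq = B ◁ j := sq.inl_desc _ _ _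
@[simp] lemma inr_gap : b ≫ gap sq = g ▷ L := sq.inr_desc _ _ _

/-- The braiding moves `X` to the right end, identifying the gap map of `g ⊗ X` and `j` with the
pushout-product of `g` and `j` tensored with `X`. That pushout-product is a trivial cofibration, so
the result is a single generating map. -/
lemma gap_whiskerRight [∀ X : C, PreservesColimitsOfSize.{0, 0} (tensorRight X)]
    (hpp : PushoutProductAxiom C) (hg : trivialCofibrations C g) (hj : trivialCofibrations C j)
    (X : C) {Q' : C} {a' : (B ⊗ X) ⊗ K ⟶ Q'} {b' : (A ⊗ X) ⊗ L ⟶ Q'}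
    (sq' : IsPushout (g ▷ X ▷ K) ((A ⊗ X) ◁ j) a' b') : tensorCells C (gap sq') := by
  let P := Functor.PushoutObjObj.ofHasPushout (curriedTensor C) g j
  have hP : trivialCofibrations C P.ι := ⟨hpp.cof g j hg.1 hj.1, hpp.weq g j hg.1 hj.1 (Or.inl hg.2)⟩
  let sh (U V : C) : (U ⊗ X) ⊗ V ≅ (U ⊗ V) ⊗ X :=
    α_ U X V ≪≫ whiskerLeftIso U (β_ X V) ≪≫ (α_ U V X).symm
  have hU {U U' : C} (f : U ⟶ U') (V : C) : f ▷ X ▷ V ≫ (sh U' V).hom = (sh U V).hom ≫ f ▷ V ▷ X := by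
    simp only [sh, Iso.trans_hom, whiskerLeftIso_hom, Iso.symm_hom, Category.assoc]
    rw [associator_naturality_left_assoc, ← whisker_exchange_assoc,
      ← associator_inv_naturality_left]
  have hV (U : C) {V V' : C} (f : V ⟶ V') : (U ⊗ X) ◁ f ≫ (sh U V').hom = (sh U V).hom ≫ (U ◁ f) ▷ X := by
    simp only [sh, Iso.trans_hom, whiskerLeftIso_hom, Iso.symm_hom, Category.assoc]
    rw [associator_naturality_right_assoc, ← MonoidalCategory.whiskerLeft_comp_assoc,
      BraidedCategory.braiding_naturality_right, MonoidalCategory.whiskerLeft_comp_assoc,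
      ← associator_inv_naturality_middle]
  have sq'' : IsPushout (g ▷ X ▷ K) ((A ⊗ X) ◁ j) ((sh B K).hom ≫ P.inl ▷ X)
      ((sh A L).hom ≫ P.inr ▷ X) :=
    (P.isPushout.map (tensorRight X)).of_iso (sh A K).symm (sh B K).symm (sh A L).symm (Iso.refl _)
      ((Iso.comp_inv_eq _).2 (by rw [Category.assoc]; exact ((Iso.inv_comp_eq _).2 (hU g K)).symm))
      ((Iso.comp_inv_eq _).2 (by rw [Category.assoc]; exact ((Iso.inv_comp_eq _).2 (hV A j)).symm))
      (by simp) (by simp)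
  let e : Q' ≅ P.pt ⊗ X := IsPushout.isoIsPushout _ _ sq' sq''
  refine ((tensorCells C).arrow_mk_iso_iff
    (Arrow.isoMk (f := Arrow.mk (gap sq')) (g := Arrow.mk (P.ι ▷ X)) e (sh B L) ?_)).2
    (trivialCofTensor_le_tensorCells _ (.mk _ X hP))
  have hl : P.inl ≫ P.ι = B ◁ j := P.inl_ι
  have hr : P.inr ≫ P.ι = g ▷ L := P.inr_ι
  have el : a' ≫ e.hom = (sh B K).hom ≫ P.inl ▷ X := IsPushout.inl_isoIsPushout_hom _ _ sq' sq''
  have er : b' ≫ e.hom = (sh A L).hom ≫ P.inr ▷ X := IsPushout.inr_isoIsPushout_hom _ _ sq' sq''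
  apply sq'.hom_ext
  · simp only [Arrow.mk_hom, reassoc_of% (inl_gap sq'), hV, reassoc_of% el, ← hl, comp_whiskerRight]
  · simp only [Arrow.mk_hom, reassoc_of% (inr_gap sq'), hU, reassoc_of% er, ← hr, comp_whiskerRight]

/-- The gap map of a pushout of `g` is a pushout of a gap map of `g`. -/
lemma gap_isPushout [∀ X : C, PreservesColimitsOfSize.{0, 0} (tensorRight X)]
    {A' B' Q' : C} {g' : A' ⟶ B'} {a' : B' ⊗ K ⟶ Q'} {b' : A' ⊗ L ⟶ Q'}
    (sq' : IsPushout (g' ▷ K) (A' ◁ j) a' b') {s : A ⟶ A'} {t : B ⟶ B'}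
    (h : IsPushout g s t g') : ∃ d, IsPushout d (gap sq) (gap sq') (t ▷ L) := by
  -- Pasting `h ⊗ K` with `sq'` and cancelling `sq` shows that `d` is a pushout of `s ⊗ L`.
  -- Cancelling this from `h ⊗ L` leaves the square of gap maps.
  have h₁ : IsPushout (g ▷ K) (s ▷ K ≫ A' ◁ j) (t ▷ K ≫ a') b' :=
    (h.map (tensorRight K)).paste_vert sq'
  have hw : g ▷ K ≫ t ▷ K ≫ a' = A ◁ j ≫ s ▷ L ≫ b' := by
    rw [h₁.w, whisker_exchange_assoc, Category.assoc]
  let d : Q ⟶ Q' := sq.desc (t ▷ K ≫ a') (s ▷ L ≫ b') hw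
  have ha : a ≫ d = t ▷ K ≫ a' := sq.inl_desc _ _ _
  have hb : b ≫ d = s ▷ L ≫ b' := sq.inr_desc _ _ _
  have h₂ : IsPushout (g ▷ K) (A ◁ j ≫ s ▷ L) (a ≫ d) b' := by
    rwa [whisker_exchange, ha]
  have h₃ : IsPushout b (s ▷ L) d b' := h₂.of_top hb sq
  have h₄ : IsPushout (b ≫ gap sq) (s ▷ L) (t ▷ L) (b' ≫ gap sq') := by
    rw [inr_gap, inr_gap]
    exact h.map (tensorRight L)
  have p : gap sq ≫ t ▷ L = d ≫ gap sq' := by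
    apply sq.hom_ext
    · rw [reassoc_of% (inl_gap sq), reassoc_of% ha, inl_gap, whisker_exchange]
    · rw [reassoc_of% (inr_gap sq), reassoc_of% hb, inr_gap, ← comp_whiskerRight,
        ← comp_whiskerRight, h.w]
  have h₅ : IsPushout (gap sq) d (t ▷ L) (gap sq') := h₄.of_left p h₃
  exact ⟨d, h₅.flip⟩

/-- Passing to gap maps commutes with pushouts in `g`, so the claim reduces to `g` of the form `f ⊗
X`. This stability is what lets the construction of stages be iterated. -/
lemma gap_mem [∀ X : C, PreservesColimitsOfSize.{0, 0} (tensorRight X)]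
    (hpp : PushoutProductAxiom C) (hg : tensorCells C g) (hj : trivialCofibrations C j) :
    tensorCells C (gap sq) := by
  obtain ⟨_, _, _, _, _, hf, h⟩ := hg
  cases hf with
  | mk f X hf =>
    obtain ⟨d, hd⟩ := gap_isPushout (IsPushout.of_hasPushout (f ▷ X ▷ K) ((_ ⊗ X) ◁ j)) sq h.flip
    exact (tensorCells C).of_isPushout hd (gap_whiskerRight hpp hf hj X _)

end
end Cells

/-! ### Attaching cells to right modules. -/

section Attach
variable {C : Type u} [Category.{v} C] [MonoidalCategory C] [ModelCategory C]
  [∀ X : C, PreservesColimitsOfSize.{0, 0} (tensorRight X)]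

instance {J : Type} [SmallCategory J] [HasColimitsOfShape J C] (R : Mon C) :
    HasColimitsOfShape J (RMod R) :=
  hasColimitsOfShape_of_hasColimitsOfShape_createsColimitsOfShape (RMod.forget R)

/-- A cell can be attached to a right module. -/
lemma exists_attach {R : Mon C} (B : RMod R) {Q Y : C} {q : Q ⟶ Y} (hq : tensorCells C q)
    (a : Q ⟶ B.X) : ∃ (B' : RMod R) (g : B ⟶ B') (y : Y ⟶ B'.X), tensorCells C g.hom ∧
      q ≫ y = a ≫ g.hom ∧ ∀ (M : RMod R) (p : B ⟶ M) (z : Y ⟶ M.X), q ≫ z = a ≫ p.hom →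
        ∃ p' : B' ⟶ M, g ≫ p' = p ∧ y ≫ p'.hom = z := by
  let adj := RMod.adj R
  obtain ⟨a', rfl⟩ := (adj.homEquiv Q B).surjective a
  have sq := IsPushout.of_hasPushout ((RMod.free R).map q) a'
  have hf {M : RMod R} (k : B ⟶ M) : adj.homEquiv Q M (a' ≫ k) = adj.homEquiv Q B a' ≫ k.hom :=
    adj.homEquiv_naturality_right _ _
  have hl {M : RMod R} (k : (RMod.free R).obj Y ⟶ M) :
      adj.homEquiv Q M ((RMod.free R).map q ≫ k) = q ≫ adj.homEquiv Y M k :=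
    adj.homEquiv_naturality_left _ _
  have hr {M M' : RMod R} (k : (RMod.free R).obj Y ⟶ M) (l : M ⟶ M') :
      adj.homEquiv Y M' (k ≫ l) = adj.homEquiv Y M k ≫ l.hom :=
    adj.homEquiv_naturality_right _ _
  refine ⟨_, pushout.inr _ _, adj.homEquiv Y _ (pushout.inl ((RMod.free R).map q) a'), ?_, ?_, ?_⟩
  -- The free right module on `q` has underlying map `q ⊗ R`, and pushouts of modules are computed
  -- in `C`.
  · exact (tensorCells C).of_isPushout (sq.map (RMod.forget R)).flip
      (tensorCells_whiskerRight hq R.X)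
  · exact (hl _).symm.trans ((congrArg _ sq.w).trans (hf _))
  · intro M p z hz
    obtain ⟨z', rfl⟩ := (adj.homEquiv Y M).surjective z
    have hw : (RMod.free R).map q ≫ z' = a' ≫ p := (adj.homEquiv Q M).injective ((hl _).trans (hz.trans (hf _).symm))
    exact ⟨sq.desc z' p hw, sq.inr_desc _ _ _, (hr _ _).symm.trans (congrArg _ (sq.inl_desc _ _ _))⟩

end Attach

/-! ### The endomorphism algebra, classifying right module structures. -/

section End
variable {C : Type u} [Category.{v} C] [MonoidalCategory C] [MonoidalClosed C]

/-- The algebra of endomorphisms of an object, acting on the right. -/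
def endMon (M : C) : Mon C :=
  letI : MonObj ((ihom M).obj M) :=
    { one := MonoidalClosed.id M
      mul := MonoidalClosed.comp M M M
      one_mul := by
        rw [← cancel_epi (λ_ _).inv, MonoidalClosed.id_comp, Iso.inv_hom_id]
      mul_one := by
        rw [← cancel_epi (ρ_ _).inv, MonoidalClosed.comp_id, Iso.inv_hom_id]
      mul_assoc := by
        rw [← cancel_epi (α_ _ _ _).inv, MonoidalClosed.assoc, Iso.inv_hom_id_assoc] }
  ⟨(ihom M).obj M⟩

/-- The action of the endomorphism algebra. -/
def evEnd (M : C) : M ⊗ (endMon M).X ⟶ M := (ihom.ev M).app M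

/-- The map to the endomorphism algebra given by a map `M ⊗ X ⟶ M`. -/
def curryEnd {M X : C} (k : M ⊗ X ⟶ M) : X ⟶ (endMon M).X := MonoidalClosed.curry k

lemma evEnd_curry {M X : C} (k : M ⊗ X ⟶ M) : M ◁ curryEnd k ≫ evEnd M = k := by
  have := MonoidalClosed.uncurry_curry k
  rwa [MonoidalClosed.uncurry_eq] at this

lemma endMon_hom_ext {M X : C} {a b : X ⟶ (endMon M).X}
    (h : M ◁ a ≫ evEnd M = M ◁ b ≫ evEnd M) : a = b :=
  MonoidalClosed.uncurry_injective ((MonoidalClosed.uncurry_eq (A := M) (X := M) a).trans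
    (h.trans (MonoidalClosed.uncurry_eq (A := M) (X := M) b).symm))

lemma one_evEnd (M : C) : M ◁ η[(endMon M).X] ≫ evEnd M = (ρ_ M).hom :=
  evEnd_curry (ρ_ M).hom

lemma mul_evEnd (M : C) : M ◁ μ[(endMon M).X] ≫ evEnd M =
    (α_ _ _ _).inv ≫ evEnd M ▷ (endMon M).X ≫ evEnd M :=
  evEnd_curry (MonoidalClosed.compTranspose M M M)

/-- The right module structure on `M` given by a map to the endomorphism algebra. -/
def modOfEnd {P : Mon C} {M : C} (φ : P ⟶ endMon M) : RMod P where
  X := M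
  act := M ◁ φ.hom ≫ evEnd M
  act_one := by
    rw [← MonoidalCategory.whiskerLeft_comp_assoc, IsMonHom.one_hom, one_evEnd]
  act_mul := by
    rw [← MonoidalCategory.whiskerLeft_comp_assoc, IsMonHom.mul_hom,
      MonoidalCategory.whiskerLeft_comp_assoc, mul_evEnd, MonoidalCategory.tensorHom_def,
      MonoidalCategory.whiskerLeft_comp_assoc, comp_whiskerRight_assoc, ← whisker_exchange_assoc]
    simp

/-- The map to the endomorphism algebra given by a right module. -/
def endOfMod {R : Mon C} (M : RMod R) : R ⟶ endMon M.X :=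
  { hom := curryEnd M.act
    isMonHom_hom :=
      { one_hom := by
          apply endMon_hom_ext
          rw [MonoidalCategory.whiskerLeft_comp_assoc, evEnd_curry, one_evEnd, M.act_one]
        mul_hom := by
          apply endMon_hom_ext
          rw [MonoidalCategory.whiskerLeft_comp_assoc, evEnd_curry, M.act_mul,
            MonoidalCategory.whiskerLeft_comp_assoc, mul_evEnd, MonoidalCategory.tensorHom_def,
            MonoidalCategory.whiskerLeft_comp_assoc, associator_inv_naturality_right_assoc,
            whisker_exchange_assoc, evEnd_curry, associator_inv_naturality_middle_assoc,
            ← comp_whiskerRight_assoc, evEnd_curry] } }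

lemma act_endOfMod {R : Mon C} (M : RMod R) : M.X ◁ (endOfMod M).hom ≫ evEnd M.X = M.act :=
  evEnd_curry _

end End

/-! ### Subalgebras. -/

section Sub
variable {C : Type u} [Category.{v} C] [MonoidalCategory C] {P : Mon C} {E : C} (i : E ⟶ P.X)
  [Mono i] (e : 𝟙_ C ⟶ E) (he : e ≫ i = η[P.X]) (m : E ⊗ E ⟶ E) (hm : m ≫ i = (i ⊗ₘ i) ≫ μ[P.X])

/-- A subobject closed under the operations is an algebra. -/
def subMon : Mon C :=
  letI : MonObj E :=
    { one := e
      mul := m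
      one_mul := by
        rw [← cancel_mono i, Category.assoc, hm, tensorHom_def_assoc, ← comp_whiskerRight_assoc, he,
          ← whisker_exchange_assoc, MonObj.one_mul, leftUnitor_naturality]
      mul_one := by
        rw [← cancel_mono i, Category.assoc, hm, tensorHom_def'_assoc,
          ← MonoidalCategory.whiskerLeft_comp_assoc, he,
          whisker_exchange_assoc, MonObj.mul_one, rightUnitor_naturality]
      mul_assoc := by
        have h₁ : m ▷ E ≫ m ≫ i = ((i ⊗ₘ i) ⊗ₘ i) ≫ μ[P.X] ▷ P.X ≫ μ[P.X] := by
          rw [hm, ← tensorHom_id, tensorHom_comp_tensorHom_assoc, hm, Category.id_comp,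
            ← tensorHom_id, tensorHom_comp_tensorHom_assoc, Category.comp_id]
        have h₂ : E ◁ m ≫ m ≫ i = (i ⊗ₘ i ⊗ₘ i) ≫ P.X ◁ μ[P.X] ≫ μ[P.X] := by
          rw [hm, ← id_tensorHom, tensorHom_comp_tensorHom_assoc, hm, Category.id_comp,
            ← id_tensorHom, tensorHom_comp_tensorHom_assoc, Category.comp_id]
        rw [← cancel_mono i]
        simp only [Category.assoc]
        rw [h₁, h₂, MonObj.mul_assoc, associator_naturality_assoc] }
  ⟨E⟩

def subMonIncl : subMon i e he m hm ⟶ P :=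
  { hom := i
    isMonHom_hom := { one_hom := he, mul_hom := hm } }

variable {i e he m hm} in
def subMonLift {R : Mon C} (g : R ⟶ P) (t : R.X ⟶ E) (ht : t ≫ i = g.hom) :
    R ⟶ subMon i e he m hm :=
  { hom := t
    isMonHom_hom :=
      { one_hom := by
          change η[R.X] ≫ t = e
          rw [← cancel_mono i, Category.assoc, ht, IsMonHom.one_hom, he]
        mul_hom := by
          change μ[R.X] ≫ t = (t ⊗ₘ t) ≫ m
          rw [← cancel_mono i, Category.assoc, ht, IsMonHom.mul_hom, Category.assoc, hm,
            tensorHom_comp_tensorHom_assoc, ht] } }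

end Sub

/-! ### Algebras obtained as pushouts along free maps. -/

section FreePushout
variable {C : Type u} [Category.{v} C] [MonoidalCategory C]

/-- `P` is the pushout of the algebra `R` along the map of free algebras on `j : K ⟶ L`. -/
structure IsFreePushout {R P : Mon C} (f : R ⟶ P) {K L : C} (j : K ⟶ L) (k : K ⟶ R.X)
    (l : L ⟶ P.X) : Prop where
  w : k ≫ f.hom = j ≫ l
  exists_desc : ∀ {S : Mon C} (g : R ⟶ S) (t : L ⟶ S.X), k ≫ g.hom = j ≫ t →
    ∃ h : P ⟶ S, f ≫ h = g ∧ l ≫ h.hom = t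
  hom_ext : ∀ {S : Mon C} {h h' : P ⟶ S}, f ≫ h = f ≫ h' → l ≫ h.hom = l ≫ h'.hom → h = h'

namespace IsFreePushout
variable {R P : Mon C} {f : R ⟶ P} {K L : C} {j : K ⟶ L} {k : K ⟶ R.X} {l : L ⟶ P.X}
  (hP : IsFreePushout f j k l)
include hP

/-- A subalgebra of `P` containing the images of `R` and `L` is everything. The equalizer of `a` and
`b`, which are only maps of `C`, is such a subalgebra; the universal property of `P` yields a
section of its inclusion. -/
lemma eq_of_subMon {Z : C} {a b : P.X ⟶ Z} [HasEqualizer a b] (h₁ : f.hom ≫ a = f.hom ≫ b)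
    (h₂ : l ≫ a = l ≫ b) (ho : η[P.X] ≫ a = η[P.X] ≫ b)
    (hm : ∀ {X Y : C} (x : X ⟶ P.X) (y : Y ⟶ P.X), x ≫ a = x ≫ b → y ≫ a = y ≫ b →
      (x ⊗ₘ y) ≫ μ[P.X] ≫ a = (x ⊗ₘ y) ≫ μ[P.X] ≫ b) : a = b := by
  let i := equalizer.ι a b
  have hi : i ≫ a = i ≫ b := equalizer.condition a b
  let m := equalizer.lift ((i ⊗ₘ i) ≫ μ[P.X]) (by simpa using hm i i hi hi)
  have hm' : m ≫ i = _ := equalizer.lift_ι _ _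
  let e := equalizer.lift η[P.X] ho
  have he : e ≫ i = _ := equalizer.lift_ι _ _
  let g : R ⟶ subMon i e he m hm' := subMonLift f (equalizer.lift f.hom h₁) (equalizer.lift_ι _ _)
  have hg : g ≫ subMonIncl i e he m hm' = f := Mon.Hom.ext (equalizer.lift_ι _ _)
  have hl : equalizer.lift l h₂ ≫ i = l := equalizer.lift_ι _ _
  obtain ⟨s, hs, hs'⟩ := hP.exists_desc g (equalizer.lift l h₂) (by
    have hk : k ≫ equalizer.lift f.hom h₁ = j ≫ equalizer.lift l h₂ := by
      rw [← cancel_mono i, Category.assoc, Category.assoc, equalizer.lift_ι, hP.w, hl]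
    exact hk)
  have h : s ≫ subMonIncl i e he m hm' = 𝟙 P := hP.hom_ext
    (by rw [reassoc_of% hs, hg, Category.comp_id])
    ((Category.assoc _ _ _).symm.trans ((congrArg (· ≫ i) hs').trans
      (hl.trans (Category.comp_id _).symm)))
  have h' : s.hom ≫ i = 𝟙 P.X := congrArg Mon.Hom.hom h
  exact (Category.id_comp a).symm.trans ((congrArg (· ≫ a) h'.symm).trans
    ((Category.assoc _ _ _).trans ((congrArg (s.hom ≫ ·) hi).trans
    ((Category.assoc _ _ _).symm.trans ((congrArg (· ≫ b) h').trans (Category.id_comp b))))))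

/-- The elements of `P` whose action commutes with `p` form a subalgebra: after currying, the
equalizer of two maps from `P` to the internal hom from `M` to `N`. So linearity over `R` and `L`
implies linearity over `P`. -/
lemma act_comp [MonoidalClosed C] [HasEqualizers C] {M N : RMod P} (p : M.X ⟶ N.X)
    (h₁ : M.X ◁ f.hom ≫ M.act ≫ p = p ▷ R.X ≫ N.X ◁ f.hom ≫ N.act)
    (h₂ : M.X ◁ l ≫ M.act ≫ p = p ▷ L ≫ N.X ◁ l ≫ N.act) : M.act ≫ p = p ▷ P.X ≫ N.act := by
  apply MonoidalClosed.curry_injective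
  have key {X : C} (x : X ⟶ P.X) : x ≫ MonoidalClosed.curry (M.act ≫ p) =
      x ≫ MonoidalClosed.curry (p ▷ P.X ≫ N.act) ↔
      M.X ◁ x ≫ M.act ≫ p = p ▷ X ≫ N.X ◁ x ≫ N.act := by
    rw [← MonoidalClosed.curry_natural_left, ← MonoidalClosed.curry_natural_left,
      MonoidalClosed.curry_injective.eq_iff, whisker_exchange_assoc]
  apply hP.eq_of_subMon ((key _).2 h₁) ((key _).2 h₂)
  · rw [key, M.act_one_assoc, N.act_one, rightUnitor_naturality]
  · intro X Y x y hx hy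
    rw [key] at hx hy
    rw [← Category.assoc, ← Category.assoc, key]
    simp only [MonoidalCategory.whiskerLeft_comp, Category.assoc, RMod.act_mul_assoc, RMod.act_mul]
    rw [MonoidalCategory.tensorHom_def, MonoidalCategory.whiskerLeft_comp,
      MonoidalCategory.whiskerLeft_comp]
    simp only [Category.assoc]
    have e (M : RMod P) : M.X ◁ x ▷ Y ≫ M.X ◁ P.X ◁ y ≫ (α_ M.X P.X P.X).inv ≫ M.act ▷ P.X =
        (α_ M.X X Y).inv ≫ (M.X ◁ x ≫ M.act) ▷ Y ≫ M.X ◁ y := by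
      rw [associator_inv_naturality_right_assoc, whisker_exchange,
        associator_inv_naturality_middle_assoc, comp_whiskerRight_assoc]
    rw [reassoc_of% e M, reassoc_of% e N, hy, ← comp_whiskerRight_assoc, Category.assoc, hx,
      comp_whiskerRight_assoc, ← associator_inv_naturality_left_assoc]

end IsFreePushout
end FreePushout

/-! ### One step of the construction of an extension of scalars. -/

section Stages
variable {C : Type u} [Category.{v} C] [MonoidalCategory C] [SymmetricCategory C] [ModelCategory C]
  [∀ X : C, PreservesColimitsOfSize.{0, 0} (tensorRight X)]
variable {R : Mon C} {K L : C} (j : K ⟶ L) (k : K ⟶ R.X) (N : RMod R) (l : N.X ⊗ L ⟶ N.X)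

/-- A stage in the construction of extension of scalars along a pushout of a free map. -/
structure Stage where
  A : RMod R
  B : RMod R
  g : A ⟶ B
  a : A.X ⊗ L ⟶ B.X
  w : A.X ◁ j ≫ a = A.X ◁ k ≫ A.act ≫ g.hom
  p : B ⟶ N
  hp : a ≫ p.hom = (g.hom ≫ p.hom) ▷ L ≫ l
  hg : tensorCells C g.hom

variable {j k N l}

/-- The cell `O ⊗ j` is attached along the action of `K` through `k`: all products of `O` with `L`
are added freely, subject to agreement on `K`. -/
lemma exists_stage (hl : N.X ◁ j ≫ l = N.X ◁ k ≫ N.act) (hj : trivialCofibrations C j) (O : RMod R)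
    (p : O ⟶ N) : ∃ (s : Stage j k N l) (i : O ⟶ s.B), i ≫ s.p = p ∧ tensorCells C i.hom := by
  obtain ⟨B, g, y, hg, hy, hd⟩ := exists_attach O (tensorCells_whiskerLeft O.X j hj)
    (O.X ◁ k ≫ O.act)
  obtain ⟨p', hp, hp'⟩ := hd _ p (p.hom ▷ L ≫ l) (by
    rw [Category.assoc, p.act_hom, whisker_exchange_assoc, whisker_exchange_assoc, hl])
  exact ⟨⟨O, B, g, y, by simpa using hy, p', by rw [hp', ← hp]; rfl, hg⟩, g, hp, hg⟩

/-- Products of `B` with `L` are already defined on `B ⊗ K`, by the `R`-action, and on `A ⊗ L`, by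
`s.a`. The cell to attach is therefore the gap map from the union of these two to `B ⊗ L`; attaching
all of `B ⊗ j` would lose compatibility with `s.a`. -/
lemma Stage.exists_next [∀ X : C, PreservesColimitsOfSize.{0, 0} (tensorLeft X)]
    (hpp : PushoutProductAxiom C) (hl : N.X ◁ j ≫ l = N.X ◁ k ≫ N.act)
    (hj : trivialCofibrations C j) (s : Stage j k N l) :
    ∃ (B : RMod R) (g : s.B ⟶ B) (a : s.B.X ⊗ L ⟶ B.X) (p : B ⟶ N),
      s.B.X ◁ j ≫ a = s.B.X ◁ k ≫ s.B.act ≫ g.hom ∧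
      a ≫ p.hom = (g.hom ≫ p.hom) ▷ L ≫ l ∧
      tensorCells C g.hom ∧ s.g.hom ▷ L ≫ a = s.a ≫ g.hom ∧ g ≫ p = s.p := by
  have sq := IsPushout.of_hasPushout (s.g.hom ▷ K) (s.A.X ◁ j)
  have hc : s.g.hom ▷ K ≫ s.B.X ◁ k ≫ s.B.act = s.A.X ◁ j ≫ s.a := by
    rw [s.w, ← whisker_exchange_assoc, s.g.act_hom]
  obtain ⟨B, g, y, hg, hy, hd⟩ := exists_attach s.B (gap_mem sq hpp s.hg hj)
    (sq.desc (s.B.X ◁ k ≫ s.B.act) s.a hc)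
  have hyl : s.B.X ◁ j ≫ y = (s.B.X ◁ k ≫ s.B.act) ≫ g.hom := by
    rw [← inl_gap sq, Category.assoc, hy, sq.inl_desc_assoc]
  have hyr : s.g.hom ▷ L ≫ y = s.a ≫ g.hom := by
    rw [← inr_gap sq, Category.assoc, hy, sq.inr_desc_assoc]
  obtain ⟨p', hp, hp'⟩ := hd _ s.p (s.p.hom ▷ L ≫ l) (by
    apply sq.hom_ext
    · rw [sq.inl_desc_assoc, reassoc_of% (inl_gap sq), Category.assoc, s.p.act_hom,
        whisker_exchange_assoc, whisker_exchange_assoc, hl]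
    · rw [sq.inr_desc_assoc, reassoc_of% (inr_gap sq), s.hp, comp_whiskerRight_assoc])
  exact ⟨B, g, y, p', by simpa using hyl, by rw [hp', ← hp]; rfl, hg, hyr, hp⟩

end Stages

section
variable {D : Type u₁} [Category.{v₁} D] (S : MorphismProperty D)

instance : (weakSaturation S).IsMultiplicative :=
  MorphismProperty.IsStableUnderTransfiniteComposition.instIsMultiplicative.{v₁} _

lemma weakSaturation_infinite {F : ℕ ⥤ D} {c : Cocone F} (hc : IsColimit c)
    (h : ∀ n, weakSaturation S (F.map (homOfLE (Nat.le_add_right n 1)))) :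
    weakSaturation S (c.ι.app 0) := by
  have := MorphismProperty.IsStableUnderTransfiniteComposition.shrink₀.{v₁} (weakSaturation S)
  exact MorphismProperty.transfiniteCompositionsOfShape_le _ _ _
    (MorphismProperty.TransfiniteCompositionOfShape.mem (J := ℕ) _
      { F := F
        isoBot := Iso.refl _
        incl := c.ι
        isColimit := hc
        fac := Category.id_comp _
        map_mem := fun n _ ↦ h n })

end

/-! ### The sequence of stages and its colimit. -/

section Sequence
variable {C : Type u} [Category.{v} C] [MonoidalCategory C] [SymmetricCategory C] [ModelCategory C]
  [∀ X : C, PreservesColimitsOfSize.{0, 0} (tensorRight X)]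
  [∀ X : C, PreservesColimitsOfSize.{0, 0} (tensorLeft X)]
variable {R : Mon C} {K L : C} (j : K ⟶ L) (k : K ⟶ R.X) (N : RMod R) (l : N.X ⊗ L ⟶ N.X)

/-- A sequence of right modules over `N` with maps `X n ⊗ L ⟶ X (n + 1)`. -/
structure StageSeq where
  X : ℕ → RMod R
  g (n : ℕ) : X n ⟶ X (n + 1)
  a (n : ℕ) : (X n).X ⊗ L ⟶ (X (n + 1)).X
  p (n : ℕ) : X n ⟶ N
  w (n : ℕ) : (X n).X ◁ j ≫ a n = (X n).X ◁ k ≫ (X n).act ≫ (g n).hom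
  hp (n : ℕ) : a n ≫ (p (n + 1)).hom = (p n).hom ▷ L ≫ l
  hg (n : ℕ) : tensorCells C (g n).hom
  ha (n : ℕ) : (g n).hom ▷ L ≫ a (n + 1) = a n ≫ (g (n + 1)).hom
  gp (n : ℕ) : g n ≫ p (n + 1) = p n

variable {j k N l}

lemma exists_stageSeq (hpp : PushoutProductAxiom C) (hl : N.X ◁ j ≫ l = N.X ◁ k ≫ N.act)
    (hj : trivialCofibrations C j) (O : RMod R) (p : O ⟶ N) :
    ∃ (s : StageSeq j k N l) (i : O ⟶ s.X 0), i ≫ s.p 0 = p ∧ tensorCells C i.hom := by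
  obtain ⟨s₀, i, hi, hi'⟩ := exists_stage hl hj O p
  choose B g a p h₁ h₂ h₃ h₄ h₅ using fun s : Stage j k N l ↦ s.exists_next hpp hl hj
  let next (s : Stage j k N l) : Stage j k N l := ⟨s.B, B s, g s, a s, h₁ s, p s, h₂ s, h₃ s⟩
  let S (n : ℕ) : Stage j k N l := Nat.rec s₀ (fun _ ↦ next) n
  exact ⟨{ X := fun n ↦ (S n).B
           g := fun n ↦ g (S n)
           a := fun n ↦ a (S n)
           p := fun n ↦ (S n).p
           w := fun n ↦ h₁ (S n)
           hp := fun n ↦ (h₂ (S n)).trans (congrArg (fun t ↦ RMod.Hom.hom t ▷ L ≫ l) (h₅ (S n)))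
           hg := fun n ↦ h₃ (S n)
           ha := fun n ↦ h₄ (S (n + 1))
           gp := fun n ↦ h₅ (S n) }, i, hi, hi'⟩

namespace StageSeq
variable (s : StageSeq j k N l)

abbrev functor : ℕ ⥤ RMod R := Functor.ofSequence s.g

variable [HasColimitsOfShape ℕ C]

abbrev pt : RMod R := colimit s.functor

def leg (n : ℕ) : s.X n ⟶ s.pt := colimit.ι s.functor n

lemma g_leg (n : ℕ) : s.g n ≫ s.leg (n + 1) = s.leg n := by
  have := colimit.w s.functor (homOfLE (Nat.le_add_right n 1))
  rwa [Functor.ofSequence_map_homOfLE_succ] at this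

lemma g_leg_hom (n : ℕ) : (s.g n).hom ≫ (s.leg (n + 1)).hom = (s.leg n).hom :=
  congrArg RMod.Hom.hom (s.g_leg n)

/-- The underlying cocone. -/
def isColimitForget : IsColimit ((RMod.forget R).mapCocone (colimit.cocone s.functor)) :=
  isColimitOfPreserves _ (colimit.isColimit _)

def isColimitTensor (Y : C) :
    IsColimit ((RMod.forget R ⋙ tensorRight Y).mapCocone (colimit.cocone s.functor)) :=
  isColimitOfPreserves _ (colimit.isColimit _)

lemma tensor_hom_ext {Y Z : C} {x y : s.pt.X ⊗ Y ⟶ Z}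
    (h : ∀ n, (s.leg n).hom ▷ Y ≫ x = (s.leg n).hom ▷ Y ≫ y) : x = y :=
  (s.isColimitTensor Y).hom_ext h

/-- The partial products raise the index by one, and `s.ha` makes them a cocone. Since `- ⊗ L`
preserves the colimit, they become an everywhere defined product in the limit. -/
lemma exists_act : ∃ t : s.pt.X ⊗ L ⟶ s.pt.X,
    ∀ n, (s.leg n).hom ▷ L ≫ t = s.a n ≫ (s.leg (n + 1)).hom := by
  let α : s.functor ⋙ RMod.forget R ⋙ tensorRight L ⟶ (Functor.const ℕ).obj s.pt.X :=
    NatTrans.ofSequence (fun n ↦ s.a n ≫ (s.leg (n + 1)).hom) (fun n ↦ by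
      change RMod.Hom.hom (s.functor.map (homOfLE (Nat.le_add_right n 1))) ▷ L ≫
        s.a (n + 1) ≫ (s.leg (n + 1 + 1)).hom = (s.a n ≫ (s.leg (n + 1)).hom) ≫ 𝟙 _
      rw [Functor.ofSequence_map_homOfLE_succ]
      change (s.g n).hom ▷ L ≫ s.a (n + 1) ≫ (s.leg (n + 1 + 1)).hom = _
      rw [reassoc_of% (s.ha n), s.g_leg_hom, Category.comp_id])
  exact ⟨(s.isColimitTensor L).desc (Cocone.mk _ α), (s.isColimitTensor L).fac (Cocone.mk _ α)⟩

lemma exists_proj : ∃ p : s.pt ⟶ N, ∀ n, s.leg n ≫ p = s.p n := by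
  let α : s.functor ⟶ (Functor.const ℕ).obj N :=
    NatTrans.ofSequence s.p (fun n ↦ by
      rw [Functor.ofSequence_map_homOfLE_succ]
      exact (s.gp n).trans (Category.comp_id _).symm)
  exact ⟨colimit.desc s.functor (Cocone.mk _ α), fun n ↦ colimit.ι_desc (Cocone.mk _ α) n⟩

end StageSeq

/-- The colimit carries actions of `R` and of `L` that agree on `K`, maps to `N` compatibly, and is
reached from `O` by cells. No universal property is recorded; the retract argument below needs only
these maps. -/
lemma exists_limit_stage [HasColimitsOfShape ℕ C] (hpp : PushoutProductAxiom C)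
    (hl : N.X ◁ j ≫ l = N.X ◁ k ≫ N.act)
    (hj : trivialCofibrations C j) (O : RMod R) (p₀ : O ⟶ N) :
    ∃ (M : RMod R) (i : O ⟶ M) (t : M.X ⊗ L ⟶ M.X) (p : M ⟶ N),
      M.X ◁ j ≫ t = M.X ◁ k ≫ M.act ∧ t ≫ p.hom = p.hom ▷ L ≫ l ∧ i ≫ p = p₀ ∧
      weakSaturation (trivialCofTensor C) i.hom := by
  obtain ⟨s, i, hi, hi'⟩ := exists_stageSeq hpp hl hj O p₀
  obtain ⟨t, ht⟩ := s.exists_act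
  obtain ⟨p, hp⟩ := s.exists_proj
  have hp' (n : ℕ) : (s.leg n).hom ≫ p.hom = (s.p n).hom := congrArg RMod.Hom.hom (hp n)
  refine ⟨s.pt, i ≫ s.leg 0, t, p, ?_, ?_, by rw [Category.assoc, hp, hi], ?_⟩
  · apply s.tensor_hom_ext
    intro n
    rw [← whisker_exchange_assoc, ht, reassoc_of% (s.w n), s.g_leg_hom, (s.leg n).act_hom,
      whisker_exchange_assoc]
  · apply s.tensor_hom_ext
    intro n
    rw [reassoc_of% (ht n), hp', s.hp, ← comp_whiskerRight_assoc, hp']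
  · refine MorphismProperty.comp_mem _ _ _ (pushouts_le_weakSaturation _ _ hi') ?_
    refine weakSaturation_infinite _ s.isColimitForget (fun n ↦ ?_)
    have h : s.functor.map (homOfLE (Nat.le_add_right n 1)) = s.g n :=
      Functor.ofSequence_map_homOfLE_succ _ _
    change weakSaturation _ (RMod.Hom.hom (s.functor.map (homOfLE (Nat.le_add_right n 1))))
    rw [h]
    exact pushouts_le_weakSaturation _ _ (s.hg n)

end Sequence

/-! ### The unit along a pushout of a free map. -/

section
variable {C : Type u} [Category.{v} C] [MonoidalCategory C] [SymmetricCategory C] [MonoidalClosed C]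
  [ModelCategory C] [HasColimitsOfShape ℕ C]

/-- Extension of scalars along a pushout of a free map on a trivial cofibration. -/
lemma IsFreePushout.unit_mem (hpp : PushoutProductAxiom C) {R P : Mon C} {f : R ⟶ P} {K L : C}
    {j : K ⟶ L} {k : K ⟶ R.X} {l : L ⟶ P.X} (hP : IsFreePushout f j k l)
    (hj : trivialCofibrations C j) (O : RMod R) :
    weakSaturation (trivialCofTensor C) ((adjR f).unit.app O).hom := by
  let N : RMod P := (extR f).obj O
  let u : O ⟶ (resR f).obj N := (adjR f).unit.app O
  -- The sequence is built over `O ⊗_R P` itself, on which `L` acts through `l`; this provides the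
  -- comparison map `p` back to it.
  obtain ⟨M, i, t, p, h₁, h₂, h₃, hi⟩ := exists_limit_stage (N := (resR f).obj N)
    (l := N.X ◁ l ≫ N.act) (k := k) (j := j) hpp (by
      change N.X ◁ j ≫ N.X ◁ l ≫ N.act = N.X ◁ k ≫ N.X ◁ f.hom ≫ N.act
      simp only [← MonoidalCategory.whiskerLeft_comp_assoc, hP.w]) hj O u
  -- The `R`-action and the map `t` agree on `K`, so they define an algebra map from `P` to the
  -- endomorphisms of `M`, that is, a `P`-module structure.
  obtain ⟨φ, hφ, hφ'⟩ := hP.exists_desc (endOfMod M) (curryEnd t) (by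
    apply endMon_hom_ext
    rw [MonoidalCategory.whiskerLeft_comp_assoc, act_endOfMod,
      MonoidalCategory.whiskerLeft_comp_assoc, evEnd_curry, h₁])
  let M' : RMod P := modOfEnd φ
  have hf : M.X ◁ f.hom ≫ M'.act = M.act := by
    change M.X ◁ f.hom ≫ M.X ◁ φ.hom ≫ evEnd M.X = _
    have h : f.hom ≫ φ.hom = (endOfMod M).hom := congrArg Mon.Hom.hom hφ
    rw [← MonoidalCategory.whiskerLeft_comp_assoc, h, act_endOfMod]
  have hl : M.X ◁ l ≫ M'.act = t := by
    change M.X ◁ l ≫ M.X ◁ φ.hom ≫ evEnd M.X = _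
    rw [← MonoidalCategory.whiskerLeft_comp_assoc, hφ', evEnd_curry]
  let i' : O ⟶ (resR f).obj M' := RMod.Hom.mk (M := O) (N := (resR f).obj M') i.hom (by
    exact i.act_hom.trans (congrArg (i.hom ▷ R.X ≫ ·) hf.symm))
  let q : M' ⟶ N := RMod.Hom.mk (M := M') (N := N) p.hom (hP.act_comp (M := M') (N := N) p.hom
    (by
      exact (Category.assoc _ _ _).symm.trans ((congrArg (· ≫ p.hom) hf).trans p.act_hom))
    (by
      exact (Category.assoc _ _ _).symm.trans ((congrArg (· ≫ p.hom) hl).trans h₂)))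
  let e : N ⟶ M' := ((adjR f).homEquiv O M').symm i'
  have he : u ≫ (resR f).map e = i' := by
    rw [← (adjR f).homEquiv_unit]
    exact Equiv.apply_symm_apply _ _
  have hq : i' ≫ (resR f).map q = u := RMod.hom_ext _ _ (congrArg RMod.Hom.hom h₃)
  -- Both sides are `P`-linear and agree after the unit `u`.
  have heq : e ≫ q = 𝟙 N := by
    apply ((adjR f).homEquiv O N).injective
    rw [(adjR f).homEquiv_unit, (adjR f).homEquiv_unit, Functor.map_comp, CategoryTheory.Functor.map_id]
    exact (Category.assoc _ _ _).symm.trans ((congrArg (· ≫ (resR f).map q) he).trans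
      (hq.trans (Category.comp_id _).symm))
  refine (weakSaturation (trivialCofTensor C)).of_retract (g := i.hom)
    { i := Arrow.homMk (𝟙 O.X) e.hom ((Category.id_comp _).trans (congrArg RMod.Hom.hom he).symm)
      r := Arrow.homMk (𝟙 O.X) p.hom ((Category.id_comp _).trans (congrArg RMod.Hom.hom hq).symm)
      retract := by
        ext
        · exact Category.comp_id _
        · exact congrArg RMod.Hom.hom heq } hi

end

/-! ### The unit of extension of scalars for right modules. -/

section Unit
variable {C : Type u} [Category.{v} C] [MonoidalCategory C] [HasCoequalizers C]
  [∀ X : C, PreservesColimitsOfSize.{0, 0} (tensorRight X)]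
variable {R S : Mon C} (f : R ⟶ S) (O : RMod R)

/-- The map `O ⟶ O ⊗_R S`. -/
def unitR : O.X ⟶ extRX f O := (ρ_ O.X).inv ≫ O.X ◁ η[S.X] ≫ extRX.π f O

lemma unitR_eq : RMod.Hom.hom ((adjR f).unit.app O) = unitR f O := by
  have h : (adjR f).unit.app O = homEquivR f O _ (𝟙 _) := rfl
  rw [h]
  change (ρ_ O.X).inv ≫ O.X ◁ η[S.X] ≫ extRX.π f O ≫ 𝟙 _ = _
  rw [Category.comp_id, unitR]

variable {f O}

/-- Elementwise, `o ⊗ s = (o ⊗ 1) s`. Consequently an `S`-linear map out of `O ⊗_R S` is determined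
by its restriction along the unit. -/
lemma π_eq : extRX.π f O = unitR f O ▷ S.X ≫ extRX.smul f O := by
  simp only [unitR, comp_whiskerRight, Category.assoc, extRX.π_whiskerRight_smul]
  rw [reassoc_of% whiskerRight_unit_mul S O.X]

lemma π_comp_of_smul {N : RMod S} {H : extRX f O ⟶ N.X}
    (hH : extRX.smul f O ≫ H = H ▷ S.X ≫ N.act) :
    extRX.π f O ≫ H = (unitR f O ≫ H) ▷ S.X ≫ N.act := by
  rw [π_eq, Category.assoc, hH, comp_whiskerRight_assoc]

lemma extRX_lin_ext (N : RMod S) {H H' : extRX f O ⟶ N.X}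
    (hH : extRX.smul f O ≫ H = H ▷ S.X ≫ N.act) (hH' : extRX.smul f O ≫ H' = H' ▷ S.X ≫ N.act)
    (h : unitR f O ≫ H = unitR f O ≫ H') : H = H' :=
  extRX.hom_ext (by rw [π_comp_of_smul hH, π_comp_of_smul hH', h])

lemma extRX_eq_id {p : extRX f O ⟶ extRX f O}
    (hp : extRX.smul f O ≫ p = p ▷ S.X ≫ extRX.smul f O) (h : unitR f O ≫ p = unitR f O) :
    p = 𝟙 _ :=
  extRX_lin_ext ((extR f).obj O) hp
    ((Category.comp_id _).trans (((congrArg (· ≫ extRX.smul f O)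
      (id_whiskerRight (extRX f O) S.X)).trans (Category.id_comp _)).symm))
    (h.trans (Category.comp_id _).symm)

lemma exists_extRX_desc (N : RMod S) (t : O.X ⟶ N.X)
    (ht : O.act ≫ t = t ▷ R.X ≫ N.X ◁ f.hom ≫ N.act) :
    ∃ H : extRX f O ⟶ N.X, extRX.smul f O ≫ H = H ▷ S.X ≫ N.act ∧ unitR f O ≫ H = t := by
  refine ⟨adjRInv (N := N) f t ht, adjRInv_smul (N := N) f t ht, ?_⟩
  have := adjRTo_adjRInv (N := N) f t ht
  simp only [adjRTo] at this
  simpa only [unitR, Category.assoc] using this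

lemma act_unitR : O.act ≫ unitR f O = unitR f O ▷ R.X ≫ extRX f O ◁ f.hom ≫ extRX.smul f O := by
  have := ((adjR f).unit.app O).act_hom
  rw [unitR_eq] at this
  exact this

/-- Extension of scalars is functorial in the algebra. -/
lemma exists_extRX_base {R' S' : Mon C} {f' : R' ⟶ S'} {a : R ⟶ R'} {b : S ⟶ S'}
    (h : f ≫ b = a ≫ f') {O' : RMod R'} (t : O.X ⟶ O'.X)
    (ht : O.act ≫ t = t ▷ R.X ≫ O'.X ◁ a.hom ≫ O'.act) :
    ∃ H : extRX f O ⟶ extRX f' O', extRX.smul f O ≫ H = H ▷ S.X ≫ extRX f' O' ◁ b.hom ≫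
      extRX.smul f' O' ∧ unitR f O ≫ H = t ≫ unitR f' O' := by
  refine exists_extRX_desc ((resR b).obj ((extR f').obj O')) (t ≫ unitR f' O') ?_
  change O.act ≫ t ≫ unitR f' O' =
    (t ≫ unitR f' O') ▷ R.X ≫ extRX f' O' ◁ f.hom ≫ extRX f' O' ◁ b.hom ≫ extRX.smul f' O'
  have h' : f.hom ≫ b.hom = a.hom ≫ f'.hom := congrArg Mon.Hom.hom h
  rw [reassoc_of% ht, act_unitR, ← MonoidalCategory.whiskerLeft_comp_assoc, h',
    MonoidalCategory.whiskerLeft_comp_assoc, comp_whiskerRight_assoc, whisker_exchange_assoc]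

end Unit

/-! ### Extension of scalars as a functor of the algebra. -/

section ExtUnder
variable {C : Type u} [Category.{v} C] [MonoidalCategory C] [HasCoequalizers C]
variable {R : Mon C} (O : RMod R)

/-- The map `O ⊗_R S ⟶ O ⊗_R S'` given by a map of algebras under `R`. -/
def extMap {A B : Under R} (g : A ⟶ B) : extRX A.hom O ⟶ extRX B.hom O :=
  extRX.desc (O.X ◁ g.right.hom ≫ extRX.π B.hom O) (by
    have h : A.hom.hom ≫ g.right.hom = B.hom.hom := congrArg Mon.Hom.hom (Under.w g)
    rw [← whisker_exchange_assoc, extRX.condition, ← h]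
    simp only [← MonoidalCategory.whiskerLeft_comp_assoc, IsMonHom.mul_hom,
      MonoidalCategory.tensorHom_def', comp_whiskerRight, Category.assoc,
      associator_naturality_right_assoc, whisker_exchange_assoc])

@[simp] lemma π_extMap {A B : Under R} (g : A ⟶ B) :
    extRX.π A.hom O ≫ extMap O g = O.X ◁ g.right.hom ≫ extRX.π B.hom O := extRX.π_desc _ _ _ _

/-- Extension of scalars as a functor of the algebra. -/
def extUnder : Under R ⥤ C where
  obj A := extRX A.hom O
  map g := extMap O g
  map_id A := extRX.hom_ext (by simp)
  map_comp g h := extRX.hom_ext (by simp [reassoc_of% (π_extMap O)])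

lemma unitR_extMap {A B : Under R} (g : A ⟶ B) :
    unitR A.hom O ≫ extMap O g = unitR B.hom O := by
  simp only [unitR, Category.assoc, π_extMap]
  rw [← MonoidalCategory.whiskerLeft_comp_assoc, IsMonHom.one_hom]

lemma extMap_smul [∀ X : C, PreservesColimitsOfSize.{0, 0} (tensorRight X)]
    {A B : Under R} (g : A ⟶ B) :
    extRX.smul A.hom O ≫ extMap O g =
      extMap O g ▷ A.right.X ≫ extRX B.hom O ◁ g.right.hom ≫ extRX.smul B.hom O := by
  apply extRX.whisker_hom_ext
  rw [extRX.π_whiskerRight_smul_assoc, π_extMap, ← comp_whiskerRight_assoc, π_extMap,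
    comp_whiskerRight_assoc, ← whisker_exchange_assoc, extRX.π_whiskerRight_smul,
    ← MonoidalCategory.whiskerLeft_comp_assoc, IsMonHom.mul_hom, MonoidalCategory.tensorHom_def,
    associator_naturality_right_assoc, associator_naturality_middle_assoc]
  simp

section Colimit
variable {K : Type w} [SmallCategory K] [IsSifted K]
  [∀ X : C, PreservesColimitsOfShape K (tensorLeft X)]
  [∀ X : C, PreservesColimitsOfShape K (tensorRight X)]
  [HasColimitsOfShape K C]

/-- Extension of scalars preserves sifted colimits of algebras. -/
def isColimitExtUnder {D : K ⥤ Under R} {c : Cocone D}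
    (hc : IsColimit ((Under.forget R).mapCocone c)) : IsColimit ((extUnder O).mapCocone c) := by
  let i (k : K) : D.obj k ⟶ c.pt := c.ι.app k
  -- Siftedness enters here: the colimit of algebras is also a colimit in `C`, and tensoring
  -- preserves it.
  have hX (Y : C) : IsColimit ((Under.forget R ⋙ Mon.forget C ⋙ tensorLeft Y).mapCocone c) :=
    isColimitOfPreserves (Mon.forget C ⋙ tensorLeft Y) hc
  have hX_ext {Y Z : C} {x y : Y ⊗ c.pt.right.X ⟶ Z}
      (h : ∀ k, Y ◁ (i k).right.hom ≫ x = Y ◁ (i k).right.hom ≫ y) : x = y :=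
    (hX Y).hom_ext h
  let leg (s : Cocone (D ⋙ extUnder O)) (k : K) : extRX (D.obj k).hom O ⟶ s.pt := s.ι.app k
  have leg_w (s : Cocone (D ⋙ extUnder O)) {k k' : K} (φ : k ⟶ k') :
      extMap O (D.map φ) ≫ leg s k' = leg s k := s.w φ
  let d (s : Cocone (D ⋙ extUnder O)) : O.X ⊗ c.pt.right.X ⟶ s.pt :=
    (hX O.X).desc (Cocone.mk s.pt
      { app k := extRX.π (D.obj k).hom O ≫ leg s k
        naturality k k' φ := by
          change O.X ◁ (D.map φ).right.hom ≫ extRX.π (D.obj k').hom O ≫ leg s k' =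
            (extRX.π (D.obj k).hom O ≫ leg s k) ≫ 𝟙 _
          rw [Category.comp_id, ← leg_w s φ, reassoc_of% (π_extMap O (D.map φ))] })
  have hd (s : Cocone (D ⋙ extUnder O)) (k : K) : O.X ◁ (i k).right.hom ≫ d s =
      extRX.π (D.obj k).hom O ≫ leg s k := (hX O.X).fac _ k
  have hcond (s : Cocone (D ⋙ extUnder O)) : O.act ▷ c.pt.right.X ≫ d s =
      (α_ O.X R.X c.pt.right.X).hom ≫ O.X ◁ c.pt.hom.hom ▷ c.pt.right.X ≫
        O.X ◁ μ[c.pt.right.X] ≫ d s := by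
    apply hX_ext
    intro k
    have h : (D.obj k).hom.hom ≫ (i k).right.hom = c.pt.hom.hom :=
      congrArg Mon.Hom.hom (Under.w (i k))
    rw [whisker_exchange_assoc, hd, reassoc_of% (extRX.condition (D.obj k).hom O), ← hd, ← h]
    simp only [← MonoidalCategory.whiskerLeft_comp_assoc, IsMonHom.mul_hom,
      MonoidalCategory.tensorHom_def', comp_whiskerRight, Category.assoc,
      associator_naturality_right_assoc, whisker_exchange_assoc]
  let D' (s : Cocone (D ⋙ extUnder O)) : extRX c.pt.hom O ⟶ s.pt := extRX.desc (d s) (hcond s)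
  have hD' (s : Cocone (D ⋙ extUnder O)) : extRX.π c.pt.hom O ≫ D' s = d s := extRX.π_desc _ _ _ _
  have huniq (s : Cocone (D ⋙ extUnder O)) (m : extRX c.pt.hom O ⟶ s.pt)
      (hm : ∀ k, extMap O (i k) ≫ m = leg s k) : m = D' s := by
    apply extRX.hom_ext
    apply hX_ext
    intro k
    rw [hD', hd, ← hm k, reassoc_of% (π_extMap O (i k))]
  exact
    { desc := D'
      fac s k := by
        change extMap O (i k) ≫ D' s = leg s k
        apply extRX.hom_ext
        rw [reassoc_of% (π_extMap O (i k)), hD', hd]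
      uniq s m hm := huniq s m hm }

end Colimit
end ExtUnder

/-! ### Stability of the class of good algebra maps. -/

section ExtClass
variable {C : Type u} [Category.{v} C] [MonoidalCategory C] [SymmetricCategory C] [MonoidalClosed C]
  [ModelCategory C]

variable (C) in
/-- The maps of algebras along which extension of scalars has units in the weak saturation of
`trivialCofTensor C`. -/
def extClass : MorphismProperty (Mon C) := fun R _ f ↦
  ∀ O : RMod R, weakSaturation (trivialCofTensor C) (unitR f O)

/-- An `R`-module `O` becomes an `R'`-module by restriction along the retraction `R' ⟶ R`, and
restricting back along the section returns `O`. Functoriality in the algebra then exhibits the unit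
for `f` as a retract of the unit for `f'`. -/
instance : (extClass C).IsStableUnderRetracts where
  of_retract {R S R' S' f f'} r hf' O := by
    let O' : RMod R' := (resR r.r.left).obj O
    have hi : r.i.left ≫ r.r.left = 𝟙 R := r.retract_left
    have hi' : r.i.left.hom ≫ r.r.left.hom = 𝟙 R.X := congrArg Mon.Hom.hom hi
    have hj : r.i.right ≫ r.r.right = 𝟙 S := r.retract_right
    have hj' : r.i.right.hom ≫ r.r.right.hom = 𝟙 S.X := congrArg Mon.Hom.hom hj
    obtain ⟨H, hH, hu⟩ := exists_extRX_base (f := f) (f' := f') (O := O) (O' := O') r.i_w.symm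
      (𝟙 O.X) (by
        change O.act ≫ 𝟙 O.X = 𝟙 O.X ▷ R.X ≫ O.X ◁ r.i.left.hom ≫ O.X ◁ r.r.left.hom ≫ O.act
        rw [← MonoidalCategory.whiskerLeft_comp_assoc, hi']
        simp)
    obtain ⟨H', hH', hu'⟩ := exists_extRX_base (f := f') (f' := f) (O := O') (O' := O) r.r_w.symm
      (𝟙 O.X) (by
        change (O.X ◁ r.r.left.hom ≫ O.act) ≫ 𝟙 O.X = 𝟙 O.X ▷ R'.X ≫ O.X ◁ r.r.left.hom ≫ O.act
        simp)
    have hHH : H ≫ H' = 𝟙 _ := by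
      refine extRX_eq_id ?_ ?_
      · rw [reassoc_of% hH, hH', comp_whiskerRight_assoc, whisker_exchange_assoc,
          ← MonoidalCategory.whiskerLeft_comp_assoc, hj']
        simp
      · have h₁ : unitR f O ≫ H = unitR f' O' := hu.trans (Category.id_comp _)
        have h₂ : unitR f' O' ≫ H' = unitR f O := hu'.trans (Category.id_comp _)
        rw [reassoc_of% h₁]
        exact h₂
    exact (weakSaturation (trivialCofTensor C)).of_retract (g := unitR f' O')
      { i := Arrow.homMk (𝟙 O.X) H hu.symm
        r := Arrow.homMk (𝟙 O.X) H' hu'.symm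
        retract := by
          ext
          · exact Category.comp_id _
          · exact hHH } (hf' O')

/-- Associativity of extension of scalars. -/
lemma extMap_mem {R : Mon C} (O : RMod R) {A B : Under R} (g : A ⟶ B)
    (hg : extClass C g.right) : weakSaturation (trivialCofTensor C) (extMap O g) := by
  let N : RMod A.right := (extR A.hom).obj O
  have h : A.hom.hom ≫ g.right.hom = B.hom.hom := congrArg Mon.Hom.hom (Under.w g)
  let ug : extRX A.hom O ⟶ extRX g.right N := unitR g.right N
  have hug : extRX.smul A.hom O ≫ ug = ug ▷ A.right.X ≫
    extRX g.right N ◁ g.right.hom ≫ extRX.smul g.right N := act_unitR (f := g.right) (O := N)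
  -- `p` and `q` compare `(O ⊗_R A) ⊗_A B` with `O ⊗_R B`. One composite being the identity
  -- suffices, since the class is closed under retracts.
  obtain ⟨p, hp, hu⟩ : ∃ p : extRX g.right N ⟶ extRX B.hom O,
      extRX.smul g.right N ≫ p = p ▷ B.right.X ≫ extRX.smul B.hom O ∧ ug ≫ p = extMap O g :=
    exists_extRX_desc (f := g.right) (O := N) ((extR B.hom).obj O)
      (extMap O g) (extMap_smul O g)
  obtain ⟨q, hq, hu'⟩ : ∃ q : extRX B.hom O ⟶ extRX g.right N,
      extRX.smul B.hom O ≫ q = q ▷ B.right.X ≫ extRX.smul g.right N ∧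
      unitR B.hom O ≫ q = unitR A.hom O ≫ ug :=
    exists_extRX_desc (f := B.hom) (O := O) ((extR g.right).obj N)
      (unitR A.hom O ≫ ug) (by
        change O.act ≫ unitR A.hom O ≫ ug = (unitR A.hom O ≫ ug) ▷ R.X ≫
          extRX g.right N ◁ B.hom.hom ≫ extRX.smul g.right N
        have h'' : O.act ≫ unitR A.hom O = unitR A.hom O ▷ R.X ≫ extRX A.hom O ◁ A.hom.hom ≫
          extRX.smul A.hom O := act_unitR
        rw [reassoc_of% h'', hug, ← h, MonoidalCategory.whiskerLeft_comp_assoc,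
          comp_whiskerRight_assoc, whisker_exchange_assoc])
  have hqp : q ≫ p = 𝟙 _ := by
    refine extRX_eq_id ?_ ?_
    · rw [reassoc_of% hq, hp, comp_whiskerRight_assoc]
    · rw [reassoc_of% hu', hu, unitR_extMap]
  have hgq : extMap O g ≫ q = ug := by
    refine extRX_lin_ext (f := A.hom) (O := O) ((resR g.right).obj ((extR g.right).obj N)) ?_ hug ?_
    · change extRX.smul A.hom O ≫ extMap O g ≫ q = (extMap O g ≫ q) ▷ A.right.X ≫
        extRX g.right N ◁ g.right.hom ≫ extRX.smul g.right N
      rw [reassoc_of% (extMap_smul O g), hq, whisker_exchange_assoc, comp_whiskerRight_assoc]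
    · have h₁ : unitR A.hom O ≫ extMap O g ≫ q = unitR A.hom O ≫ ug := by
        rw [reassoc_of% (unitR_extMap O g), hu']
      exact h₁
  exact (weakSaturation (trivialCofTensor C)).of_retract (g := ug)
    { i := Arrow.homMk (𝟙 _) q ((Category.id_comp _).trans hgq.symm)
      r := Arrow.homMk (𝟙 _) p ((Category.id_comp _).trans hu.symm)
      retract := by
        ext
        · exact Category.comp_id _
        · exact hqp } (hg N)

/-- A propositional equality is allowed because the lemma is applied to the transition map of a
diagram at `⊥ ≤ ⊥`. -/
lemma isIso_unitR_id {R : Mon C} {f : R ⟶ R} (hf : f = 𝟙 R) (O : RMod R) : IsIso (unitR f O) := by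
  subst hf
  obtain ⟨p, hp, hu⟩ := exists_extRX_desc (f := 𝟙 R) (O := O) O (𝟙 O.X) (by simp)
  refine ⟨p, hu, ?_⟩
  have hO' : extRX (𝟙 R) O ◁ Mon.Hom.hom (𝟙 R) ≫ extRX.smul (𝟙 R) O = extRX.smul (𝟙 R) O := by
    change extRX (𝟙 R) O ◁ 𝟙 R.X ≫ extRX.smul (𝟙 R) O = extRX.smul (𝟙 R) O
    rw [MonoidalCategory.whiskerLeft_id, Category.id_comp]
  refine extRX_eq_id ?_ (by rw [reassoc_of% hu])
  rw [reassoc_of% hp, act_unitR, comp_whiskerRight_assoc, hO']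

/-- The diagram is regarded under its bottom algebra and `O ⊗ -` is applied. This preserves the
colimits involved, its successor maps are good by `extMap_mem`, and its bottom term is `O`; so the
unit is itself a transfinite composition. -/
instance [HasColimits C] : MorphismProperty.IsStableUnderTransfiniteComposition.{v} (extClass C) where
  isStableUnderTransfiniteCompositionOfShape J _ _ _ _ := by
    refine ⟨?_⟩
    rintro X Y f ⟨hf⟩
    suffices h : extClass C (hf.incl.app ⊥) from
      ((extClass C).arrow_mk_iso_iff (Arrow.isoMk (f := Arrow.mk f) (g := Arrow.mk (hf.incl.app ⊥))
        hf.isoBot.symm (Iso.refl _) (by simp))).2 h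
    intro O
    let s : (Functor.const J).obj (hf.F.obj ⊥) ⟶ hf.F :=
      { app j := hf.F.map (homOfLE bot_le)
        naturality i j φ := by
          change 𝟙 _ ≫ hf.F.map _ = hf.F.map _ ≫ hf.F.map φ
          rw [← hf.F.map_comp, Category.id_comp]
          rfl }
    let D : J ⥤ Under (hf.F.obj ⊥) := Under.lift hf.F s
    let c : Cocone D := Cocone.mk (Under.mk (hf.incl.app ⊥))
      { app j := Under.homMk (hf.incl.app j) (by
          change hf.F.map _ ≫ hf.incl.app j = hf.incl.app ⊥
          rw [hf.incl.naturality]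
          exact Category.comp_id _)
        naturality i j φ := by
          ext1
          exact hf.incl.naturality φ }
    have hc : IsColimit ((Under.forget _).mapCocone c) := hf.isColimit
    have h₀ : IsIso (unitR (hf.F.map (homOfLE (bot_le (a := (⊥ : J))))) O) :=
      isIso_unitR_id (hf.F.map_id _) O
    have hw : (D ⋙ extUnder O).IsWellOrderContinuous := ⟨fun m hm ↦ by
      -- Nonemptiness is what makes the segment below a limit element filtered, hence sifted.
      have : Nonempty (Set.Iio m) := ⟨⊥, bot_lt_iff_ne_bot.2 (by rintro rfl; exact hm.1 isMin_bot)⟩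
      let c' : Cocone ((Set.principalSegIio m).monotone.functor ⋙ D) :=
        (Set.principalSegIio m).cocone D
      have hc' : IsColimit ((Under.forget _).mapCocone c') :=
        hf.F.isColimitOfIsWellOrderContinuous m hm
      exact ⟨isColimitExtUnder O hc'⟩⟩
    exact MorphismProperty.transfiniteCompositionsOfShape_le _ J _
      ⟨{ F := D ⋙ extUnder O
         isoBot := (asIso (unitR (hf.F.map (homOfLE (bot_le (a := (⊥ : J))))) O)).symm
         isWellOrderContinuous := hw
         incl := ((extUnder O).mapCocone c).ι
         isColimit := isColimitExtUnder O hc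
         fac := unitR_extMap O (c.ι.app ⊥)
         map_mem := fun j hj ↦ extMap_mem O (D.map (homOfLE (Order.le_succ j))) (hf.map_mem j hj) }⟩

end ExtClass

/-! ### Acyclicity for algebras. -/

section
variable {C : Type u} [Category.{v} C] [MonoidalCategory C] [SymmetricCategory C] [MonoidalClosed C]
  [ModelCategory C] [HasColimits C]

instance : PreservesFilteredColimitsOfSize.{v, v} (Mon.forget C) :=
  ⟨fun J _ _ ↦ have := IsFiltered.isSifted (C := J); inferInstance⟩

instance : HasColimits (Mon C) := ⟨fun _ _ ↦ hasColimitsOfShape_mon⟩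

lemma isFreePushout {R P : Mon C} {f : R ⟶ P} {K L : C} {j : K ⟶ L}
    {k : (FreeMon.free C).obj K ⟶ R} {l : (FreeMon.free C).obj L ⟶ P}
    (sq : IsPushout ((FreeMon.free C).map j) k l f) :
    IsFreePushout f j ((FreeMon.adj C).homEquiv K R k) ((FreeMon.adj C).homEquiv L P l) := by
  let adj := FreeMon.adj C
  have hk {S : Mon C} (g : R ⟶ S) : adj.homEquiv K S (k ≫ g) = adj.homEquiv K R k ≫ g.hom :=
    adj.homEquiv_naturality_right _ _
  have hl {S : Mon C} (g : P ⟶ S) : adj.homEquiv L S (l ≫ g) = adj.homEquiv L P l ≫ g.hom :=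
    adj.homEquiv_naturality_right _ _
  have hj {S : Mon C} (t : (FreeMon.free C).obj L ⟶ S) :
      adj.homEquiv K S ((FreeMon.free C).map j ≫ t) = j ≫ adj.homEquiv L S t :=
    adj.homEquiv_naturality_left _ _
  refine ⟨?_, ?_, ?_⟩
  · exact (hk f).symm.trans ((congrArg _ sq.w.symm).trans (hj l))
  · intro S g t h
    obtain ⟨t, rfl⟩ := (adj.homEquiv L S).surjective t
    have h' : (FreeMon.free C).map j ≫ t = k ≫ g :=
      (adj.homEquiv K S).injective ((hj t).trans (h.symm.trans (hk g).symm))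
    exact ⟨sq.desc t g h', sq.inr_desc _ _ _, (hl _).symm.trans (congrArg _ (sq.inl_desc _ _ _))⟩
  · intro S h h' h₁ h₂
    refine sq.hom_ext ((adj.homEquiv L S).injective ?_) h₁
    exact (hl _).trans (h₂.trans (hl _).symm)

lemma pushouts_free_le_extClass (hpp : PushoutProductAxiom C) :
    ((trivialCofibrations C).map (FreeMon.free C)).pushouts ≤ extClass C := by
  rintro R P f ⟨A, B, p, k, l, ⟨K, L, j, hj, ⟨e⟩⟩, sq⟩ O
  have sq' : IsPushout ((FreeMon.free C).map j) (e.hom.left ≫ k) (e.hom.right ≫ l) f :=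
    sq.flip.of_iso' (Arrow.leftFunc.mapIso e) (Arrow.rightFunc.mapIso e) (Iso.refl _) (Iso.refl _)
      e.hom.w (by simp; rfl) (by simp; rfl) (by simp)
  rw [← unitR_eq]
  exact (isFreePushout sq').unit_mem hpp hj O

/-- Small object argument: the closure properties of `extClass` reduce the claim to pushouts of free
maps on trivial cofibrations. -/
lemma llp_le_extClass (hcomb : IsCombinatorial C) (hpp : PushoutProductAxiom C) :
    ((fibrations C).inverseImage (Mon.forget C)).llp ≤ extClass C :=
  llp_fibrations_le (FreeMon.adj C) hcomb _ (pushouts_free_le_extClass hpp)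

/-- The case `O = R`. The map `s ↦ 1 ⊗ s` makes `S` a retract of `R ⊗_R S` under `R`. -/
lemma hom_mem_of_extClass {R S : Mon C} {f : R ⟶ S} (hf : extClass C f) :
    weakSaturation (trivialCofTensor C) f.hom := by
  obtain ⟨p, hp, hu⟩ := exists_extRX_desc (f := f) (O := RMod.regular R) (RMod.regular S) f.hom (by
    change μ ≫ f.hom = f.hom ▷ R.X ≫ S.X ◁ f.hom ≫ μ
    rw [IsMonHom.mul_hom, MonoidalCategory.tensorHom_def, Category.assoc])
  let p' : extRX f (RMod.regular R) ⟶ S.X := p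
  let u : R.X ⟶ extRX f (RMod.regular R) := unitR f (RMod.regular R)
  have hπ : extRX.π f (RMod.regular R) = u ▷ S.X ≫ extRX.smul f (RMod.regular R) := π_eq
  have hact : μ[R.X] ≫ u = u ▷ R.X ≫ extRX f (RMod.regular R) ◁ f.hom ≫
    extRX.smul f (RMod.regular R) := act_unitR (f := f) (O := RMod.regular R)
  have hp' : extRX.smul f (RMod.regular R) ≫ p' = p' ▷ S.X ≫ μ[S.X] := hp
  have hu' : u ≫ p' = f.hom := hu
  let i : S.X ⟶ extRX f (RMod.regular R) :=
    (λ_ _).inv ≫ (η[R.X] ≫ u) ▷ S.X ≫ extRX.smul f (RMod.regular R)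
  have hi : f.hom ≫ i = u := by
    rw [leftUnitor_inv_naturality_assoc, whisker_exchange_assoc, comp_whiskerRight_assoc, ← hact,
      MonObj.one_mul_assoc, Iso.inv_hom_id_assoc]
  have hip : i ≫ p' = 𝟙 S.X := by
    simp only [i, Category.assoc]
    rw [hp', ← comp_whiskerRight_assoc, Category.assoc, hu', IsMonHom.one_hom, MonObj.one_mul,
      Iso.inv_hom_id]
  exact (weakSaturation (trivialCofTensor C)).of_retract (g := u)
    { i := Arrow.homMk (𝟙 _) i ((Category.id_comp _).trans hi.symm)
      r := Arrow.homMk (𝟙 _) p' ((Category.id_comp _).trans hu'.symm)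
      retract := by
        ext
        · exact Category.comp_id _
        · exact hip } (hf _)

end

/-! ### The unit of extension of scalars for left modules. -/

section UnitL
variable {C : Type u} [Category.{v} C] [MonoidalCategory C] [HasCoequalizers C]
  [∀ X : C, PreservesColimitsOfSize.{0, 0} (tensorLeft X)]
variable {R S : Mon C} (f : R ⟶ S) (O : LMod R)

/-- The map `O ⟶ S ⊗_R O`. -/
def unitL : O.X ⟶ extLX f O := (λ_ O.X).inv ≫ η[S.X] ▷ O.X ≫ extLX.π f O

lemma unitL_eq : Mod.Hom.hom ((adjL f).unit.app O) = unitL f O := by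
  have h : (adjL f).unit.app O = homEquivL f O _ (𝟙 _) := rfl
  rw [h]
  change (λ_ O.X).inv ≫ η[S.X] ▷ O.X ≫ extLX.π f O ≫ 𝟙 _ = _
  rw [Category.comp_id, unitL]

variable {f O}

lemma extLX_π_eq : extLX.π f O = S.X ◁ unitL f O ≫ extLX.smul f O := by
  simp only [unitL, MonoidalCategory.whiskerLeft_comp, Category.assoc, extLX.whiskerLeft_π_smul]
  rw [reassoc_of% whiskerLeft_unit_mul S O.X]

lemma extLX_eq_id {p : extLX f O ⟶ extLX f O}
    (hp : extLX.smul f O ≫ p = S.X ◁ p ≫ extLX.smul f O) (h : unitL f O ≫ p = unitL f O) :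
    p = 𝟙 _ := by
  apply extLX.hom_ext
  rw [extLX_π_eq, Category.assoc, hp, ← MonoidalCategory.whiskerLeft_comp_assoc, h, Category.comp_id]

lemma exists_extLX_desc (N : LMod S) (t : O.X ⟶ N.X)
    (ht : lact O ≫ t = R.X ◁ t ≫ f.hom ▷ N.X ≫ lact N) :
    ∃ H : extLX f O ⟶ N.X, extLX.smul f O ≫ H = S.X ◁ H ≫ lact N ∧ unitL f O ≫ H = t := by
  refine ⟨adjLInv (N := N) f t ht, adjLInv_smul (N := N) f t ht, ?_⟩
  have := adjLTo_adjLInv (N := N) f t ht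
  simp only [adjLTo] at this
  simpa only [unitL, Category.assoc] using this

lemma lact_unitL : lact O ≫ unitL f O = R.X ◁ unitL f O ≫ f.hom ▷ extLX f O ≫ extLX.smul f O := by
  have := lact_hom ((adjL f).unit.app O)
  rw [unitL_eq] at this
  exact this

end UnitL

/-! ### Reduction of left modules to right modules. -/

section Rev
variable {C : Type u} [Category.{v} C] [MonoidalCategory C] [SymmetricCategory C] [MonoidalClosed C]


lemma mul_comp_of_rev {R S : Mon C} {a : R.X ⟶ S.X}
    (h : ((β_ R.X R.X).hom ≫ μ[R.X]) ≫ a = (a ⊗ₘ a) ≫ μ[S.X]) :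
    μ[R.X] ≫ a = (a ⊗ₘ a) ≫ (β_ S.X S.X).hom ≫ μ[S.X] := by
  rw [BraidedCategory.braiding_naturality_assoc, ← h, Category.assoc,
    SymmetricCategory.symmetry_assoc]

lemma rev_mul_comp {R S : Mon C} {a : R.X ⟶ S.X}
    (h : μ[R.X] ≫ a = (a ⊗ₘ a) ≫ (β_ S.X S.X).hom ≫ μ[S.X]) :
    ((β_ R.X R.X).hom ≫ μ[R.X]) ≫ a = (a ⊗ₘ a) ≫ μ[S.X] := by
  rw [Category.assoc, h, BraidedCategory.braiding_naturality_assoc,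
    SymmetricCategory.symmetry_assoc]

def fromRev {R S : Mon C} (a : rev R ⟶ S) : R ⟶ rev S :=
  { hom := a.hom
    isMonHom_hom :=
      { one_hom := IsMonHom.one_hom a.hom
        mul_hom := mul_comp_of_rev (R := R) (IsMonHom.mul_hom a.hom) } }

def toRev {R S : Mon C} (a : R ⟶ rev S) : rev R ⟶ S :=
  { hom := a.hom
    isMonHom_hom :=
      { one_hom := IsMonHom.one_hom a.hom
        mul_hom := rev_mul_comp (S := S) (IsMonHom.mul_hom a.hom) } }

/-- Passing to opposites is an involution that leaves underlying maps unchanged, so lifting problems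
for `revMap f` translate into lifting problems for `f`. -/
lemma revMap_llp {P : MorphismProperty C} {R S : Mon C} {f : R ⟶ S}
    (hf : (P.inverseImage (Mon.forget C)).llp f) : (P.inverseImage (Mon.forget C)).llp (revMap f) := by
  intro X Y p hp
  refine ⟨fun {a b} sq ↦ ?_⟩
  have : HasLiftingProperty f (revMap p) := hf _ hp
  have sq' : CommSq (fromRev a) f (revMap p) (fromRev b) :=
    ⟨Mon.Hom.ext (by have h := congrArg Mon.Hom.hom sq.w; exact h)⟩
  exact ⟨⟨{ l := toRev sq'.lift
            fac_left := Mon.Hom.ext (by have h := congrArg Mon.Hom.hom sq'.fac_left; exact h)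
            fac_right := Mon.Hom.ext (by have h := congrArg Mon.Hom.hom sq'.fac_right; exact h) }⟩⟩

/-- The unit of extension of scalars for left modules is a retract of that for right modules. -/
lemma unitL_retract [HasCoequalizers C] {R S : Mon C} (f : R ⟶ S) (O : LMod R) :
    Nonempty (RetractArrow (unitL f O) (unitR (revMap f) (toRMod O))) := by
  let ER := extRX (revMap f) (toRMod O)
  let sR : ER ⊗ S.X ⟶ ER := extRX.smul (revMap f) (toRMod O)
  let sL : S.X ⊗ extLX f O ⟶ extLX f O := extLX.smul f O
  let uR : O.X ⟶ ER := unitR (revMap f) (toRMod O)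
  have hR : ((β_ O.X R.X).hom ≫ lact O) ≫ uR = uR ▷ R.X ≫ ER ◁ f.hom ≫ sR :=
    act_unitR (f := revMap f) (O := toRMod O)
  have hL : lact O ≫ unitL f O = R.X ◁ unitL f O ≫ f.hom ▷ extLX f O ≫ sL := lact_unitL
  obtain ⟨p, hp, hu⟩ : ∃ p : extLX f O ⟶ ER,
      sL ≫ p = S.X ◁ p ≫ (β_ S.X ER).hom ≫ sR ∧ unitL f O ≫ p = uR :=
    exists_extLX_desc (f := f) (O := O) (ofRMod ((extR (revMap f)).obj (toRMod O))) uR (by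
      change lact O ≫ uR = R.X ◁ uR ≫ f.hom ▷ ER ≫ (β_ S.X ER).hom ≫ sR
      rw [BraidedCategory.braiding_naturality_left_assoc,
        BraidedCategory.braiding_naturality_right_assoc, ← hR]
      simp)
  obtain ⟨q, hq, hu'⟩ : ∃ q : ER ⟶ extLX f O,
      sR ≫ q = q ▷ S.X ≫ (β_ (extLX f O) S.X).hom ≫ sL ∧ uR ≫ q = unitL f O :=
    exists_extRX_desc (f := revMap f) (O := toRMod O) (toRMod ((extL f).obj O)) (unitL f O) (by
      change ((β_ O.X R.X).hom ≫ lact O) ≫ unitL f O =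
        unitL f O ▷ R.X ≫ extLX f O ◁ f.hom ≫ (β_ (extLX f O) S.X).hom ≫ sL
      rw [Category.assoc, hL, BraidedCategory.braiding_naturality_right_assoc,
        BraidedCategory.braiding_naturality_left_assoc])
  -- `p` and `q` come from the two universal properties and are the identity on `O`; the composite
  -- is `S`-linear, so it is determined there.
  have hpq : p ≫ q = 𝟙 _ := by
    refine extLX_eq_id ?_ ?_
    · change sL ≫ p ≫ q = S.X ◁ (p ≫ q) ≫ sL
      rw [reassoc_of% hp, hq, BraidedCategory.braiding_naturality_left_assoc]
      simp
    · rw [reassoc_of% hu, hu']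
  exact ⟨{ i := Arrow.homMk (𝟙 O.X) p ((Category.id_comp _).trans hu.symm)
           r := Arrow.homMk (𝟙 O.X) q ((Category.id_comp _).trans hu'.symm)
           retract := by
             ext
             · exact Category.comp_id _
             · exact hpq }⟩

end Rev

/-! ### Units and relative tensor products. -/

section RelTensor
variable {C : Type u} [Category.{v} C] [MonoidalCategory C] [HasCoequalizers C]
  {R S : Mon C} (f : R ⟶ S)

/-- The map `R ⊗ O ⟶ R ⊗_R O`. -/
def πL (O : LMod R) : R.X ⊗ O.X ⟶ relTensor (RMod.regular R) O := relTensor.π (RMod.regular R) O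

/-- The map `O ⊗ R ⟶ O ⊗_R R`. -/
def πR (O : RMod R) : O.X ⊗ R.X ⟶ relTensor O (Mod.regular R.X) := relTensor.π O (Mod.regular R.X)

/-- `R ⊗_R O` is `O`. -/
lemma isIso_regular_left (O : LMod R) : IsIso ((λ_ O.X).inv ≫ η[R.X] ▷ O.X ≫ πL O) := by
  have hc : μ[R.X] ▷ O.X ≫ πL O = (α_ R.X R.X O.X).hom ≫ R.X ◁ lact O ≫ πL O :=
    relTensor.condition (RMod.regular R) O
  let d : relTensor (RMod.regular R) O ⟶ O.X := relTensor.desc (lact O) (mul_lact O)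
  have hd : πL O ≫ d = lact O := relTensor.π_desc _ _
  refine ⟨d, ?_, ?_⟩
  · rw [Category.assoc, Category.assoc, hd, one_lact, Iso.inv_hom_id]
  · have h₂ : R.X ◁ lact O ≫ πL O = (α_ R.X R.X O.X).inv ≫ μ[R.X] ▷ O.X ≫ πL O := by
      rw [hc, Iso.inv_hom_id_assoc]
    have h₃ : πL O ≫ d ≫ (λ_ O.X).inv ≫ η[R.X] ▷ O.X ≫ πL O = πL O ≫ 𝟙 _ := by
      rw [reassoc_of% hd, Category.comp_id, leftUnitor_inv_naturality_assoc,
        whisker_exchange_assoc, h₂, associator_inv_naturality_left_assoc,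
        ← comp_whiskerRight_assoc, MonObj.one_mul]
      simp
    exact relTensor.hom_ext h₃

lemma unitL_eq_map (O : LMod R) : ((λ_ O.X).inv ≫ η[R.X] ▷ O.X ≫ πL O) ≫
    relTensor.map (hRight f) (𝟙 O) = unitL f O := by
  have h : πL O ≫ relTensor.map (hRight f) (𝟙 O) = f.hom ▷ O.X ≫ S.X ◁ 𝟙 O.X ≫ extLX.π f O :=
    relTensor.π_map (hRight f) (𝟙 O)
  rw [MonoidalCategory.whiskerLeft_id, Category.id_comp] at h
  let m : relTensor (RMod.regular R) O ⟶ extLX f O := relTensor.map (hRight f) (𝟙 O)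
  have hm : πL O ≫ m = f.hom ▷ O.X ≫ extLX.π f O := h
  have key : ((λ_ O.X).inv ≫ η[R.X] ▷ O.X ≫ πL O) ≫ m = unitL f O := by
    rw [Category.assoc, Category.assoc, hm, ← comp_whiskerRight_assoc, IsMonHom.one_hom, unitL]
  exact key

/-- `O ⊗_R R` is `O`. -/
lemma isIso_regular_right (O : RMod R) : IsIso ((ρ_ O.X).inv ≫ O.X ◁ η[R.X] ≫ πR O) := by
  have hc : O.act ▷ R.X ≫ πR O = (α_ O.X R.X R.X).hom ≫ O.X ◁ μ[R.X] ≫ πR O :=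
    relTensor.condition O (Mod.regular R.X)
  let d : relTensor O (Mod.regular R.X) ⟶ O.X := relTensor.desc (N := Mod.regular R.X) O.act (by
    change O.act ▷ R.X ≫ O.act = (α_ O.X R.X R.X).hom ≫ O.X ◁ μ[R.X] ≫ O.act
    simp)
  have hd : πR O ≫ d = O.act := relTensor.π_desc _ _
  refine ⟨d, ?_, ?_⟩
  · rw [Category.assoc, Category.assoc, hd, O.act_one, Iso.inv_hom_id]
  · have h₃ : πR O ≫ d ≫ (ρ_ O.X).inv ≫ O.X ◁ η[R.X] ≫ πR O = πR O ≫ 𝟙 _ := by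
      rw [reassoc_of% hd, Category.comp_id, rightUnitor_inv_naturality_assoc,
        ← whisker_exchange_assoc, hc, associator_naturality_right_assoc,
        ← MonoidalCategory.whiskerLeft_comp_assoc, MonObj.mul_one]
      simp
    exact relTensor.hom_ext h₃

lemma unitR_eq_map (O : RMod R) : ((ρ_ O.X).inv ≫ O.X ◁ η[R.X] ≫ πR O) ≫
    relTensor.map (𝟙 O) (hLeft f) = unitR f O := by
  have h : πR O ≫ relTensor.map (𝟙 O) (hLeft f) = 𝟙 O.X ▷ R.X ≫ O.X ◁ f.hom ≫ extRX.π f O :=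
    relTensor.π_map (𝟙 O) (hLeft f)
  rw [id_whiskerRight, Category.id_comp] at h
  let m : relTensor O (Mod.regular R.X) ⟶ extRX f O := relTensor.map (𝟙 O) (hLeft f)
  have hm : πR O ≫ m = O.X ◁ f.hom ≫ extRX.π f O := h
  have key : ((ρ_ O.X).inv ≫ O.X ◁ η[R.X] ≫ πR O) ≫ m = unitR f O := by
    rw [Category.assoc, Category.assoc, hm, ← MonoidalCategory.whiskerLeft_comp_assoc,
      IsMonHom.one_hom, unitR]
  exact key

variable [ModelCategory C]

/-- Since `R ⊗_R O` is `O`, tensoring `R ⟶ S` with `O` is the unit up to isomorphism. This links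
flatness and flat equivalences, phrased with `relTensor`, to the units studied above. -/
lemma unitL_weq_iff (O : LMod R) : weakEquivalences C (unitL f O) ↔
    weakEquivalences C (relTensor.map (hRight f) (𝟙 O)) := by
  have := isIso_regular_left O
  rw [← unitL_eq_map]
  exact MorphismProperty.cancel_left_of_respectsIso _ _ _

lemma unitR_weq_iff (O : RMod R) : weakEquivalences C (unitR f O) ↔
    weakEquivalences C (relTensor.map (𝟙 O) (hLeft f)) := by
  have := isIso_regular_right O
  rw [← unitR_eq_map]
  exact MorphismProperty.cancel_left_of_respectsIso _ _ _

end RelTensor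

/-! ### Cell classes pulled back along forgetful functors. -/

section Inverse
variable {C : Type u} [Category.{v} C] {D : Type u₁} [Category.{v} D] (U : D ⥤ C)

/-- Preservation of filtered colimits is enough, because initial segments below limit elements are
filtered. -/
instance [PreservesFilteredColimitsOfSize.{v, v} U] (P : MorphismProperty C)
    [MorphismProperty.IsStableUnderTransfiniteComposition.{v} P] :
    MorphismProperty.IsStableUnderTransfiniteComposition.{v} (P.inverseImage U) where
  isStableUnderTransfiniteCompositionOfShape J _ _ _ _ := by
    have : ∀ m : J, Order.IsSuccLimit m → IsFiltered (Set.Iio m) := fun m hm ↦ by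
      have : Nonempty (Set.Iio m) := ⟨⊥, bot_lt_iff_ne_bot.2 (by rintro rfl; exact hm.1 isMin_bot)⟩
      infer_instance
    have : PreservesWellOrderContinuousOfShape J U :=
      ⟨fun m hm ↦ have := this m hm; inferInstance⟩
    exact ⟨fun X Y f hf ↦ MorphismProperty.transfiniteCompositionsOfShape_le P J _
      (MorphismProperty.transfiniteCompositionsOfShape_map_of_preserves J U f hf)⟩

variable {U}

lemma pushouts_map_le {F : C ⥤ D} [PreservesColimitsOfShape WalkingSpan U]
    (P : MorphismProperty C) [P.IsStableUnderCobaseChange] (Q : MorphismProperty C)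
    (h : ∀ ⦃K L : C⦄ (j : K ⟶ L), Q j → P (U.map (F.map j))) :
    (Q.map F).pushouts ≤ P.inverseImage U := by
  rintro R R' f ⟨A, B, p, k, l, ⟨K, L, j, hj, ⟨e⟩⟩, sq⟩
  exact P.of_isPushout (sq.map U) ((P.arrow_mk_iso_iff (U.mapArrow.mapIso e)).1 (h j hj))

end Inverse

/-! ### Transfer along a single right adjoint. -/

section Transfer
variable {C : Type u} [Category.{v} C] [ModelCategory C] {D : Type u₁} [Category.{v} D]
  {U : D ⥤ C}

lemma ModelClasses.isModel_transfer {F : C ⥤ D} (adj : F ⊣ U) (hC : IsCombinatorial C)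
    [HasLimits D] [HasColimits D] [PreservesFilteredColimitsOfSize.{v, v} U]
    (h : ((fibrations C).inverseImage U).llp ≤ (weakEquivalences C).inverseImage U) :
    (ModelClasses.transfer U).IsModel :=
  ModelClasses.isModel_of_family (fun _ : Unit ↦ adj) hC _ (fun _ _ _ ↦ ⟨fun h _ ↦ h, fun h ↦ h ()⟩)
    (fun _ _ _ ↦ ⟨fun h _ ↦ h, fun h ↦ h ()⟩) rfl h

end Transfer

/-! ### Model structures on algebras and modules. -/

section Models
variable {C : Type u} [Category.{v} C] [MonoidalCategory C] [SymmetricCategory C] [MonoidalClosed C]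
  [ModelCategory C]

lemma algClasses_isModel (hC : IsCombinatorial C) (hpp : PushoutProductAxiom C)
    (hm : MonoidAxiom C) : (algClasses (C := C)).IsModel := by
  have := hC.hasColimits
  have := hC.hasLimits
  have : HasLimits (Mon C) := ⟨fun _ _ ↦ inferInstance⟩
  exact ModelClasses.isModel_transfer (FreeMon.adj C) hC
    fun _ _ f hf ↦ hm _ (hom_mem_of_extClass (llp_le_extClass hC hpp f hf))

variable (R : Mon C)

section
variable [HasLimits C]
instance : HasLimits (RMod R) := hasLimits_of_hasLimits_createsLimits (RMod.forget R)
instance : HasLimits (LMod R) := hasLimits_of_hasLimits_createsLimits (Mod.forget R.X)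
end

section
variable [HasColimits C]
instance : HasColimits (RMod R) :=
  ⟨fun _ _ ↦ hasColimitsOfShape_of_hasColimitsOfShape_createsColimitsOfShape (RMod.forget R)⟩
instance : HasColimits (LMod R) :=
  ⟨fun _ _ ↦ hasColimitsOfShape_of_hasColimitsOfShape_createsColimitsOfShape (Mod.forget R.X)⟩
instance : PreservesColimitsOfSize.{v, v} (RMod.forget R) := ⟨inferInstance⟩
instance : PreservesColimitsOfSize.{v, v} (Mod.forget (D := C) R.X) := ⟨inferInstance⟩
instance : PreservesColimitsOfShape WalkingSpan (RMod.forget R) := inferInstance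
instance : PreservesColimitsOfShape WalkingSpan (Mod.forget (D := C) R.X) := inferInstance
end

lemma weakSaturation_whiskerRight {K L : C} {j : K ⟶ L} (hj : trivialCofibrations C j) (X : C) :
    weakSaturation (trivialCofTensor C) (j ▷ X) := le_weakSaturation _ _ (.mk j X hj)

/-- The free right module on `j` has underlying map `j ⊗ R`, and module colimits are computed in
`C`; this is exactly the situation covered by the monoid axiom. -/
lemma rmod_llp_le (hC : IsCombinatorial C) :
    ((fibrations C).inverseImage (RMod.forget R)).llp ≤
      (weakSaturation (trivialCofTensor C)).inverseImage (RMod.forget R) := by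
  have := hC.hasColimits
  exact llp_fibrations_le (RMod.adj R) hC _
    (pushouts_map_le _ _ fun _ _ j hj ↦ weakSaturation_whiskerRight hj R.X)

lemma lmod_llp_le (hC : IsCombinatorial C) :
    ((fibrations C).inverseImage (Mod.forget R.X)).llp ≤
      (weakSaturation (trivialCofTensor C)).inverseImage (Mod.forget (D := C) R.X) := by
  have := hC.hasColimits
  -- Free left modules were built over the opposite algebra, so their underlying functor is `- ⊗ R`
  -- as well.
  exact llp_fibrations_le (adjFreeL R) hC _
    (pushouts_map_le _ _ fun _ _ j hj ↦ weakSaturation_whiskerRight hj R.X)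

lemma rmodClasses_isModel (hC : IsCombinatorial C) (hm : MonoidAxiom C) :
    (rmodClasses R).IsModel := by
  have := hC.hasColimits
  have := hC.hasLimits
  exact ModelClasses.isModel_transfer (RMod.adj R) hC fun _ _ f hf ↦ hm _ (rmod_llp_le R hC f hf)

lemma lmodClasses_isModel (hC : IsCombinatorial C) (hm : MonoidAxiom C) :
    (lmodClasses R).IsModel := by
  have := hC.hasColimits
  have := hC.hasLimits
  exact ModelClasses.isModel_transfer (adjFreeL R) hC fun _ _ f hf ↦ hm _ (lmod_llp_le R hC f hf)

variable {R} {S : Mon C} {f : R ⟶ S} [HasColimits C]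

lemma unitR_mem_of_trivialCof (hC : IsCombinatorial C) (hpp : PushoutProductAxiom C)
    (hf : ((fibrations C).inverseImage (Mon.forget C)).llp f) (O : RMod R) :
    weakSaturation (trivialCofTensor C) (unitR f O) := llp_le_extClass hC hpp _ hf O

/-- The opposite of `f` has the same lifting property, and the left unit is a retract of the right
unit over the opposite algebras. -/
lemma unitL_mem_of_trivialCof (hC : IsCombinatorial C) (hpp : PushoutProductAxiom C)
    (hf : ((fibrations C).inverseImage (Mon.forget C)).llp f) (O : LMod R) :
    weakSaturation (trivialCofTensor C) (unitL f O) :=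
  (weakSaturation (trivialCofTensor C)).of_retract (unitL_retract f O).some
    (unitR_mem_of_trivialCof hC hpp (revMap_llp hf) (toRMod O))

end Models

/-! ### Relative and absolute limits in bifibrations. -/

section RelativeLimits
variable {N : Type u₂} [Category.{v₂} N] {B : Type u₁} [Category.{v₁} B] {π : N ⥤ B}

lemma exists_cartesian (hcart : ∀ (Y : N) ⦃b : B⦄ (f : b ⟶ π.obj Y),
      ∃ (X : N) (φ : X ⟶ Y), π.IsStronglyCartesian f φ) {Y : N} {b c : B} (h : π.obj Y = c)
    (f : b ⟶ c) : ∃ (X : N) (φ : X ⟶ Y), π.IsStronglyCartesian f φ := by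
  subst h
  exact hcart Y f

lemma isHomLift_congr {b c : B} {X Y : N} {f g : b ⟶ c} {φ : X ⟶ Y} (h : π.IsHomLift f φ)
    (e : f = g) : π.IsHomLift g φ := e ▸ h

/-- Cartesian lifts of the legs of `s` pull the diagram `δ` back into the fibre over `s.pt`; the
limit taken there is the relative limit. -/
lemma relativelyComplete (hcart : ∀ (Y : N) ⦃b : B⦄ (f : b ⟶ π.obj Y),
      ∃ (X : N) (φ : X ⟶ Y), π.IsStronglyCartesian f φ)
    [∀ b, HasLimitsOfSize.{w, w} (π.Fiber b)] : RelativelyComplete.{w} π := by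
  intro I _ δ s
  let σ (i : I) : s.pt ⟶ π.obj (δ.obj i) := s.π.app i
  have hσ {i j : I} (u : i ⟶ j) : σ i ≫ π.map (δ.map u) = σ j := s.w u
  choose X κ hκ using fun i ↦ hcart (δ.obj i) (σ i)
  have hl {i j : I} (u : i ⟶ j) : π.IsHomLift (σ j) (κ i ≫ δ.map u) :=
    isHomLift_congr inferInstance (hσ u)
  let tr {i j : I} (u : i ⟶ j) : X i ⟶ X j :=
    have := hl u
    Functor.IsStronglyCartesian.map π (σ j) (κ j) (Category.id_comp (σ j)).symm (κ i ≫ δ.map u)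
  have tr_lift {i j : I} (u : i ⟶ j) : π.IsHomLift (𝟙 s.pt) (tr u) := by
    have := hl u
    exact Functor.IsStronglyCartesian.map_isHomLift _ _ _ _ _
  have tr_fac {i j : I} (u : i ⟶ j) : tr u ≫ κ j = κ i ≫ δ.map u := by
    have := hl u
    exact Functor.IsStronglyCartesian.fac _ _ _ _ _
  have ext {i : I} {Z : N} (ψ ψ' : Z ⟶ X i) (_ : π.IsHomLift (𝟙 s.pt) ψ)
      (_ : π.IsHomLift (𝟙 s.pt) ψ') (h : ψ ≫ κ i = ψ' ≫ κ i) : ψ = ψ' :=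
    Functor.IsStronglyCartesian.ext π (σ i) (κ i) (𝟙 s.pt) h
  let D : I ⥤ π.Fiber s.pt :=
    { obj i := ⟨X i, IsHomLift.domain_eq π (σ i) (κ i)⟩
      map u := ⟨tr u, tr_lift u⟩
      map_id i := Subtype.ext (ext _ _ (tr_lift _) (IsHomLift.id (IsHomLift.domain_eq π (σ i) (κ i)))
        (by rw [tr_fac, δ.map_id]; exact (Category.comp_id _).trans (Category.id_comp _).symm))
      map_comp {i j k} u u' := Subtype.ext (ext _ _ (tr_lift _)
        (by have := tr_lift u; have := tr_lift u'; change π.IsHomLift _ (tr u ≫ tr u'); infer_instance)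
        (by change tr _ ≫ _ = (tr u ≫ tr u') ≫ _; rw [tr_fac, Category.assoc, tr_fac, reassoc_of% (tr_fac u)]
            simp)) }
  let l (i : I) : (limit D).1 ⟶ X i := (limit.π D i).1
  have l_lift (i : I) : π.IsHomLift (𝟙 s.pt) (l i) := (limit.π D i).2
  have hlw {i j : I} (u : i ⟶ j) : l i ≫ tr u = l j := congrArg Subtype.val (limit.w D u)
  refine ⟨Cone.mk (limit D).1
    { app i := l i ≫ κ i
      naturality i j u := by
        change 𝟙 _ ≫ l j ≫ κ j = (l i ≫ κ i) ≫ δ.map u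
        rw [Category.id_comp, Category.assoc, ← tr_fac, reassoc_of% (hlw u)] }, ⟨(limit D).2, fun i ↦ ?_⟩, ?_⟩
  · have := l_lift i
    exact isHomLift_congr (inferInstanceAs (π.IsHomLift (𝟙 s.pt ≫ σ i) (l i ≫ κ i)))
      (Category.id_comp _)
  · intro t' ht'
    let τ (i : I) : t'.pt ⟶ δ.obj i := t'.π.app i
    have hτ (i : I) : π.IsHomLift (σ i) (τ i) := ht'.legs i
    have hτw {i j : I} (u : i ⟶ j) : τ i ≫ δ.map u = τ j := t'.w u
    choose m hm₁ hm₂ using fun i ↦ (have := hτ i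
      (Functor.IsStronglyCartesian.universal_property π (σ i) (κ i) (𝟙 s.pt) _
        (Category.id_comp (σ i)).symm (τ i)).exists)
    let c : Cone D := Cone.mk ⟨t'.pt, ht'.pt⟩
      { app i := ⟨m i, hm₁ i⟩
        naturality i j u := Subtype.ext (by
          change 𝟙 _ ≫ m j = m i ≫ tr u
          have := tr_lift u
          have := hm₁ i
          refine (Category.id_comp _).trans (ext _ _ (hm₁ j) inferInstance ?_)
          rw [Category.assoc, tr_fac, reassoc_of% (hm₂ i), hm₂, hτw]) }
    have hc (i : I) : (limit.lift D c).1 ≫ l i = m i := congrArg Subtype.val (limit.lift_π c i)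
    refine ⟨(limit.lift D c).1, ⟨(limit.lift D c).2, fun i ↦ ?_⟩, ?_⟩
    · change _ ≫ l i ≫ κ i = τ i
      rw [reassoc_of% (hc i), hm₂]
    · rintro g ⟨hg, hg'⟩
      have : (⟨g, hg⟩ : c.pt ⟶ limit D) = limit.lift D c := by
        refine limit.hom_ext fun i ↦ Functor.Fiber.hom_ext ?_
        refine Eq.trans ?_ (hc i).symm
        change g ≫ l i = m i
        have := l_lift i
        refine ext _ _ inferInstance (hm₁ i) ?_
        rw [hm₂, Category.assoc]
        exact hg' i
      exact congrArg Subtype.val this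

/-- Dually, coCartesian lifts push the diagram forward into the fibre over `s.pt`. -/
lemma relativelyCocomplete (hcocart : ∀ (X : N) ⦃b : B⦄ (f : π.obj X ⟶ b),
      ∃ (Y : N) (φ : X ⟶ Y), π.IsStronglyCocartesian f φ)
    [∀ b, HasColimitsOfSize.{w, w} (π.Fiber b)] : RelativelyCocomplete.{w} π := by
  intro I _ δ s
  let σ (i : I) : π.obj (δ.obj i) ⟶ s.pt := s.ι.app i
  have hσ {i j : I} (u : i ⟶ j) : π.map (δ.map u) ≫ σ j = σ i := s.w u
  choose X κ hκ using fun i ↦ hcocart (δ.obj i) (σ i)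
  have hl {i j : I} (u : i ⟶ j) : π.IsHomLift (σ i) (δ.map u ≫ κ j) :=
    isHomLift_congr inferInstance (hσ u)
  let tr {i j : I} (u : i ⟶ j) : X i ⟶ X j :=
    have := hl u
    Functor.IsStronglyCocartesian.map π (σ i) (κ i) (Category.comp_id (σ i)).symm (δ.map u ≫ κ j)
  have tr_lift {i j : I} (u : i ⟶ j) : π.IsHomLift (𝟙 s.pt) (tr u) := by
    have := hl u
    exact Functor.IsStronglyCocartesian.map_isHomLift _ _ _ _ _
  have tr_fac {i j : I} (u : i ⟶ j) : κ i ≫ tr u = δ.map u ≫ κ j := by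
    have := hl u
    exact Functor.IsStronglyCocartesian.fac _ _ _ _ _
  have ext {i : I} {Z : N} (ψ ψ' : X i ⟶ Z) (_ : π.IsHomLift (𝟙 s.pt) ψ)
      (_ : π.IsHomLift (𝟙 s.pt) ψ') (h : κ i ≫ ψ = κ i ≫ ψ') : ψ = ψ' :=
    Functor.IsStronglyCocartesian.ext π (σ i) (κ i) (𝟙 s.pt) h
  let D : I ⥤ π.Fiber s.pt :=
    { obj i := ⟨X i, IsHomLift.codomain_eq π (σ i) (κ i)⟩
      map u := ⟨tr u, tr_lift u⟩
      map_id i := Subtype.ext (ext _ _ (tr_lift _) (IsHomLift.id (IsHomLift.codomain_eq π (σ i) (κ i)))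
        (by rw [tr_fac, δ.map_id]; exact (Category.id_comp _).trans (Category.comp_id _).symm))
      map_comp {i j k} u u' := Subtype.ext (ext _ _ (tr_lift _)
        (by have := tr_lift u; have := tr_lift u'; change π.IsHomLift _ (tr u ≫ tr u'); infer_instance)
        (by change _ ≫ tr _ = _ ≫ tr u ≫ tr u'
            rw [tr_fac, reassoc_of% (tr_fac u), tr_fac]
            simp)) }
  let l (i : I) : X i ⟶ (colimit D).1 := (colimit.ι D i).1
  have l_lift (i : I) : π.IsHomLift (𝟙 s.pt) (l i) := (colimit.ι D i).2
  have hlw {i j : I} (u : i ⟶ j) : tr u ≫ l j = l i := congrArg Subtype.val (colimit.w D u)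
  refine ⟨Cocone.mk (colimit D).1
    { app i := κ i ≫ l i
      naturality i j u := by
        change δ.map u ≫ κ j ≫ l j = (κ i ≫ l i) ≫ 𝟙 _
        rw [Category.comp_id, ← hlw u, reassoc_of% (tr_fac u)] }, ⟨(colimit D).2, fun i ↦ ?_⟩, ?_⟩
  · have := l_lift i
    exact isHomLift_congr (inferInstanceAs (π.IsHomLift (σ i ≫ 𝟙 s.pt) (κ i ≫ l i)))
      (Category.comp_id _)
  · intro t' ht'
    let τ (i : I) : δ.obj i ⟶ t'.pt := t'.ι.app i
    have hτ (i : I) : π.IsHomLift (σ i) (τ i) := ht'.legs i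
    have hτw {i j : I} (u : i ⟶ j) : δ.map u ≫ τ j = τ i := t'.w u
    choose m hm₁ hm₂ using fun i ↦ (have := hτ i
      (Functor.IsStronglyCocartesian.universal_property π (σ i) (κ i) (𝟙 s.pt) _
        (Category.comp_id (σ i)).symm (τ i)).exists)
    let c : Cocone D := Cocone.mk ⟨t'.pt, ht'.pt⟩
      { app i := ⟨m i, hm₁ i⟩
        naturality i j u := Subtype.ext (by
          change tr u ≫ m j = m i ≫ 𝟙 _
          have := tr_lift u
          have := hm₁ j
          refine Eq.trans (ext _ _ inferInstance (hm₁ i) ?_) (Category.comp_id _).symm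
          rw [reassoc_of% (tr_fac u), hm₂, hm₂, hτw]) }
    have hc (i : I) : l i ≫ (colimit.desc D c).1 = m i := congrArg Subtype.val (colimit.ι_desc c i)
    refine ⟨(colimit.desc D c).1, ⟨(colimit.desc D c).2, fun i ↦ ?_⟩, ?_⟩
    · change (κ i ≫ l i) ≫ _ = τ i
      rw [Category.assoc, hc i, hm₂]
    · rintro g ⟨hg, hg'⟩
      have : (⟨g, hg⟩ : colimit D ⟶ c.pt) = colimit.desc D c := by
        refine colimit.hom_ext fun i ↦ Functor.Fiber.hom_ext ?_
        refine Eq.trans ?_ (hc i).symm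
        change l i ≫ g = m i
        have := l_lift i
        refine ext _ _ inferInstance (hm₁ i) ?_
        rw [hm₂, ← Category.assoc]
        exact hg' i
      exact congrArg Subtype.val this

/-- The relative limit over a limit cone of `δ ⋙ π` is tested only against cones over the same base
object. An arbitrary cone is brought there by pushing its apex forward along a coCartesian map,
hence the hypothesis on coCartesian lifts. -/
lemma hasLimits_of_relativelyComplete (hπ : RelativelyComplete.{w} π) [HasLimitsOfSize.{w, w} B]
    (hcocart : ∀ (X : N) ⦃b : B⦄ (f : π.obj X ⟶ b),
      ∃ (Y : N) (φ : X ⟶ Y), π.IsStronglyCocartesian f φ) : HasLimitsOfSize.{w, w} N := by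
  refine ⟨fun I _ ↦ ⟨fun δ ↦ ?_⟩⟩
  obtain ⟨s, ⟨hs⟩⟩ : ∃ s : Cone (δ ⋙ π), Nonempty (IsLimit s) := ⟨_, ⟨limit.isLimit _⟩⟩
  obtain ⟨t, ht, hu⟩ := hπ I δ s
  have hlift (c : Cone δ) : ∃ u : π.obj c.pt ⟶ s.pt, ∀ i, u ≫ s.π.app i = π.map (c.π.app i) :=
    ⟨hs.lift (π.mapCone c), fun i ↦ hs.fac (π.mapCone c) i⟩
  choose u hu' using hlift
  choose E κ hκ using fun c : Cone δ ↦ hcocart c.pt (u c)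
  choose m hm₁ hm₂ using fun (c : Cone δ) (i : I) ↦
    (Functor.IsStronglyCocartesian.universal_property π (u c) (κ c) (s.π.app i) _ (hu' c i).symm
      (c.π.app i)).exists
  let t' (c : Cone δ) : Cone δ := Cone.mk (E c)
    { app i := m c i
      naturality i j a := by
        have hl : π.IsHomLift (s.π.app j) (m c i ≫ δ.map a) := by
          have := hm₁ c i
          exact isHomLift_congr (inferInstanceAs (π.IsHomLift (s.π.app i ≫ π.map (δ.map a)) _)) (s.w a)
        have := hm₁ c j
        change 𝟙 _ ≫ m c j = m c i ≫ δ.map a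
        rw [Category.id_comp]
        refine Functor.IsStronglyCocartesian.ext π (u c) (κ c) (s.π.app j) ?_
        rw [hm₂, reassoc_of% (hm₂ c i), c.w] }
  have ht' (c : Cone δ) : IsConeLift π s (t' c) := ⟨IsHomLift.codomain_eq π (u c) (κ c), hm₁ c⟩
  choose g hg hg' using fun c ↦ hu (t' c) (ht' c)
  refine ⟨⟨t, ⟨fun c ↦ κ c ≫ g c, fun c i ↦ ?_, fun c k hk ↦ ?_⟩⟩⟩
  · rw [Category.assoc, (hg c).2 i]
    exact hm₂ c i
  · have hk' : π.IsHomLift (u c) k := by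
      refine IsHomLift.of_fac π (u c) k rfl ht.pt (hs.hom_ext fun i ↦ ?_)
      have := ht.legs i
      have h₁ := IsHomLift.fac' π (s.π.app i) (t.π.app i)
      have h₂ : π.map k ≫ π.map (t.π.app i) = π.map (c.π.app i) := by
        rw [← π.map_comp, hk]
      rw [hu', ← h₂, h₁]
      simp
    obtain ⟨q, ⟨hq₁, hq₂⟩, -⟩ := Functor.IsStronglyCocartesian.universal_property π (u c) (κ c)
      (𝟙 s.pt) _ (Category.comp_id _).symm k
    rw [← hq₂, hg' c q ⟨hq₁, fun i ↦ ?_⟩]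
    change q ≫ t.π.app i = m c i
    have := ht.legs i
    have := hm₁ c i
    have : π.IsHomLift (s.π.app i) (q ≫ t.π.app i) :=
      isHomLift_congr (inferInstanceAs (π.IsHomLift (𝟙 s.pt ≫ s.π.app i) _)) (Category.id_comp _)
    refine Functor.IsStronglyCocartesian.ext π (u c) (κ c) (s.π.app i) ?_
    rw [hm₂, reassoc_of% hq₂, hk]

/-- Dual: the apex of an arbitrary cocone is pulled back along a Cartesian map to the fibre over the
colimit. -/
lemma hasColimits_of_relativelyCocomplete (hπ : RelativelyCocomplete.{w} π)
    [HasColimitsOfSize.{w, w} B] (hcart : ∀ (Y : N) ⦃b : B⦄ (f : b ⟶ π.obj Y),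
      ∃ (X : N) (φ : X ⟶ Y), π.IsStronglyCartesian f φ) : HasColimitsOfSize.{w, w} N := by
  refine ⟨fun I _ ↦ ⟨fun δ ↦ ?_⟩⟩
  obtain ⟨s, ⟨hs⟩⟩ : ∃ s : Cocone (δ ⋙ π), Nonempty (IsColimit s) := ⟨_, ⟨colimit.isColimit _⟩⟩
  obtain ⟨t, ht, hu⟩ := hπ I δ s
  have hdesc (c : Cocone δ) : ∃ u : s.pt ⟶ π.obj c.pt, ∀ i, s.ι.app i ≫ u = π.map (c.ι.app i) :=
    ⟨hs.desc (π.mapCocone c), fun i ↦ hs.fac (π.mapCocone c) i⟩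
  choose u hu' using hdesc
  choose E κ hκ using fun c : Cocone δ ↦ hcart c.pt (u c)
  choose m hm₁ hm₂ using fun (c : Cocone δ) (i : I) ↦
    (Functor.IsStronglyCartesian.universal_property π (u c) (κ c) (s.ι.app i) _ (hu' c i).symm
      (c.ι.app i)).exists
  let t' (c : Cocone δ) : Cocone δ := Cocone.mk (E c)
    { app i := m c i
      naturality i j a := by
        have hl : π.IsHomLift (s.ι.app i) (δ.map a ≫ m c j) := by
          have := hm₁ c j
          exact isHomLift_congr (inferInstanceAs (π.IsHomLift (π.map (δ.map a) ≫ s.ι.app j) _)) (s.w a)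
        have := hm₁ c i
        change δ.map a ≫ m c j = m c i ≫ 𝟙 _
        rw [Category.comp_id]
        refine Functor.IsStronglyCartesian.ext π (u c) (κ c) (s.ι.app i) ?_
        rw [hm₂, Category.assoc, hm₂, c.w] }
  have ht' (c : Cocone δ) : IsCoconeLift π s (t' c) := ⟨IsHomLift.domain_eq π (u c) (κ c), hm₁ c⟩
  choose g hg hg' using fun c ↦ hu (t' c) (ht' c)
  refine ⟨⟨t, ⟨fun c ↦ g c ≫ κ c, fun c i ↦ ?_, fun c k hk ↦ ?_⟩⟩⟩
  · rw [← Category.assoc, (hg c).2 i]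
    exact hm₂ c i
  · have hk' : π.IsHomLift (u c) k := by
      refine IsHomLift.of_fac π (u c) k ht.pt rfl (hs.hom_ext fun i ↦ ?_)
      have := ht.legs i
      have h₁ := IsHomLift.fac' π (s.ι.app i) (t.ι.app i)
      have h₂ : π.map (t.ι.app i) ≫ π.map k = π.map (c.ι.app i) := by
        rw [← π.map_comp, hk]
      rw [hu', ← h₂, h₁]
      simp
    obtain ⟨q, ⟨hq₁, hq₂⟩, -⟩ := Functor.IsStronglyCartesian.universal_property π (u c) (κ c)
      (𝟙 s.pt) _ (Category.id_comp _).symm k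
    rw [← hq₂, hg' c q ⟨hq₁, fun i ↦ ?_⟩]
    change t.ι.app i ≫ q = m c i
    have := ht.legs i
    have := hm₁ c i
    have : π.IsHomLift (s.ι.app i) (t.ι.app i ≫ q) :=
      isHomLift_congr (inferInstanceAs (π.IsHomLift (s.ι.app i ≫ 𝟙 s.pt) _)) (Category.comp_id _)
    refine Functor.IsStronglyCartesian.ext π (u c) (κ c) (s.ι.app i) ?_
    rw [hm₂, Category.assoc, hq₂, hk]

end RelativeLimits

/-! ### Lifting and factorization from the base and the fibres. -/

section RelativeFactorization
variable {C : Type u} [Category.{v} C] {N : Type u₂} [Category.{v₂} N] {B : Type u₁}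
  [Category.{v₁} B] (π : N ⥤ B) (V : N ⥤ C)

/-- `π` is a fibration and an opfibration, and `V` inverts the Cartesian morphisms. -/
structure IsBifibration : Prop where
  cartesian : ∀ (Y : N) ⦃b : B⦄ (f : b ⟶ π.obj Y),
    ∃ (X : N) (φ : X ⟶ Y), π.IsStronglyCartesian f φ
  cocartesian : ∀ (X : N) ⦃b : B⦄ (f : π.obj X ⟶ b),
    ∃ (Y : N) (φ : X ⟶ Y), π.IsStronglyCocartesian f φ
  isIso : ∀ ⦃X Y : N⦄ (φ : X ⟶ Y) ⦃b c : B⦄ (f : b ⟶ c), π.IsStronglyCartesian f φ →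
    IsIso (V.map φ)

/-- The morphisms which become invertible in the base and are sent to `Q` by `V`. -/
def vertical (Q : MorphismProperty C) : MorphismProperty N :=
  fun _ _ p ↦ IsIso (π.map p) ∧ Q (V.map p)

/-- The left lifting property inside the fibre over `b`. -/
def FiberLlp (Q : MorphismProperty C) (b : B) {X Y : N} (i : X ⟶ Y) : Prop :=
  ∀ ⦃Z W : N⦄ (p : Z ⟶ W), π.IsHomLift (𝟙 b) p → Q (V.map p) → ∀ (s : X ⟶ Z) (t : Y ⟶ W),
    π.IsHomLift (𝟙 b) s → π.IsHomLift (𝟙 b) t → s ≫ p = i ≫ t → ∃ k, i ≫ k = s ∧ k ≫ p = t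

variable {π V}

lemma isIso_of_isHomLift_id {b : B} {X Y : N} (φ : X ⟶ Y) [π.IsHomLift (𝟙 b) φ] :
    IsIso (π.map φ) := by
  rw [IsHomLift.fac' π (𝟙 b) φ]
  infer_instance

variable (hπ : IsBifibration π V) {Q : MorphismProperty C} [Q.RespectsIso]
include hπ

/-- The map `p` factors as a vertical `p'` followed by a Cartesian map over `π p`. As `V` inverts
the latter, `p'` is still in `Q`. The prescribed base filler `u` turns the square into one against
`p'`. -/
lemma IsBifibration.exists_lift {X Y Z W : N} {φ : X ⟶ Y} (hφ : (vertical π V Q).llp φ)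
    {p : Z ⟶ W} (hp : Q (V.map p)) (s : X ⟶ Z) (t : Y ⟶ W) (w : s ≫ p = φ ≫ t)
    (u : π.obj Y ⟶ π.obj Z) (h₁ : π.map φ ≫ u = π.map s) (h₂ : u ≫ π.map p = π.map t) :
    ∃ k : Y ⟶ Z, φ ≫ k = s ∧ k ≫ p = t ∧ π.map k = u := by
  obtain ⟨D, d, hd⟩ := hπ.cartesian W (π.map p)
  have := hπ.isIso d _ hd
  obtain ⟨p', ⟨hp', hpd⟩, -⟩ := Functor.IsStronglyCartesian.universal_property π (π.map p) d
    (𝟙 _) _ (Category.id_comp _).symm p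
  obtain ⟨t', ⟨ht', htd⟩, -⟩ := Functor.IsStronglyCartesian.universal_property π (π.map p) d
    u _ h₂.symm t
  have hv : vertical π V Q p' := by
    refine ⟨isIso_of_isHomLift_id (b := π.obj Z) p', ?_⟩
    rwa [← Q.cancel_right_of_respectsIso _ (V.map d), ← V.map_comp, hpd]
  have sq : CommSq s φ p' t' := ⟨by
    have : π.IsHomLift (π.map s) (s ≫ p') :=
      isHomLift_congr (inferInstanceAs (π.IsHomLift (π.map s ≫ 𝟙 _) _)) (Category.comp_id _)
    have : π.IsHomLift (π.map s) (φ ≫ t') :=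
      isHomLift_congr (inferInstanceAs (π.IsHomLift (π.map φ ≫ u) _)) h₁
    refine Functor.IsStronglyCartesian.ext π (π.map p) d (π.map s) ?_
    rw [Category.assoc, hpd, Category.assoc, htd, w]⟩
  have := hφ p' hv
  refine ⟨sq.lift, sq.fac_left, ?_, ?_⟩
  · rw [← hpd, sq.fac_right_assoc, htd]
  · have h := congrArg π.map sq.fac_right
    rw [π.map_comp, IsHomLift.fac' π (𝟙 (π.obj Z)) p', IsHomLift.fac' π u t'] at h
    simp [← Category.assoc] at h
    exact (cancel_mono _).1 h

/-- The target map, invertible in the base, is pulled back along Cartesian maps to the fibre over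
`b`; this changes its image under `V` only by isomorphisms. -/
lemma IsBifibration.llp_of_fiberLlp {b : B} {X Y : N} {i : X ⟶ Y} [hi : π.IsHomLift (𝟙 b) i]
    (h : FiberLlp π V Q b i) : (vertical π V Q).llp i := by
  intro Z W p ⟨_, hp⟩
  refine ⟨fun {s t} sq ↦ ?_⟩
  obtain rfl := IsHomLift.domain_eq π (𝟙 b) i
  have hY := IsHomLift.codomain_eq π (𝟙 (π.obj X)) i
  have e : π.map i = eqToHom hY.symm := by
    rw [IsHomLift.fac' π (𝟙 (π.obj X)) i]
    simp
  obtain ⟨D, d, hd⟩ := hπ.cartesian Z (π.map s)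
  obtain ⟨E, e, he⟩ := exists_cartesian hπ.cartesian rfl (eqToHom hY.symm ≫ π.map t)
  have := hπ.isIso d _ hd
  have := hπ.isIso e _ he
  have hw : π.map s ≫ π.map p = eqToHom hY.symm ≫ π.map t := by
    rw [← π.map_comp, sq.w, π.map_comp, ‹π.map i = _›]
  have : π.IsHomLift (eqToHom hY.symm ≫ π.map t) (d ≫ p) :=
    isHomLift_congr (f := π.map s ≫ π.map p) inferInstance hw
  obtain ⟨p', ⟨hp', hpe⟩, -⟩ := Functor.IsStronglyCartesian.universal_property π
    (eqToHom hY.symm ≫ π.map t) e (𝟙 _) _ (Category.id_comp _).symm (d ≫ p)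
  obtain ⟨s', ⟨hs', hsd⟩, -⟩ := Functor.IsStronglyCartesian.universal_property π (π.map s) d
    (𝟙 _) _ (Category.id_comp _).symm s
  obtain ⟨t', ⟨ht', hte⟩, -⟩ := Functor.IsStronglyCartesian.universal_property π
    (eqToHom hY.symm ≫ π.map t) e (𝟙 _) _ (Category.id_comp _).symm t
  obtain ⟨k, hk₁, hk₂⟩ := h p' hp' (by
      rw [← Q.cancel_right_of_respectsIso _ (V.map e), ← V.map_comp, hpe, V.map_comp,
        Q.cancel_left_of_respectsIso]
      exact hp) s' t' hs' ht' (by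
      refine Functor.IsStronglyCartesian.ext π (eqToHom hY.symm ≫ π.map t) e (𝟙 (π.obj X)) ?_
      rw [Category.assoc, hpe, reassoc_of% hsd, Category.assoc, hte, sq.w])
  exact ⟨⟨{ l := k ≫ d
            fac_left := by rw [reassoc_of% hk₁, hsd]
            fac_right := by rw [Category.assoc, ← hpe, reassoc_of% hk₂, hte] }⟩⟩

omit hπ in
-- Since `π p` is invertible, the lifting problem has a unique solution in the base, and the
-- coCartesian property lifts it.
lemma llp_vertical_of_cocartesian {X Y : N} {c : X ⟶ Y} {a b : B} (f : a ⟶ b)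
    (hc : π.IsStronglyCocartesian f c) : (vertical π V Q).llp c := by
  intro Z W p ⟨_, _⟩
  refine ⟨fun {s t} sq ↦ ?_⟩
  obtain rfl := IsHomLift.domain_eq π f c
  obtain rfl := IsHomLift.codomain_eq π f c
  obtain rfl := IsHomLift.eq_of_isHomLift π f c
  have h : π.map s = π.map c ≫ π.map t ≫ inv (π.map p) := by
    rw [← Category.assoc, ← π.map_comp, ← sq.w, π.map_comp, Category.assoc, IsIso.hom_inv_id,
      Category.comp_id]
  obtain ⟨k, ⟨hk, hk'⟩, -⟩ := Functor.IsStronglyCocartesian.universal_property π (π.map c) c _ _ h s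
  refine ⟨⟨{ l := k, fac_left := hk', fac_right := ?_ }⟩⟩
  have : π.IsHomLift (π.map t) (k ≫ p) :=
    isHomLift_congr (f := (π.map t ≫ inv (π.map p)) ≫ π.map p) inferInstance (by simp)
  refine Functor.IsStronglyCocartesian.ext π (π.map c) c (π.map t) ?_
  rw [reassoc_of% hk', sq.w]

/-- A factorization in the total category from a factorization in the base and factorizations
in the fibres. The left part is a coCartesian morphism followed by a vertical morphism. -/
lemma IsBifibration.exists_factor {K : MorphismProperty N}
    (hQ : ∀ ⦃b : B⦄ ⦃X Y : N⦄ (ψ : X ⟶ Y), π.IsHomLift (𝟙 b) ψ → ∃ (Z : N) (i : X ⟶ Z) (p : Z ⟶ Y),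
      i ≫ p = ψ ∧ π.IsHomLift (𝟙 b) i ∧ π.IsHomLift (𝟙 b) p ∧ FiberLlp π V Q b i ∧ K i ∧ Q (V.map p))
    {X Y : N} (φ : X ⟶ Y) {b : B} (h : π.obj X ⟶ b) (g : b ⟶ π.obj Y) (w : h ≫ g = π.map φ) :
    ∃ (Z : N) (i : X ⟶ Z) (p : Z ⟶ Y), i ≫ p = φ ∧ π.obj Z = b ∧ π.IsHomLift h i ∧
      π.IsHomLift g p ∧ (vertical π V Q).llp i ∧ Q (V.map p) ∧
      ∃ (E : N) (c : X ⟶ E) (j : E ⟶ Z), c ≫ j = i ∧ π.IsStronglyCocartesian h c ∧ K j := by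
  obtain ⟨E, c, hc⟩ := hπ.cocartesian X h
  obtain ⟨D, d, hd⟩ := hπ.cartesian Y g
  have := hπ.isIso d _ hd
  obtain ⟨ψ₁, ⟨h₁, h₁'⟩, -⟩ := Functor.IsStronglyCocartesian.universal_property π h c g _ w.symm φ
  obtain ⟨ψ, ⟨hψ, hψ'⟩, -⟩ := Functor.IsStronglyCartesian.universal_property π g d (𝟙 _) _
    (Category.id_comp _).symm ψ₁
  -- At this point `φ = c ≫ ψ ≫ d` with `c` coCartesian, `d` Cartesian and `ψ` vertical; only `ψ`
  -- needs a factorization, which takes place in the fibre.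
  obtain ⟨Z, i, p, hip, hi, hp, hl, hK, hq⟩ := hQ ψ hψ
  refine ⟨Z, c ≫ i, p ≫ d, ?_, IsHomLift.domain_eq π (𝟙 b) p, ?_, ?_, ?_, ?_, E, c, i, rfl, hc, hK⟩
  · rw [Category.assoc, reassoc_of% hip, hψ', h₁']
  · exact isHomLift_congr (inferInstanceAs (π.IsHomLift (h ≫ 𝟙 b) _)) (Category.comp_id _)
  · exact isHomLift_congr (inferInstanceAs (π.IsHomLift (𝟙 b ≫ g) _)) (Category.id_comp _)
  · exact (vertical π V Q).llp.comp_mem _ _ (llp_vertical_of_cocartesian h hc)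
      (hπ.llp_of_fiberLlp (b := b) hl)
  · rwa [V.map_comp, Q.cancel_right_of_respectsIso]

lemma IsBifibration.isRelativeWFS [Q.IsStableUnderRetracts]
    (hQ : ∀ ⦃b : B⦄ ⦃X Y : N⦄ (ψ : X ⟶ Y), π.IsHomLift (𝟙 b) ψ → ∃ (Z : N) (i : X ⟶ Z) (p : Z ⟶ Y),
      i ≫ p = ψ ∧ π.IsHomLift (𝟙 b) i ∧ π.IsHomLift (𝟙 b) p ∧ FiberLlp π V Q b i ∧ Q (V.map p))
    (L R : MorphismProperty B) : IsRelativeWFS π (L.inverseImage π ⊓ (vertical π V Q).llp)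
      (R.inverseImage π ⊓ Q.inverseImage V) L R where
  left_le _ _ _ h := h.1
  right_le _ _ _ h := h.1
  left_retract _ _ _ _ _ _ h hg hf := ⟨hf, (vertical π V Q).llp.of_retract h.some hg.2⟩
  right_retract _ _ _ _ _ _ h hg hf := ⟨hf, (Q.inverseImage V).of_retract h.some hg.2⟩
  factor X Y φ b h g w hh hg := by
    obtain ⟨Z, i, p, hip, rfl, hi, hp, hl, hr, -⟩ := hπ.exists_factor (K := ⊤) (Q := Q)
      (fun b X Y ψ hψ ↦ by
        obtain ⟨Z, i, p, h₁, h₂, h₃, h₄, h₅⟩ := hQ ψ hψ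
        exact ⟨Z, i, p, h₁, h₂, h₃, h₄, trivial, h₅⟩) φ h g w
    obtain rfl := IsHomLift.eq_of_isHomLift π h i
    obtain rfl := IsHomLift.eq_of_isHomLift π g p
    exact ⟨Z, i, p, hip, ⟨hh, hl⟩, ⟨hg, hr⟩, rfl, hi, hp⟩
  lift X Y Z W s i p t w hi hp u h₁ h₂ := hπ.exists_lift hi.2 hp.2 s t w u h₁ h₂

/-- Terminal objects of the fibres give a section of `π` with Cartesian values. -/
lemma IsBifibration.map_mem_llp [∀ b, HasTerminal (π.Fiber b)] [Q.ContainsIdentities]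
    {R : MorphismProperty B}
    {X Y : N} {φ : X ⟶ Y} (hφ : (R.inverseImage π ⊓ Q.inverseImage V).llp φ) :
    R.llp (π.map φ) := by
  intro c d q hq
  refine ⟨fun {a b} sq ↦ ?_⟩
  obtain ⟨T, rfl, t, ht⟩ : ∃ T, π.obj T = d ∧ ∃ t : Y ⟶ T, π.IsHomLift b t := by
    obtain ⟨E, κ, hκ⟩ := hπ.cocartesian Y b
    obtain ⟨τ, hτ⟩ : ∃ τ : E ⟶ (⊤_ π.Fiber d).1, π.IsHomLift (𝟙 d) τ :=
      let τ := terminal.from (Functor.Fiber.mk (IsHomLift.codomain_eq π b κ))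
      ⟨τ.1, τ.2⟩
    exact ⟨(⊤_ π.Fiber d).1, (⊤_ π.Fiber d).2, κ ≫ τ,
      isHomLift_congr (f := b ≫ 𝟙 d) inferInstance (Category.comp_id _)⟩
  -- The Cartesian lift of `q` is a legitimate test map because `V` inverts it, and `Q` contains
  -- isomorphisms.
  obtain ⟨P, p, hp⟩ := hπ.cartesian T q
  obtain ⟨s, ⟨hs, hs'⟩, -⟩ := Functor.IsStronglyCartesian.universal_property π q p a _ sq.w.symm
    (φ ≫ t)
  obtain rfl := IsHomLift.domain_eq π q p
  obtain rfl := IsHomLift.eq_of_isHomLift π q p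
  obtain rfl := IsHomLift.eq_of_isHomLift π a s
  obtain rfl := IsHomLift.eq_of_isHomLift π b t
  have := hπ.isIso p _ hp
  have := hφ p ⟨hq, Q.of_isIso _⟩
  have sq' : CommSq s φ p t := ⟨hs'⟩
  exact ⟨⟨{ l := π.map sq'.lift
            fac_left := by rw [← π.map_comp, sq'.fac_left]
            fac_right := by rw [← π.map_comp, sq'.fac_right] }⟩⟩

end RelativeFactorization

/-! ### Adjoints of the projection. -/

section Adjoints
variable {N : Type u₂} [Category.{v₂} N] {B : Type u₁} [Category.{v₁} B] {π : N ⥤ B}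

lemma exists_fiber_initial (b : B) [HasInitial (π.Fiber b)] :
    ∃ T, π.obj T = b ∧ ∀ P, π.obj P = b → ∃! k : T ⟶ P, π.IsHomLift (𝟙 b) k := by
  refine ⟨(⊥_ π.Fiber b).1, (⊥_ π.Fiber b).2, fun P hP ↦ ?_⟩
  let F : π.Fiber b := Functor.Fiber.mk hP
  refine ⟨(initial.to F).1, (initial.to F).2, fun k hk ↦ ?_⟩
  let k' : ⊥_ π.Fiber b ⟶ F := ⟨k, hk⟩
  exact congrArg Functor.Fiber.fiberInclusion.map (initial.hom_ext k' (initial.to F))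

lemma exists_fiber_terminal (b : B) [HasTerminal (π.Fiber b)] :
    ∃ T, π.obj T = b ∧ ∀ P, π.obj P = b → ∃! k : P ⟶ T, π.IsHomLift (𝟙 b) k := by
  refine ⟨(⊤_ π.Fiber b).1, (⊤_ π.Fiber b).2, fun P hP ↦ ?_⟩
  let F : π.Fiber b := Functor.Fiber.mk hP
  refine ⟨(terminal.from F).1, (terminal.from F).2, fun k hk ↦ ?_⟩
  let k' : F ⟶ ⊤_ π.Fiber b := ⟨k, hk⟩
  exact congrArg Functor.Fiber.fiberInclusion.map (terminal.hom_ext k' (terminal.from F))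

/-- The left adjoint sends `b` to the initial object of its fibre; Cartesian lifts extend initiality
to maps over arbitrary base maps. -/
lemma isRightAdjoint_of_cartesian (hcart : ∀ (Y : N) ⦃b : B⦄ (f : b ⟶ π.obj Y),
      ∃ (X : N) (φ : X ⟶ Y), π.IsStronglyCartesian f φ) [∀ b, HasInitial (π.Fiber b)] :
    π.IsRightAdjoint := by
  have (b : B) : HasInitial (StructuredArrow b π) := by
    obtain ⟨T, rfl, h⟩ := exists_fiber_initial (π := π) b
    refine IsInitial.hasInitial (X := StructuredArrow.mk (𝟙 (π.obj T))) ?_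
    have key (Y : StructuredArrow (π.obj T) π) : ∃! k : T ⟶ Y.right, π.map k = Y.hom := by
      obtain ⟨P, p, hp⟩ := hcart _ Y.hom
      obtain ⟨k, hk, hk'⟩ := h P (IsHomLift.domain_eq π Y.hom p)
      have : π.IsHomLift Y.hom (k ≫ p) :=
        isHomLift_congr (f := 𝟙 _ ≫ Y.hom) inferInstance (Category.id_comp _)
      refine ⟨k ≫ p, (IsHomLift.eq_of_isHomLift π Y.hom (k ≫ p)).symm, fun l hl ↦ ?_⟩
      have : π.IsHomLift Y.hom l := isHomLift_congr (.map l) hl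
      obtain ⟨l', ⟨hl', hl''⟩, -⟩ := Functor.IsStronglyCartesian.universal_property π Y.hom p (𝟙 _) _
        (Category.id_comp _).symm l
      rw [← hl'', hk' l' hl']
    refine IsInitial.ofUniqueHom (fun Y ↦ StructuredArrow.homMk (key Y).choose
      ((Category.id_comp _).trans (key Y).choose_spec.1)) fun Y f ↦ ?_
    ext
    exact (key Y).choose_spec.2 f.right ((Category.id_comp _).symm.trans (StructuredArrow.w f))
  exact isRightAdjointOfStructuredArrowInitials π

/-- Dually, terminal objects of the fibres give a right adjoint. -/
lemma isLeftAdjoint_of_cocartesian (hcocart : ∀ (X : N) ⦃b : B⦄ (f : π.obj X ⟶ b),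
      ∃ (Y : N) (φ : X ⟶ Y), π.IsStronglyCocartesian f φ) [∀ b, HasTerminal (π.Fiber b)] :
    π.IsLeftAdjoint := by
  have (b : B) : HasTerminal (CostructuredArrow π b) := by
    obtain ⟨T, rfl, h⟩ := exists_fiber_terminal (π := π) b
    refine IsTerminal.hasTerminal (X := CostructuredArrow.mk (𝟙 (π.obj T))) ?_
    have key (Y : CostructuredArrow π (π.obj T)) : ∃! k : Y.left ⟶ T, π.map k = Y.hom := by
      obtain ⟨P, p, hp⟩ := hcocart _ Y.hom
      obtain ⟨k, hk, hk'⟩ := h P (IsHomLift.codomain_eq π Y.hom p)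
      have : π.IsHomLift Y.hom (p ≫ k) :=
        isHomLift_congr (f := Y.hom ≫ 𝟙 _) inferInstance (Category.comp_id _)
      refine ⟨p ≫ k, (IsHomLift.eq_of_isHomLift π Y.hom (p ≫ k)).symm, fun l hl ↦ ?_⟩
      have : π.IsHomLift Y.hom l := isHomLift_congr (.map l) hl
      obtain ⟨l', ⟨hl', hl''⟩, -⟩ := Functor.IsStronglyCocartesian.universal_property π Y.hom p (𝟙 _) _
        (Category.comp_id _).symm l
      rw [← hl'', hk' l' hl']
    refine IsTerminal.ofUniqueHom (fun Y ↦ CostructuredArrow.homMk (key Y).choose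
      ((Category.comp_id _).trans (key Y).choose_spec.1)) fun Y f ↦ ?_
    ext
    exact (key Y).choose_spec.2 f.left ((Category.comp_id _).symm.trans (CostructuredArrow.w f))
  exact isLeftAdjoint_of_costructuredArrowTerminals π

end Adjoints

/-! ### Model structures detected by the projection and a functor to `C`. -/

section Detected
variable {C : Type u} [Category.{v} C] [ModelCategory C]

lemma ModelClasses.IsModel.llp_fib_le {D : Type u₁} [Category.{v₁} D] {m : ModelClasses D}
    (hm : m.IsModel) : m.fib.llp ≤ m.cof ⊓ m.weq := by
  intro X Y f hf
  have := hm.factor_trivial_cof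
  have := hm.retracts_cof
  have := hm.retracts_weq
  let d := MorphismProperty.factorizationData (m.cof ⊓ m.weq) m.fib f
  have := hf d.p d.hp
  exact ⟨m.cof.of_retract (RetractArrow.ofLeftLiftingProperty d.fac) d.hi.1,
    m.weq.of_retract (RetractArrow.ofLeftLiftingProperty d.fac) d.hi.2⟩

variable {N : Type u₂} [Category.{v₂} N] {B : Type u₁} [Category.{v₁} B] (π : N ⥤ B) (V : N ⥤ C)

/-- The weak equivalences and fibrations of `n` are detected by `π` and `V`, and the cofibrations
are the maps which lift against vertical trivial fibrations and lie over cofibrations. -/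
structure IsDetected (n : ModelClasses N) (m : ModelClasses B) : Prop where
  bifib : IsBifibration π V
  weq_eq : n.weq = m.weq.inverseImage π ⊓ (weakEquivalences C).inverseImage V
  fib_eq : n.fib = m.fib.inverseImage π ⊓ (fibrations C).inverseImage V
  cof_eq : n.cof = m.cof.inverseImage π ⊓ (vertical π V (trivialFibrations C)).llp
  factor_trivial_fib : ∀ ⦃b : B⦄ ⦃X Y : N⦄ (ψ : X ⟶ Y), π.IsHomLift (𝟙 b) ψ →
    ∃ (Z : N) (i : X ⟶ Z) (p : Z ⟶ Y), i ≫ p = ψ ∧ π.IsHomLift (𝟙 b) i ∧ π.IsHomLift (𝟙 b) p ∧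
      FiberLlp π V (trivialFibrations C) b i ∧ trivialFibrations C (V.map p)
  factor_trivial_cof : ∀ ⦃b : B⦄ ⦃X Y : N⦄ (ψ : X ⟶ Y), π.IsHomLift (𝟙 b) ψ →
    ∃ (Z : N) (i : X ⟶ Z) (p : Z ⟶ Y), i ≫ p = ψ ∧ π.IsHomLift (𝟙 b) i ∧ π.IsHomLift (𝟙 b) p ∧
      FiberLlp π V (fibrations C) b i ∧ (weakEquivalences C).inverseImage V i ∧
        fibrations C (V.map p)
  weq_of_trivial_cof : ∀ ⦃X Y : N⦄ (c : X ⟶ Y), π.IsStronglyCocartesian (π.map c) c →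
    m.cof (π.map c) → m.weq (π.map c) → weakEquivalences C (V.map c)

variable {π V} {n : ModelClasses N} {m : ModelClasses B} (h : IsDetected π V n m)

namespace IsDetected
include h

lemma trivial_fib_eq : n.fib ⊓ n.weq =
    (m.fib ⊓ m.weq).inverseImage π ⊓ (trivialFibrations C).inverseImage V := by
  rw [h.fib_eq, h.weq_eq]
  ext X Y f
  exact ⟨fun h ↦ ⟨⟨h.1.1, h.2.1⟩, h.1.2, h.2.2⟩, fun h ↦ ⟨⟨h.1.1, h.2.1⟩, h.1.2, h.2.2⟩⟩

lemma weq_of_cocartesian {X Y : N} {b : B} (f : π.obj X ⟶ b) (c : X ⟶ Y)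
    (hc : π.IsStronglyCocartesian f c) (h₁ : m.cof f) (h₂ : m.weq f) :
    weakEquivalences C (V.map c) := by
  obtain rfl := IsHomLift.codomain_eq π f c
  obtain rfl := IsHomLift.eq_of_isHomLift π f c
  exact h.weq_of_trivial_cof c hc h₁ h₂

/-- Over a trivial cofibration the coCartesian part of the factorization is a weak equivalence by
`weq_of_trivial_cof`, and the fibrewise part is one by choice. -/
lemma exists_factor {X Y : N} (φ : X ⟶ Y) (hφ : m.cof (π.map φ)) (hφ' : m.weq (π.map φ)) :
    ∃ (Z : N) (i : X ⟶ Z) (p : Z ⟶ Y), i ≫ p = φ ∧ (vertical π V (fibrations C)).llp i ∧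
      weakEquivalences C (V.map i) ∧ vertical π V (fibrations C) p := by
  obtain ⟨Z, i, p, hip, hZ, hi, hp, hl, hr, E, c, j, rfl, hc, hj⟩ :=
    h.bifib.exists_factor h.factor_trivial_cof φ (π.map φ) (𝟙 _) (Category.comp_id _)
  refine ⟨Z, c ≫ j, p, hip, hl, ?_, isIso_of_isHomLift_id (b := π.obj Y) p, hr⟩
  rw [V.map_comp]
  refine MorphismProperty.comp_mem _ _ _ ?_ hj
  exact h.weq_of_cocartesian _ c hc hφ hφ'

/-- Two retract arguments on the factorization `φ = i ≫ p` above. If `φ` is a trivial cofibration,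
two-out-of-three makes `p` a vertical trivial fibration, so `φ` is a retract of `i`. Conversely,
lifting against `p` makes `φ` a retract of `i`, whose image under `V` is a weak equivalence. -/
lemma trivial_cof_eq : n.cof ⊓ n.weq =
    (m.cof ⊓ m.weq).inverseImage π ⊓ (vertical π V (fibrations C)).llp := by
  rw [h.cof_eq, h.weq_eq]
  ext X Y φ
  constructor
  · rintro ⟨⟨h₁, h₂⟩, h₃, h₄⟩
    obtain ⟨Z, i, p, rfl, hi, hi', hp⟩ := h.exists_factor φ h₁ h₃
    have hw : weakEquivalences C (V.map p) := by
      have h₄' : weakEquivalences C (V.map (i ≫ p)) := h₄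
      rw [V.map_comp] at h₄'
      exact MorphismProperty.of_precomp _ _ _ hi' h₄'
    have := h₂ p ⟨hp.1, hp.2, hw⟩
    exact ⟨⟨h₁, h₃⟩, MorphismProperty.of_retract (RetractArrow.ofLeftLiftingProperty rfl) hi⟩
  · rintro ⟨⟨h₁, h₃⟩, h₂⟩
    obtain ⟨Z, i, p, hip, hi, hi', hp⟩ := h.exists_factor φ h₁ h₃
    have := h₂ p hp
    exact ⟨⟨h₁, fun _ _ p hp ↦ h₂ p ⟨hp.1, hp.2.1⟩⟩, h₃,
      (weakEquivalences C).of_retract ((RetractArrow.ofLeftLiftingProperty hip).map V) hi'⟩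

lemma isRelativeModelCategory (hm : m.IsPreModel)
    [∀ b, HasLimitsOfSize.{w, w} (π.Fiber b)] [∀ b, HasColimitsOfSize.{w, w} (π.Fiber b)] :
    IsRelativeModelCategory.{w} π n m := by
  have := hm.weq
  have := hm.cof
  have := hm.fib
  exact
    { preModel_base := hm
      preModel_total :=
        { weq := by rw [h.weq_eq]; infer_instance
          cof := by rw [h.cof_eq]; infer_instance
          fib := by rw [h.fib_eq]; infer_instance }
      cocomplete := relativelyCocomplete h.bifib.cocartesian
      complete := relativelyComplete h.bifib.cartesian
      weq_comp := by
        rw [h.weq_eq]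
        exact fun _ _ _ f g hf hg hfg ↦ ⟨hfg, MorphismProperty.comp_mem _ _ _ hf.2 hg.2⟩
      weq_of_postcomp := by
        rw [h.weq_eq]
        exact fun _ _ _ f g hg hfg hf ↦ ⟨hf, MorphismProperty.of_postcomp _ _ _ hg.2 hfg.2⟩
      weq_of_precomp := by
        rw [h.weq_eq]
        exact fun _ _ _ f g hf hfg hg ↦ ⟨hg, MorphismProperty.of_precomp _ _ _ hf.2 hfg.2⟩
      wfs_trivial_cof := by
        rw [h.trivial_cof_eq, h.fib_eq]
        refine h.bifib.isRelativeWFS (fun b X Y ψ hψ ↦ ?_) _ _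
        obtain ⟨Z, i, p, h₁, h₂, h₃, h₄, -, h₅⟩ := h.factor_trivial_cof ψ hψ
        exact ⟨Z, i, p, h₁, h₂, h₃, h₄, h₅⟩
      wfs_trivial_fib := by
        rw [h.trivial_fib_eq, h.cof_eq]
        exact h.bifib.isRelativeWFS h.factor_trivial_fib _ _ }

lemma isModelFibration (hm : m.IsPreModel)
    [∀ b, HasLimitsOfSize.{w, w} (π.Fiber b)] [∀ b, HasColimitsOfSize.{w, w} (π.Fiber b)]
    (hc : ∀ ⦃X Y : N⦄ (f : X ⟶ Y), π.IsStronglyCocartesian (π.map f) f →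
      IsRelativelyCofibrant π n X → m.weq (π.map f) → weakEquivalences C (V.map f)) :
    IsModelFibration.{w} π n m where
  relative := h.isRelativeModelCategory hm
  cartesian := h.bifib.cartesian
  cocartesian := h.bifib.cocartesian
  weq_of_cocartesian X Y f hf hX hf' := by
    rw [h.weq_eq]
    exact ⟨hf', hc f hf hX hf'⟩
  weq_of_cartesian X Y f hf hX hf' := by
    rw [h.weq_eq]
    have := h.bifib.isIso f _ hf
    exact ⟨hf', MorphismProperty.of_isIso (weakEquivalences C) (V.map f)⟩

/-- A square against a total trivial fibration is solved in the base and then above it. Conversely,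
vertical trivial fibrations are among the total ones, and terminal objects of the fibres transfer
the lifting property to the base. -/
lemma cof_eq_llp [∀ b, HasTerminal (π.Fiber b)] (hm : m.cof = (m.fib ⊓ m.weq).llp)
    (hi : (m.fib ⊓ m.weq).ContainsIdentities) (hr : (m.fib ⊓ m.weq).RespectsIso) :
    n.cof = (n.fib ⊓ n.weq).llp := by
  rw [h.trivial_fib_eq]
  ext X Y φ
  constructor
  · rw [h.cof_eq]
    rintro ⟨h₁, h₂⟩ Z W p hp
    rw [hm] at h₁
    refine ⟨fun {s t} sq ↦ ?_⟩
    have := h₁ (π.map p) hp.1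
    have sq' : CommSq (π.map s) (π.map φ) (π.map p) (π.map t) := sq.map π
    obtain ⟨k, hk, hk', -⟩ := h.bifib.exists_lift h₂ hp.2 s t sq.w sq'.lift sq'.fac_left sq'.fac_right
    exact ⟨⟨{ l := k, fac_left := hk, fac_right := hk' }⟩⟩
  · intro hφ
    rw [h.cof_eq]
    refine ⟨?_, fun Z W p hp ↦ hφ p ⟨?_, hp.2⟩⟩
    · rw [hm]
      exact h.bifib.map_mem_llp hφ
    · have := hp.1
      exact MorphismProperty.of_isIso (m.fib ⊓ m.weq) (π.map p)

end IsDetected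

variable {N : Type u₂} [Category.{v} N] {B : Type u₁} [Category.{v} B]
  {π : N ⥤ B} {V : N ⥤ C} {n : ModelClasses N} {U : B ⥤ C} {F : C ⥤ B}

lemma ModelClasses.isPreModel_transfer : (ModelClasses.transfer U).IsPreModel where
  weq := inferInstanceAs ((weakEquivalences C).inverseImage U).IsMultiplicative
  cof := inferInstanceAs
    (((fibrations C).inverseImage U ⊓ (weakEquivalences C).inverseImage U).llp).IsMultiplicative
  fib := inferInstanceAs ((fibrations C).inverseImage U).IsMultiplicative

/-- The classes on `N` are detected by the two right adjoints `π ⋙ U` and `V` to `C`, so the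
transfer theorem for families applies. -/
lemma IsDetected.isModel (h : IsDetected π V n (ModelClasses.transfer U)) (hC : IsCombinatorial C)
    (hm : (ModelClasses.transfer U).IsModel) (adj : F ⊣ U)
    [∀ b, HasLimitsOfSize.{v, v} (π.Fiber b)] [∀ b, HasColimitsOfSize.{v, v} (π.Fiber b)]
    [PreservesFilteredColimitsOfSize.{v, v} U] [PreservesFilteredColimitsOfSize.{v, v} V]
    [V.IsRightAdjoint] : n.IsModel := by
  have := hm.hasLimits
  have := hm.hasColimits
  have : HasLimits N := hasLimits_of_relativelyComplete
    (relativelyComplete h.bifib.cartesian) h.bifib.cocartesian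
  have : HasColimits N := hasColimits_of_relativelyCocomplete
    (relativelyCocomplete h.bifib.cocartesian) h.bifib.cartesian
  have (b : B) : HasTerminal (π.Fiber b) :=
    have := hasLimitsOfSizeShrink.{0, 0, v, v} (π.Fiber b)
    inferInstance
  have (b : B) : HasInitial (π.Fiber b) :=
    have := hasColimitsOfSizeShrink.{0, 0, v, v} (π.Fiber b)
    inferInstance
  have := isRightAdjoint_of_cartesian h.bifib.cartesian
  have := isLeftAdjoint_of_cocartesian h.bifib.cocartesian
  have := adj.isRightAdjoint
  let W (k : Bool) : N ⥤ C := if k then V else π ⋙ U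
  have : ∀ k, (W k).IsRightAdjoint := by
    rintro (_ | _)
    · exact inferInstanceAs (π ⋙ U).IsRightAdjoint
    · exact inferInstanceAs V.IsRightAdjoint
  have : PreservesColimitsOfSize.{v, v} π := (Adjunction.ofIsLeftAdjoint π).leftAdjoint_preservesColimits
  have : ∀ k, PreservesFilteredColimitsOfSize.{v, v} (W k) := by
    rintro (_ | _)
    · exact inferInstanceAs (PreservesFilteredColimitsOfSize.{v, v} (π ⋙ U))
    · exact inferInstanceAs (PreservesFilteredColimitsOfSize.{v, v} V)
  refine ModelClasses.isModel_of_family (fun k ↦ Adjunction.ofIsRightAdjoint (W k)) hC n ?_ ?_ ?_ ?_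
  · rw [h.weq_eq]
    intro X Y f
    exact ⟨fun hf k ↦ by cases k; exacts [hf.1, hf.2], fun hf ↦ ⟨hf false, hf true⟩⟩
  · rw [h.fib_eq]
    intro X Y f
    exact ⟨fun hf k ↦ by cases k; exacts [hf.1, hf.2], fun hf ↦ ⟨hf false, hf true⟩⟩
  · exact h.cof_eq_llp rfl
      (inferInstanceAs
        ((fibrations C).inverseImage U ⊓ (weakEquivalences C).inverseImage U).ContainsIdentities)
      (inferInstanceAs
        ((fibrations C).inverseImage U ⊓ (weakEquivalences C).inverseImage U).RespectsIso)
  · intro X Y φ hφ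
    rw [h.fib_eq] at hφ
    -- Acyclicity: the base component lifts against fibrations and is thus a trivial cofibration,
    -- while `φ` itself lifts against vertical fibrations; `trivial_cof_eq` combines the two.
    have h₁ := hm.llp_fib_le _ (h.bifib.map_mem_llp hφ)
    have h₂ : (n.cof ⊓ n.weq) φ := by
      rw [h.trivial_cof_eq]
      refine ⟨h₁, fun Z W p hp ↦ hφ p ⟨?_, hp.2⟩⟩
      have := hp.1
      exact MorphismProperty.of_isIso (fibrations C) (U.map (π.map p))
    exact h₂.2

end Detected

/-! ### The integral model structure of a diagram with an underlying functor. -/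

namespace AdjDiagram
variable {A : Type u₁} [Category.{v₁} A] (F : AdjDiagram.{v₁, u₁, v₂, u₂} A)

/-- The inclusion of the fibre over `a`. -/
abbrev incl (a : A) : F.res.obj ⟨op a⟩ ⥤ F.Total := Pseudofunctor.CoGrothendieck.ι F.res a

/-- The coCartesian morphism `(a, X) ⟶ (b, f_! X)`. -/
def cocart {a b : A} (M : F.res.obj ⟨op a⟩) (f : a ⟶ b) :
    (F.incl a).obj M ⟶ (F.incl b).obj ((F.ext f).obj M) :=
  ⟨f, (F.adj f).unit.app M⟩

variable {F}

instance {a : A} {M N : F.res.obj ⟨op a⟩} (g : M ⟶ N) :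
    F.proj.IsHomLift (𝟙 a) ((F.incl a).map g) := .map ((F.incl a).map g)

lemma exists_incl_map {a : A} {M N : F.res.obj ⟨op a⟩} (φ : (F.incl a).obj M ⟶ (F.incl a).obj N)
    (h : F.proj.IsHomLift (𝟙 a) φ) : ∃ g, (F.incl a).map g = φ := by
  let I := Functor.Fiber.inducedFunctor (Pseudofunctor.CoGrothendieck.comp_const F.res a)
  let φ' : I.obj M ⟶ I.obj N := ⟨φ, h⟩
  obtain ⟨g, hg⟩ := I.map_surjective φ'
  exact ⟨g, congrArg Functor.Fiber.fiberInclusion.map hg⟩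

lemma incl_map_injective {a : A} {M N : F.res.obj ⟨op a⟩} {g g' : M ⟶ N}
    (h : (F.incl a).map g = (F.incl a).map g') : g = g' :=
  (Functor.Fiber.inducedFunctor (Pseudofunctor.CoGrothendieck.comp_const F.res a)).map_injective
    (Subtype.ext h)

variable {C : Type u} [Category.{v} C] [ModelCategory C] {m : ModelClasses A}

variable (F m) in
/-- A functor which plays the role of the forgetful functor to `C` on all the fibres. -/
structure IsUnderlying (V : F.Total ⥤ C) : Prop where
  isModel : ∀ a, (F.classes a).IsModel
  isIso : ∀ ⦃a b : A⦄ (M : F.res.obj ⟨op b⟩) (f : a ⟶ b),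
    IsIso (V.map (Pseudofunctor.CoGrothendieck.cartesianLift M f))
  cocartesian : ∀ ⦃a b : A⦄ (M : F.res.obj ⟨op a⟩) (f : a ⟶ b),
    F.proj.IsStronglyCocartesian f (F.cocart M f)
  cocart_adjoint : ∀ ⦃X Y : F.Total⦄ (φ : X ⟶ Y),
    F.cocart X.fiber φ.base ≫ (F.incl Y.base).map (F.adjoint φ) = φ
  cocart_naturality : ∀ ⦃a b : A⦄ (f : a ⟶ b) ⦃M N : F.res.obj ⟨op a⟩⦄ (g : M ⟶ N),
    F.cocart M f ≫ (F.incl b).map ((F.ext f).map g) =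
      (F.incl a).map g ≫ F.cocart N f
  weq_iff : ∀ ⦃a : A⦄ ⦃M N : F.res.obj ⟨op a⟩⦄ (g : M ⟶ N),
    (F.classes a).weq g ↔ weakEquivalences C (V.map ((F.incl a).map g))
  fib_iff : ∀ ⦃a : A⦄ ⦃M N : F.res.obj ⟨op a⟩⦄ (g : M ⟶ N),
    (F.classes a).fib g ↔ fibrations C (V.map ((F.incl a).map g))
  cof_eq : ∀ a, (F.classes a).cof = ((F.classes a).fib ⊓ (F.classes a).weq).llp
  fib_fiber_iff : ∀ ⦃X Y : F.Total⦄ (φ : X ⟶ Y),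
    (F.classes X.base).fib φ.fiber ↔ fibrations C (V.map φ)
  weq_of_cofibrant : ∀ ⦃a b : A⦄ (M : F.res.obj ⟨op a⟩) (f : a ⟶ b), m.weq f →
    (F.classes a).IsCofibrant M → weakEquivalences C (V.map (F.cocart M f))
  weq_of_trivial_cof : ∀ ⦃a b : A⦄ (M : F.res.obj ⟨op a⟩) (f : a ⟶ b), m.cof f → m.weq f →
    weakEquivalences C (V.map (F.cocart M f))

namespace IsUnderlying
variable {V : F.Total ⥤ C} (h : F.IsUnderlying m V)
include h

/-- Cartesian maps over the same base map with the same target are isomorphic, so it is enough that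
`V` inverts the chosen ones. -/
lemma isBifibration : IsBifibration F.proj V where
  cartesian Y b f := ⟨_, _, Pseudofunctor.CoGrothendieck.isStronglyCartesian_homCartesianLift Y.fiber f⟩
  cocartesian X b f := ⟨_, _, h.cocartesian X.fiber f⟩
  isIso X Y φ b c f hφ := by
    obtain rfl := IsHomLift.codomain_eq F.proj f φ
    let κ := Pseudofunctor.CoGrothendieck.cartesianLift Y.fiber f
    have : F.proj.IsStronglyCartesian f κ :=
      Pseudofunctor.CoGrothendieck.isStronglyCartesian_homCartesianLift Y.fiber f
    have : IsIso (V.map κ) := h.isIso Y.fiber f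
    let e := Functor.IsCartesian.domainUniqueUpToIso F.proj f φ κ
    have he : e.inv ≫ κ = φ := Functor.IsCartesian.fac F.proj f κ φ
    rw [← he, V.map_comp]
    infer_instance

lemma exists_cofibrant (a : A) (M : F.res.obj ⟨op a⟩) : ∃ (M' : F.res.obj ⟨op a⟩) (q : M' ⟶ M),
    (F.classes a).IsCofibrant M' ∧ (F.classes a).fib q ∧ (F.classes a).weq q := by
  have := (h.isModel a).hasColimits
  have : HasInitial (F.res.obj ⟨op a⟩) :=
    have := hasColimitsOfSizeShrink.{0, 0, v₂, v₂} (F.res.obj ⟨op a⟩)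
    inferInstance
  have := (h.isModel a).factor_trivial_fib
  let d := MorphismProperty.factorizationData (F.classes a).cof
    ((F.classes a).fib ⊓ (F.classes a).weq) (initial.to M)
  refine ⟨d.Z, d.p, ⟨⊥_ _, initialIsInitial, ?_⟩, d.hp⟩
  rw [initialIsInitial.hom_ext (initialIsInitial.to d.Z) d.i]
  exact d.hi

/-- In the square comparing the derived adjoint map with `φ`, the coCartesian map out of the
cofibrant object `M` and the map `q` are weak equivalences. Two-out-of-three removes the cofibrant
replacement from the definition. -/
lemma weq_iff_of_cofibrant {X Y : F.Total} (φ : X ⟶ Y) (hφ : m.weq φ.base)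
    {M : F.res.obj ⟨op X.base⟩} (q : M ⟶ X.fiber) (hM : (F.classes X.base).IsCofibrant M)
    (hq : (F.classes X.base).weq q) :
    (F.classes Y.base).weq ((F.ext φ.base).map q ≫ F.adjoint φ) ↔ weakEquivalences C (V.map φ) := by
  let φ' : (F.incl X.base).obj X.fiber ⟶ (F.incl Y.base).obj Y.fiber := φ
  have hφ' : F.cocart X.fiber φ.base ≫ (F.incl Y.base).map (F.adjoint φ) = φ' := h.cocart_adjoint φ
  have e : F.cocart M φ.base ≫
      (F.incl Y.base).map ((F.ext φ.base).map q ≫ F.adjoint φ) = (F.incl X.base).map q ≫ φ' := by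
    rw [Functor.map_comp, reassoc_of% (h.cocart_naturality φ.base q), hφ']
  have e' := congrArg V.map e
  rw [V.map_comp, V.map_comp] at e'
  change _ ↔ weakEquivalences C (V.map φ')
  rw [h.weq_iff] at hq ⊢
  rw [← (weakEquivalences C).precomp_iff _ _ (h.weq_of_cofibrant M φ.base hφ hM), e']
  exact (weakEquivalences C).precomp_iff _ _ hq

lemma fiberLlp {a : A} {M N : F.res.obj ⟨op a⟩} {i : M ⟶ N} {Q : MorphismProperty C}
    (hi : ∀ ⦃Z W : F.res.obj ⟨op a⟩⦄ (p : Z ⟶ W), Q (V.map ((F.incl a).map p)) →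
      HasLiftingProperty i p) : FiberLlp F.proj V Q a ((F.incl a).map i) := by
  intro Z W p hp hpQ s t hs ht w
  obtain ⟨b, Z⟩ := Z
  obtain ⟨c, W⟩ := W
  obtain rfl : b = a := IsHomLift.domain_eq F.proj (𝟙 a) p
  obtain rfl : c = b := IsHomLift.codomain_eq F.proj (𝟙 b) p
  obtain ⟨p, rfl⟩ := exists_incl_map p hp
  obtain ⟨s, rfl⟩ := exists_incl_map s hs
  obtain ⟨t, rfl⟩ := exists_incl_map t ht
  have := hi p hpQ
  have sq : CommSq s i p t := ⟨incl_map_injective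
    ((Functor.map_comp _ s p).trans (w.trans (Functor.map_comp _ i t).symm))⟩
  exact ⟨(F.incl c).map sq.lift,
    (Functor.map_comp _ i sq.lift).symm.trans (congrArg (F.incl c).map sq.fac_left),
    (Functor.map_comp _ sq.lift p).symm.trans (congrArg (F.incl c).map sq.fac_right)⟩

lemma vertical_incl {a : A} {M N : F.res.obj ⟨op a⟩} {Q : MorphismProperty C} (p : M ⟶ N)
    (hp : Q (V.map ((F.incl a).map p))) : vertical F.proj V Q ((F.incl a).map p) :=
  ⟨isIso_of_isHomLift_id (b := a) ((F.incl a).map p), hp⟩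

lemma exists_lift_incl {X Y : F.Total} {φ : X ⟶ Y} {Q : MorphismProperty C}
    (hφ : (vertical F.proj V Q).llp φ) {M N : F.res.obj ⟨op Y.base⟩} (p : M ⟶ N)
    (hp : Q (V.map ((F.incl _).map p))) (s : X ⟶ (F.incl _).obj M) (t : Y.fiber ⟶ N)
    (w : s ≫ (F.incl _).map p = φ ≫ (F.incl Y.base).map t) :
    ∃ k : Y.fiber ⟶ M, φ ≫ (F.incl Y.base).map k = s ∧ k ≫ p = t := by
  have := hφ _ (h.vertical_incl p hp)
  let t' : Y ⟶ (F.incl Y.base).obj N := (F.incl Y.base).map t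
  have sq : CommSq s φ ((F.incl _).map p) t' := ⟨w⟩
  -- Both `p` and `t` lie over identities, which forces the lift to lie in the fibre.
  have hk : F.proj.IsHomLift (𝟙 Y.base) sq.lift := by
    have := congrArg F.proj.map sq.fac_right
    rw [F.proj.map_comp] at this
    have h' : F.proj.map sq.lift = 𝟙 Y.base := (Category.comp_id _).symm.trans this
    exact isHomLift_congr (.map sq.lift) h'
  obtain ⟨k, hk⟩ := exists_incl_map (M := Y.fiber) sq.lift hk
  exact ⟨k, (congrArg (φ ≫ ·) hk).trans sq.fac_left, incl_map_injective
    ((Functor.map_comp _ k p).trans ((congrArg (· ≫ _) hk).trans sq.fac_right))⟩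

/-- `φ` is a coCartesian map followed by its adjoint in the fibre. The coCartesian part lifts
uniquely against vertical maps, so only the adjoint matters. -/
lemma cof_adjoint_iff {X Y : F.Total} (φ : X ⟶ Y) : (F.classes Y.base).cof (F.adjoint φ) ↔
    (vertical F.proj V (trivialFibrations C)).llp φ := by
  constructor
  · intro hφ
    have h₁ := llp_vertical_of_cocartesian (V := V) (Q := trivialFibrations C) φ.base
      (h.cocartesian X.fiber φ.base)
    have h₂ := h.isBifibration.llp_of_fiberLlp (b := Y.base)
      (h.fiberLlp (i := F.adjoint φ) (Q := trivialFibrations C) fun Z W p hp ↦ by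
        rw [h.cof_eq] at hφ
        exact hφ p ⟨(h.fib_iff p).2 hp.1, (h.weq_iff p).2 hp.2⟩)
    rw [← h.cocart_adjoint φ]
    exact (vertical F.proj V (trivialFibrations C)).llp.comp_mem _ _ h₁ h₂
  · intro hφ
    rw [h.cof_eq]
    intro M N p hp
    refine ⟨fun {s t} sq ↦ ?_⟩
    let c : X ⟶ (F.incl Y.base).obj ((F.ext φ.base).obj X.fiber) := F.cocart X.fiber φ.base
    have hc : F.proj.IsStronglyCocartesian φ.base c := h.cocartesian X.fiber φ.base
    let φ' : X ⟶ (F.incl Y.base).obj Y.fiber := φ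
    have hφ' : c ≫ (F.incl Y.base).map (F.adjoint φ) = φ' := h.cocart_adjoint φ
    have w : (c ≫ (F.incl Y.base).map s) ≫ (F.incl Y.base).map p = φ' ≫ (F.incl Y.base).map t := by
      rw [Category.assoc, ← Functor.map_comp, sq.w, Functor.map_comp, reassoc_of% hφ']
    obtain ⟨k, hk, hk'⟩ := h.exists_lift_incl hφ p ⟨(h.fib_iff p).1 hp.1, (h.weq_iff p).1 hp.2⟩
      (c ≫ (F.incl Y.base).map s) t w
    refine ⟨⟨{ l := k, fac_left := incl_map_injective ?_, fac_right := hk' }⟩⟩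
    refine Functor.IsStronglyCocartesian.ext F.proj φ.base c (𝟙 Y.base) ?_
    rw [Functor.map_comp, reassoc_of% hφ']
    exact hk

lemma weq_of_isStronglyCocartesian {X Y : F.Total} (c : X ⟶ Y)
    (hc : F.proj.IsStronglyCocartesian (F.proj.map c) c)
    (hX : weakEquivalences C (V.map (F.cocart X.fiber c.base))) : weakEquivalences C (V.map c) := by
  let κ : X ⟶ (F.incl Y.base).obj ((F.ext c.base).obj X.fiber) := F.cocart X.fiber c.base
  let c' : X ⟶ (F.incl Y.base).obj Y.fiber := c
  let ψ : (F.incl Y.base).obj ((F.ext c.base).obj X.fiber) ⟶ (F.incl Y.base).obj Y.fiber :=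
    (F.incl Y.base).map (F.adjoint c)
  have hc' : κ ≫ ψ = c' := h.cocart_adjoint c
  have h₁ : F.proj.IsStronglyCocartesian c.base κ := h.cocartesian X.fiber c.base
  have h₀ : F.proj.IsHomLift (𝟙 Y.base) ψ := .map ψ
  have h₂ : F.proj.IsStronglyCocartesian (c.base ≫ 𝟙 Y.base) (κ ≫ ψ) := by
    rw [hc', Category.comp_id]
    exact hc
  have h₃ : F.proj.IsStronglyCocartesian (𝟙 Y.base) ψ :=
    Functor.IsStronglyCocartesian.of_comp (p := F.proj) (f := c.base) (φ := κ)
  have h₄ : IsIso ψ := Functor.IsStronglyCocartesian.isIso_of_base_isIso F.proj (𝟙 Y.base) ψ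
  change weakEquivalences C (V.map c')
  rw [← hc', V.map_comp]
  exact MorphismProperty.comp_mem _ _ _ hX (MorphismProperty.of_isIso _ _)

lemma isDetected : IsDetected F.proj V (F.integral m) m where
  bifib := h.isBifibration
  weq_eq := by
    ext X Y φ
    refine ⟨fun ⟨hφ, M, q, hM, _, hq, hw⟩ ↦ ⟨hφ, (h.weq_iff_of_cofibrant φ hφ q hM hq).1 hw⟩,
      fun ⟨hφ, hw⟩ ↦ ?_⟩
    obtain ⟨M, q, hM, hq', hq⟩ := h.exists_cofibrant _ X.fiber
    exact ⟨hφ, M, q, hM, hq', hq, (h.weq_iff_of_cofibrant φ hφ q hM hq).2 hw⟩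
  fib_eq := by
    ext X Y φ
    exact and_congr Iff.rfl (h.fib_fiber_iff φ)
  cof_eq := by
    ext X Y φ
    exact and_congr Iff.rfl (h.cof_adjoint_iff φ)
  factor_trivial_fib b X Y ψ hψ := by
    obtain ⟨a, M⟩ := X
    obtain ⟨c, N⟩ := Y
    obtain rfl : a = b := IsHomLift.domain_eq F.proj (𝟙 b) ψ
    obtain rfl : c = a := IsHomLift.codomain_eq F.proj (𝟙 a) ψ
    obtain ⟨ψ, rfl⟩ := exists_incl_map ψ hψ
    have := (h.isModel c).factor_trivial_fib
    let d := MorphismProperty.factorizationData (F.classes c).cof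
      ((F.classes c).fib ⊓ (F.classes c).weq) ψ
    refine ⟨(F.incl c).obj d.Z, (F.incl c).map d.i, (F.incl c).map d.p, ?_,
      .map ((F.incl c).map d.i), .map ((F.incl c).map d.p), h.fiberLlp fun Z W p hp ↦ ?_, (h.fib_iff _).1 d.hp.1, (h.weq_iff _).1 d.hp.2⟩
    · exact (Functor.map_comp _ d.i d.p).symm.trans (congrArg (F.incl c).map d.fac)
    · exact (h.isModel c).lift_trivial_fib _ _ d.hi ((h.fib_iff p).2 hp.1) ((h.weq_iff p).2 hp.2)
  factor_trivial_cof b X Y ψ hψ := by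
    obtain ⟨a, M⟩ := X
    obtain ⟨c, N⟩ := Y
    obtain rfl : a = b := IsHomLift.domain_eq F.proj (𝟙 b) ψ
    obtain rfl : c = a := IsHomLift.codomain_eq F.proj (𝟙 a) ψ
    obtain ⟨ψ, rfl⟩ := exists_incl_map ψ hψ
    have := (h.isModel c).factor_trivial_cof
    let d := MorphismProperty.factorizationData ((F.classes c).cof ⊓ (F.classes c).weq)
      (F.classes c).fib ψ
    refine ⟨(F.incl c).obj d.Z, (F.incl c).map d.i, (F.incl c).map d.p, ?_,
      .map ((F.incl c).map d.i), .map ((F.incl c).map d.p), h.fiberLlp fun Z W p hp ↦ ?_, (h.weq_iff _).1 d.hi.2, (h.fib_iff _).1 d.hp⟩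
    · exact (Functor.map_comp _ d.i d.p).symm.trans (congrArg (F.incl c).map d.fac)
    · exact (h.isModel c).lift_trivial_cof _ _ d.hi.1 d.hi.2 ((h.fib_iff p).2 hp)
  weq_of_trivial_cof X Y c hc h₁ h₂ :=
    h.weq_of_isStronglyCocartesian c hc (h.weq_of_trivial_cof X.fiber c.base h₁ h₂)

/-- Initial objects of the two versions of the fibre need not be compared: a lift over `X` is all
that cofibrancy asks for, and it comes from the total category. -/
lemma isCofibrant_fiber {X : F.Total} (hX : IsRelativelyCofibrant F.proj (F.integral m) X) :
    (F.classes X.base).IsCofibrant X.fiber := by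
  obtain ⟨E, hE, hE'⟩ := hX
  have := (h.isModel X.base).hasColimits
  have : HasInitial (F.res.obj ⟨op X.base⟩) :=
    have := hasColimitsOfSizeShrink.{0, 0, v₂, v₂} (F.res.obj ⟨op X.base⟩)
    inferInstance
  refine ⟨⊥_ _, initialIsInitial, ?_⟩
  rw [h.cof_eq]
  intro M N p hp
  refine ⟨fun {s t} _ ↦ ?_⟩
  rw [h.isDetected.cof_eq] at hE'
  let M' : F.proj.Fiber X.base := Functor.Fiber.mk (a := (F.incl X.base).obj M) rfl
  let N' : F.proj.Fiber X.base := Functor.Fiber.mk (a := (F.incl X.base).obj N) rfl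
  let X' : F.proj.Fiber X.base := Functor.Fiber.mk (a := X) rfl
  let p' : M' ⟶ N' := ⟨(F.incl X.base).map p, .map ((F.incl X.base).map p)⟩
  let t' : X' ⟶ N' := ⟨(F.incl X.base).map t, .map ((F.incl X.base).map t)⟩
  have w : hE.to M' ≫ p' = hE.to X' ≫ t' := hE.hom_ext _ _
  obtain ⟨k, -, hk⟩ := h.exists_lift_incl hE'.2 p
    ⟨(h.fib_iff p).1 hp.1, (h.weq_iff p).1 hp.2⟩ (hE.to M').1 t
    (congrArg Functor.Fiber.fiberInclusion.map w)
  exact ⟨⟨{ l := k, fac_left := initialIsInitial.hom_ext _ _, fac_right := hk }⟩⟩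

lemma hasLimits_fiber (a : A) : HasLimitsOfSize.{v₂, v₂} (F.proj.Fiber a) := by
  have := (h.isModel a).hasLimits
  exact Adjunction.has_limits_of_equivalence
    (Functor.Fiber.inducedFunctor (Pseudofunctor.CoGrothendieck.comp_const F.res a)).inv

lemma hasColimits_fiber (a : A) : HasColimitsOfSize.{v₂, v₂} (F.proj.Fiber a) := by
  have := (h.isModel a).hasColimits
  exact Adjunction.has_colimits_of_equivalence
    (Functor.Fiber.inducedFunctor (Pseudofunctor.CoGrothendieck.comp_const F.res a)).inv

lemma isModelFibration (hm : m.IsPreModel) :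
    IsModelFibration.{v₂} F.proj (F.integral m) m := by
  have := h.hasLimits_fiber
  have := h.hasColimits_fiber
  exact h.isDetected.isModelFibration hm fun X Y f hf hX hf' ↦
    h.weq_of_isStronglyCocartesian f hf (h.weq_of_cofibrant X.fiber f.base hf' (h.isCofibrant_fiber hX))

/-- Two-out-of-three in the naturality square of the units, which are weak equivalences over a
trivial cofibration. -/
lemma isLeftProper : F.IsLeftProper m := by
  intro a b f h₁ h₂ M N g hg
  rw [h.weq_iff] at hg ⊢
  have e := congrArg V.map (h.cocart_naturality f g)
  rw [V.map_comp, V.map_comp] at e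
  rw [← (weakEquivalences C).precomp_iff _ _ (h.weq_of_trivial_cof M f h₁ h₂), e]
  exact MorphismProperty.comp_mem _ _ _ hg (h.weq_of_trivial_cof N f h₁ h₂)

/-- Preservation by the left adjoint is the adjoint form of preservation of fibrations and weak
equivalences by restriction. -/
lemma isModelDiagram (hfib : ∀ ⦃a b : A⦄ (f : a ⟶ b) ⦃M N : F.res.obj ⟨op b⟩⦄ (g : M ⟶ N),
      (F.classes b).fib g → (F.classes a).fib ((F.res.map f.op.toLoc).toFunctor.map g))
    (hweq : ∀ ⦃a b : A⦄ (f : a ⟶ b) ⦃M N : F.res.obj ⟨op b⟩⦄ (g : M ⟶ N),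
      (F.classes b).weq g → (F.classes a).weq ((F.res.map f.op.toLoc).toFunctor.map g)) :
    F.IsModelDiagram where
  isModel := h.isModel
  ext_cof a b f M N g hg := by
    rw [h.cof_eq] at hg ⊢
    intro Z W p hp
    rw [(F.adj f).hasLiftingProperty_iff]
    exact hg _ ⟨hfib f p hp.1, hweq f p hp.2⟩
  ext_trivial_cof a b f M N g hg hg' := by
    refine ((h.isModel b).llp_fib_le _ fun Z W p hp ↦ ?_).2
    rw [(F.adj f).hasLiftingProperty_iff]
    exact (h.isModel a).lift_trivial_cof _ _ hg hg' (hfib f p hp)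

end IsUnderlying
end AdjDiagram

lemma AdjDiagram.IsUnderlying.integral_isModel {A : Type u₁} [Category.{v} A]
    {F : AdjDiagram.{v, u₁, v, u₂} A} {C : Type u} [Category.{v} C] [ModelCategory C]
    {U : A ⥤ C} {G : C ⥤ A} {V : F.Total ⥤ C} (h : F.IsUnderlying (ModelClasses.transfer U) V)
    (hC : IsCombinatorial C) (hm : (ModelClasses.transfer U).IsModel) (adj : G ⊣ U)
    [PreservesFilteredColimitsOfSize.{v, v} U] [PreservesFilteredColimitsOfSize.{v, v} V]
    [V.IsRightAdjoint] : (F.integral (ModelClasses.transfer U)).IsModel := by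
  have := h.hasLimits_fiber
  have := h.hasColimits_fiber
  exact h.isDetected.isModel hC hm adj

/-! ### Pairs of an algebra and a left module. -/

section TotalL
variable {C : Type u} [Category.{v} C] [MonoidalCategory C] [ModelCategory C]
  [∀ X : C, PreservesColimitsOfSize.{0, 0} (tensorLeft X)]
  [∀ X : C, PreservesColimitsOfSize.{0, 0} (tensorRight X)]

namespace TotalL

/-- The left module underlying a pair `(R, M)`. -/
def mod (X : (lmodDiagram C).Total) : LMod X.base := X.fiber

/-- The pair `(R, M)`. -/
def of {R : Mon C} (M : LMod R) : (lmodDiagram C).Total := ⟨R, M⟩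

/-- The map of underlying objects of a map of pairs. -/
def hom {X Y : (lmodDiagram C).Total} (φ : X ⟶ Y) : (mod X).X ⟶ (mod Y).X :=
  Mod.Hom.hom (M := mod X) (N := (resL φ.base).obj (mod Y)) φ.fiber

variable (C) in
/-- The functor `(R, M) ↦ M` to the ambient category. -/
def forget : (lmodDiagram C).Total ⥤ C where
  obj X := (mod X).X
  map φ := hom φ
  map_id X := rfl
  map_comp {X Y Z} φ ψ := by
    -- The extra identity is the underlying map of the pseudofunctor's composition isomorphism.
    change hom φ ≫ hom ψ ≫ 𝟙 _ = hom φ ≫ hom ψ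
    rw [Category.comp_id]

lemma hom_comp {X Y Z : (lmodDiagram C).Total} (φ : X ⟶ Y) (ψ : Y ⟶ Z) :
    hom (φ ≫ ψ) = hom φ ≫ hom ψ := (forget C).map_comp φ ψ

lemma lact_hom {X Y : (lmodDiagram C).Total} (φ : X ⟶ Y) :
    lact (mod X) ≫ hom φ = X.base.X ◁ hom φ ≫ φ.base.hom ▷ (mod Y).X ≫ lact (mod Y) :=
  ModFib.lact_hom (M := mod X) (N := (resL φ.base).obj (mod Y)) φ.fiber

/-- Maps of pairs from semilinear maps. -/
def mk {X Y : (lmodDiagram C).Total} (f : X.base ⟶ Y.base) (t : (mod X).X ⟶ (mod Y).X)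
    (ht : lact (mod X) ≫ t = X.base.X ◁ t ≫ f.hom ▷ (mod Y).X ≫ lact (mod Y)) : X ⟶ Y where
  base := f
  fiber := Mod.Hom.mk' (M := mod X) (N := (resL f).obj (mod Y)) t ht

lemma hom_ext {X Y : (lmodDiagram C).Total} {φ ψ : X ⟶ Y} (h : φ.base = ψ.base)
    (h' : hom φ = hom ψ) : φ = ψ := by
  obtain ⟨f, g⟩ := φ
  obtain ⟨f', g'⟩ := ψ
  obtain rfl : f = f' := h
  obtain rfl : g = g' := Mod.hom_ext (A := X.base.X) (M := mod X) (N := (resL f).obj (mod Y)) _ _ h'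
  rfl

lemma base_eq {X Y : (lmodDiagram C).Total} (f : X.base ⟶ Y.base) (φ : X ⟶ Y)
    (h : (lmodDiagram C).proj.IsHomLift f φ) : φ.base = f :=
  (@IsHomLift.eq_of_isHomLift _ _ _ _ (lmodDiagram C).proj _ _ f φ h).symm

lemma hom_incl {R : Mon C} {M N : LMod R} (g : M ⟶ N) :
    hom (((lmodDiagram C).incl R).map g) = g.hom := Category.comp_id _

lemma hom_cocart {R S : Mon C} (M : LMod R) (f : R ⟶ S) :
    hom ((lmodDiagram C).cocart M f) = unitL f M := unitL_eq f M

lemma incl_iff (P : MorphismProperty C) {R : Mon C} {M N : LMod R} (g : M ⟶ N) :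
    P (hom (((lmodDiagram C).incl R).map g)) ↔ P g.hom := by
  have h : P (hom (((lmodDiagram C).incl R).map g)) = P g.hom := congrArg (P ·) (hom_incl g)
  exact iff_of_eq h

lemma cocart_iff (P : MorphismProperty C) {R S : Mon C} (M : LMod R) (f : R ⟶ S) :
    P (hom ((lmodDiagram C).cocart M f)) ↔ P (unitL f M) := by
  have h : P (hom ((lmodDiagram C).cocart M f)) = P (unitL f M) := congrArg (P ·) (hom_cocart M f)
  exact iff_of_eq h

lemma unit_ext {R S : Mon C} (M : LMod R) (f : R ⟶ S) {Z : (lmodDiagram C).Total} (g : S ⟶ Z.base)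
    {a b : extLX f M ⟶ (mod Z).X}
    (ha : extLX.smul f M ≫ a = S.X ◁ a ≫ g.hom ▷ (mod Z).X ≫ lact (mod Z))
    (hb : extLX.smul f M ≫ b = S.X ◁ b ≫ g.hom ▷ (mod Z).X ≫ lact (mod Z))
    (h : unitL f M ≫ a = unitL f M ≫ b) : a = b := by
  apply extLX.hom_ext
  rw [extLX_π_eq, Category.assoc, Category.assoc, ha, hb,
    ← MonoidalCategory.whiskerLeft_comp_assoc, h, MonoidalCategory.whiskerLeft_comp_assoc]

/-- A map over `f ≫ g` is an `R`-linear map into a module restricted from `S`, so the adjunction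
extends it uniquely to `S ⊗_R M`. -/
lemma cocartesian {R S : Mon C} (M : LMod R) (f : R ⟶ S) :
    (lmodDiagram C).proj.IsStronglyCocartesian f ((lmodDiagram C).cocart M f) where
  toIsHomLift := .map (((lmodDiagram C).cocart M f))
  universal_property' {Z} g φ' hφ' := by
    have hb : φ'.base = f ≫ g := base_eq (X := of M) (f ≫ g) φ' hφ'
    have ht : lact M ≫ hom φ' = R.X ◁ hom φ' ≫ f.hom ▷ (mod Z).X ≫ g.hom ▷ (mod Z).X ≫
        lact (mod Z) := by
      have := lact_hom φ'
      rw [hb] at this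
      refine this.trans ?_
      exact congrArg (R.X ◁ hom φ' ≫ ·) (comp_whiskerRight_assoc f.hom g.hom _ _)
    obtain ⟨H, hH, hH'⟩ := exists_extLX_desc (f := f) (O := M) ((resL g).obj (mod Z)) (hom φ') ht
    refine ⟨mk (X := of ((extL f).obj M)) g H hH, ⟨.map (mk (X := of ((extL f).obj M)) g H hH), ?_⟩, ?_⟩
    · refine hom_ext hb.symm ?_
      refine (hom_comp _ _).trans ?_
      rw [hom_cocart]
      exact hH'
    · rintro χ ⟨hχ, hχ'⟩
      obtain rfl : χ.base = g := base_eq (X := of ((extL f).obj M)) g χ hχ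
      refine hom_ext rfl (unit_ext M f χ.base (lact_hom χ) hH ?_)
      refine Eq.trans ?_ hH'.symm
      have := congrArg hom hχ'
      rw [hom_comp, hom_cocart] at this
      exact this

lemma cocart_adjoint {X Y : (lmodDiagram C).Total} (φ : X ⟶ Y) :
    (lmodDiagram C).cocart X.fiber φ.base ≫
      ((lmodDiagram C).incl Y.base).map ((lmodDiagram C).adjoint φ) = φ := by
  refine hom_ext (Category.comp_id _) ?_
  refine (hom_comp _ _).trans ((congrArg (_ ≫ ·) (hom_incl _)).trans ?_)
  have := ((lmodDiagram C).adj φ.base).homEquiv_unit (f := (lmodDiagram C).adjoint φ)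
  have h := this.symm.trans
    ((((lmodDiagram C).adj φ.base).homEquiv X.fiber Y.fiber).apply_symm_apply φ.fiber)
  exact congrArg Mod.Hom.hom h

lemma cocart_naturality {R S : Mon C} (f : R ⟶ S) {M N : LMod R} (g : M ⟶ N) :
    (lmodDiagram C).cocart M f ≫ ((lmodDiagram C).incl S).map ((extL f).map g) =
      ((lmodDiagram C).incl R).map g ≫ (lmodDiagram C).cocart N f := by
  refine hom_ext ((Category.comp_id f).trans (Category.id_comp f).symm) ?_
  refine ((hom_comp _ _).trans (congrArg (_ ≫ ·) (hom_incl _))).trans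
    (Eq.trans ?_ ((hom_comp _ _).trans (congrArg (· ≫ _) (hom_incl _))).symm)
  exact congrArg Mod.Hom.hom ((adjL f).unit.naturality g).symm

/-! Filtered colimits of pairs are computed in the ambient category. -/

namespace Colimit
variable {J : Type u₁} [Category.{v₁} J] [IsSifted J]
  [∀ X : C, PreservesColimitsOfShape J (tensorLeft X)]
  [∀ X : C, PreservesColimitsOfShape J (tensorRight X)]
  (F : J ⥤ (lmodDiagram C).Total) {c : Cocone ((F ⋙ (lmodDiagram C).proj) ⋙ Mon.forget C)}
  (hc : IsColimit c) {d : Cocone (F ⋙ forget C)} (hd : IsColimit d)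

variable (c) in
def legB (j : J) : (F.obj j).base.X ⟶ c.pt := c.ι.app j

variable (d) in
def leg (j : J) : (mod (F.obj j)).X ⟶ d.pt := d.ι.app j

lemma w {i j : J} (f : i ⟶ j) : hom (F.map f) ≫ leg F d j = leg F d i := d.w f

variable {F} in
include hd in
lemma ext {Z : C} {a b : d.pt ⟶ Z} (h : ∀ j, leg F d j ≫ a = leg F d j ≫ b) : a = b :=
  hd.hom_ext h

variable {F} in
include hc hd in
lemma ext₂ {Z : C} {a b : c.pt ⊗ d.pt ⟶ Z}
    (h : ∀ j, (legB F c j ⊗ₘ leg F d j) ≫ a = (legB F c j ⊗ₘ leg F d j) ≫ b) : a = b :=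
  (isColimitTensor hc hd).hom_ext h

variable {F} in
include hc hd in
lemma ext₃ {Z : C} {a b : (c.pt ⊗ c.pt) ⊗ d.pt ⟶ Z}
    (h : ∀ j, ((legB F c j ⊗ₘ legB F c j) ⊗ₘ leg F d j) ≫ a =
      ((legB F c j ⊗ₘ legB F c j) ⊗ₘ leg F d j) ≫ b) : a = b :=
  (isColimitTensor (isColimitTensor hc hc) hd).hom_ext h

/-- Algebra and module vary together; siftedness makes the tensor product of the two colimits the
colimit of the diagonal, on which the given actions form a cocone. -/
def act : c.pt ⊗ d.pt ⟶ d.pt :=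
  (isColimitTensor hc hd).desc (Cocone.mk d.pt
    { app j := lact (mod (F.obj j)) ≫ leg F d j
      naturality i j f := by
        refine Eq.trans ?_ (Category.comp_id _).symm
        change ((F.map f).base.hom ⊗ₘ hom (F.map f)) ≫ lact (mod (F.obj j)) ≫ leg F d j =
          lact (mod (F.obj i)) ≫ leg F d i
        rw [← w F f, reassoc_of% (lact_hom (F.map f)), tensorHom_def', Category.assoc] })

lemma fac (j : J) : (legB F c j ⊗ₘ leg F d j) ≫ act F hc hd =
    lact (mod (F.obj j)) ≫ leg F d j :=
  (isColimitTensor hc hd).fac (Cocone.mk d.pt _) j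

def base : Mon C := MonColimit.pt (F ⋙ (lmodDiagram C).proj) hc

def module : LMod (base F hc) :=
  letI : ModObj (base F hc).X d.pt :=
    { smul := act F hc hd
      one_smul := by
        change MonColimit.one (F ⋙ (lmodDiagram C).proj) c ▷ d.pt ≫ act F hc hd = (λ_ d.pt).hom
        rw [← cancel_epi (λ_ d.pt).inv]
        refine ext hd fun j ↦ ?_
        have h : MonColimit.one (F ⋙ (lmodDiagram C).proj) c = η[(F.obj j).base.X] ≫ legB F c j :=
          MonColimit.one_eq (F ⋙ (lmodDiagram C).proj) j
        rw [leftUnitor_inv_naturality_assoc, whisker_exchange_assoc, h,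
          comp_whiskerRight_assoc, ← tensorHom_def_assoc, fac]
        simp
      mul_smul := by
        change MonColimit.mul (F ⋙ (lmodDiagram C).proj) hc ▷ d.pt ≫ act F hc hd =
          (α_ c.pt c.pt d.pt).hom ≫ c.pt ◁ act F hc hd ≫ act F hc hd
        refine ext₃ hc hd fun j ↦ ?_
        have h := fac F hc hd j
        have h' : (legB F c j ⊗ₘ legB F c j) ≫ MonColimit.mul (F ⋙ (lmodDiagram C).proj) hc =
          μ[(F.obj j).base.X] ≫ legB F c j := MonColimit.fac (F ⋙ (lmodDiagram C).proj) hc j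
        have h₁ : μ[(F.obj j).base.X] ≫ legB F c j ⊗ₘ leg F d j =
          μ[(F.obj j).base.X] ▷ (mod (F.obj j)).X ≫ (legB F c j ⊗ₘ leg F d j) := by
          simp [MonoidalCategory.tensorHom_def]
        have h₂ : legB F c j ⊗ₘ lact (mod (F.obj j)) ≫ leg F d j =
          (F.obj j).base.X ◁ lact (mod (F.obj j)) ≫ (legB F c j ⊗ₘ leg F d j) := by
          simp [tensorHom_def']
        rw [associator_naturality_assoc, ← tensorHom_id, ← id_tensorHom,
          tensorHom_comp_tensorHom_assoc, tensorHom_comp_tensorHom_assoc, h, h', Category.comp_id,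
          Category.comp_id, h₁, h₂, Category.assoc, Category.assoc, h, mul_lact_assoc] }
  ⟨d.pt⟩

/-- The cocone of pairs on a filtered colimit. -/
def cocone : Cocone F :=
  Cocone.mk (of (module F hc hd))
    { app j := mk (X := F.obj j) (Y := of (module F hc hd))
        ((MonColimit.cocone (F ⋙ (lmodDiagram C).proj) hc).ι.app j) (leg F d j) (by
          refine (fac F hc hd j).symm.trans ?_
          rw [tensorHom_def', Category.assoc]
          rfl)
      naturality i j f := by
        refine Eq.trans ?_ (Category.comp_id _).symm
        exact hom_ext ((MonColimit.cocone (F ⋙ (lmodDiagram C).proj) hc).w f)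
          ((hom_comp _ _).trans (w F f)) }

def desc (s : Cocone F) : d.pt ⟶ (mod s.pt).X := hd.desc ((forget C).mapCocone s)

lemma leg_desc (s : Cocone F) (j : J) : leg F d j ≫ desc F hd s = hom (s.ι.app j) := hd.fac _ j

def descB (s : Cocone F) : base F hc ⟶ s.pt.base :=
  (MonColimit.isColimitCocone (F ⋙ (lmodDiagram C).proj) hc).desc ((lmodDiagram C).proj.mapCocone s)

def descX (s : Cocone F) : c.pt ⟶ s.pt.base.X := (descB F hc s).hom

lemma legB_descX (s : Cocone F) (j : J) : legB F c j ≫ descX F hc s = (s.ι.app j).base.hom :=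
  hc.fac _ j

def isColimitCocone : IsColimit (cocone F hc hd) where
  desc s := mk (X := of (module F hc hd)) (descB F hc s) (desc F hd s) (by
    change act F hc hd ≫ desc F hd s = c.pt ◁ desc F hd s ≫ descX F hc s ▷ (mod s.pt).X ≫
      lact (mod s.pt)
    refine ext₂ hc hd fun j ↦ ?_
    rw [reassoc_of% (fac F hc hd j), leg_desc, lact_hom, ← tensorHom_def'_assoc,
      ← tensorHom_def'_assoc, tensorHom_comp_tensorHom_assoc, leg_desc, legB_descX]
    rfl)
  fac s j := hom_ext
    ((MonColimit.isColimitCocone (F ⋙ (lmodDiagram C).proj) hc).fac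
      ((lmodDiagram C).proj.mapCocone s) j) ((hom_comp _ _).trans (leg_desc F hd s j))
  uniq s m h := hom_ext
    ((MonColimit.isColimitCocone (F ⋙ (lmodDiagram C).proj) hc).uniq
      ((lmodDiagram C).proj.mapCocone s) m.base
        fun j ↦ congrArg Pseudofunctor.CoGrothendieck.Hom.base (h j))
    (ext hd fun j ↦ ((hom_comp _ _).symm.trans (congrArg hom (h j))).trans
      (leg_desc F hd s j).symm)

end Colimit

instance [HasColimits C] [∀ X : C, PreservesColimitsOfSize.{v, v} (tensorLeft X)]
    [∀ X : C, PreservesColimitsOfSize.{v, v} (tensorRight X)] :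
    PreservesFilteredColimitsOfSize.{v, v} (forget C) where
  preserves_filtered_colimits J _ _ := by
    have : IsSifted J := IsFiltered.isSifted
    exact ⟨fun {F} ↦ preservesColimit_of_preserves_colimit_cocone
      (Colimit.isColimitCocone F (colimit.isColimit _) (colimit.isColimit (F ⋙ forget C)))
      (IsColimit.ofIsoColimit (colimit.isColimit (F ⋙ forget C))
        (Cocone.ext (Iso.refl _) fun _ ↦ Category.comp_id _))⟩

end TotalL
end TotalL

/-! ### Left modules satisfy the hypotheses of the general construction. -/

section UnderlyingL
variable {C : Type u} [Category.{v} C] [MonoidalCategory C] [SymmetricCategory C]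
  [MonoidalClosed C] [ModelCategory C]

namespace TotalL

/-- The left adjoint sends `X` to the free module on `X` over the initial algebra. -/
lemma isRightAdjoint [HasInitial (Mon C)] : (forget C).IsRightAdjoint := by
  have (X : C) : HasInitial (StructuredArrow X (forget C)) := by
    let Z : (lmodDiagram C).Total := of ((freeL (⊥_ (Mon C))).obj X)
    refine IsInitial.hasInitial (X := StructuredArrow.mk (Y := Z)
      ((adjFreeL (⊥_ (Mon C))).unit.app X : X ⟶ (forget C).obj Z)) ?_
    let κ (s : StructuredArrow X (forget C)) : Z ⟶ s.right :=
      ⟨initial.to _, ((adjFreeL (⊥_ (Mon C))).homEquiv X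
        ((resL (initial.to _)).obj (mod s.right))).symm s.hom⟩
    refine IsInitial.ofUniqueHom (fun s ↦ StructuredArrow.homMk (κ s) ?_) fun s m ↦ ?_
    · exact ((adjFreeL (⊥_ (Mon C))).homEquiv_unit _ _ _).symm.trans
        (((adjFreeL (⊥_ (Mon C))).homEquiv X
          ((resL (initial.to _)).obj (mod s.right))).apply_symm_apply s.hom)
    · refine StructuredArrow.ext _ _ ?_
      obtain ⟨φ, hφ⟩ : ∃ φ : Z ⟶ s.right, φ = m.right := ⟨_, rfl⟩
      have hφ' : (adjFreeL (⊥_ (Mon C))).unit.app X ≫ hom φ = s.hom := by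
        rw [hφ]; exact StructuredArrow.w m
      change m.right = κ s
      rw [← hφ]
      obtain ⟨f, g⟩ := φ
      obtain rfl : f = initial.to _ := initialIsInitial.hom_ext f _
      refine congrArg (Pseudofunctor.CoGrothendieck.Hom.mk (X := Z) (Y := s.right) (initial.to _)) ?_
      refine (((adjFreeL (⊥_ (Mon C))).homEquiv X
        ((resL (initial.to _)).obj (mod s.right))).eq_symm_apply).2 ?_
      exact ((adjFreeL (⊥_ (Mon C))).homEquiv_unit _ _ _).trans hφ'
  exact isRightAdjointOfStructuredArrowInitials _

lemma isUnderlying (hC : IsCombinatorial C) (hpp : PushoutProductAxiom C)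
    (hSS : SchwedeShipley C) :
    (lmodDiagram C).IsUnderlying algClasses (forget C) where
  isModel R := lmodClasses_isModel R hC hSS.monoidAxiom
  isIso R S M f := by
    change IsIso (𝟙 (TotalL.mod (TotalL.of M)).X)
    infer_instance
  cocartesian R S M f := cocartesian M f
  cocart_adjoint X Y φ := cocart_adjoint φ
  cocart_naturality R S f M N g := cocart_naturality f g
  weq_iff R M N g := (incl_iff (weakEquivalences C) g).symm
  fib_iff R M N g := (incl_iff (fibrations C) g).symm
  cof_eq R := rfl
  fib_fiber_iff X Y φ := Iff.rfl
  weq_of_cofibrant R S M f hf hM := by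
    refine (cocart_iff (weakEquivalences C) M f).2 ((unitL_weq_iff f M).2 ?_)
    -- Flatness of `M` is applied to `f` itself, seen as a weak equivalence of right `R`-modules.
    exact hSS.flat_left R M hM (hRight f) hf
  weq_of_trivial_cof R S M f hf hf' := by
    have := hC.hasColimits
    refine (cocart_iff (weakEquivalences C) M f).2 ?_
    exact hSS.monoidAxiom _ (unitL_mem_of_trivialCof hC hpp
      (fun _ _ p hp ↦ (algClasses_isModel hC hpp hSS.monoidAxiom).lift_trivial_cof f p hf hf' hp) M)

end TotalL
end UnderlyingL

/-! ### Pairs of an algebra and a right module. -/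

section TotalR
variable {C : Type u} [Category.{v} C] [MonoidalCategory C] [ModelCategory C]
  [∀ X : C, PreservesColimitsOfSize.{0, 0} (tensorLeft X)]
  [∀ X : C, PreservesColimitsOfSize.{0, 0} (tensorRight X)]

namespace TotalR

/-- The right module underlying a pair `(R, M)`. -/
def mod (X : (rmodDiagram C).Total) : RMod X.base := X.fiber

/-- The pair `(R, M)`. -/
def of {R : Mon C} (M : RMod R) : (rmodDiagram C).Total := ⟨R, M⟩

/-- The map of underlying objects of a map of pairs. -/
def hom {X Y : (rmodDiagram C).Total} (φ : X ⟶ Y) : (mod X).X ⟶ (mod Y).X :=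
  RMod.Hom.hom (M := mod X) (N := (resR φ.base).obj (mod Y)) φ.fiber

variable (C) in
/-- The functor `(R, M) ↦ M` to the ambient category. -/
def forget : (rmodDiagram C).Total ⥤ C where
  obj X := (mod X).X
  map φ := hom φ
  map_id X := rfl
  map_comp {X Y Z} φ ψ := by
    change hom φ ≫ hom ψ ≫ 𝟙 _ = hom φ ≫ hom ψ
    rw [Category.comp_id]

lemma hom_comp {X Y Z : (rmodDiagram C).Total} (φ : X ⟶ Y) (ψ : Y ⟶ Z) :
    hom (φ ≫ ψ) = hom φ ≫ hom ψ := (forget C).map_comp φ ψ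

lemma act_hom {X Y : (rmodDiagram C).Total} (φ : X ⟶ Y) :
    (mod X).act ≫ hom φ = hom φ ▷ X.base.X ≫ (mod Y).X ◁ φ.base.hom ≫ (mod Y).act :=
  RMod.Hom.act_hom (M := mod X) (N := (resR φ.base).obj (mod Y)) φ.fiber

/-- Maps of pairs from semilinear maps. -/
def mk {X Y : (rmodDiagram C).Total} (f : X.base ⟶ Y.base) (t : (mod X).X ⟶ (mod Y).X)
    (ht : (mod X).act ≫ t = t ▷ X.base.X ≫ (mod Y).X ◁ f.hom ≫ (mod Y).act) : X ⟶ Y where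
  base := f
  fiber := RMod.Hom.mk (M := mod X) (N := (resR f).obj (mod Y)) t ht

lemma hom_ext {X Y : (rmodDiagram C).Total} {φ ψ : X ⟶ Y} (h : φ.base = ψ.base)
    (h' : hom φ = hom ψ) : φ = ψ := by
  obtain ⟨f, g⟩ := φ
  obtain ⟨f', g'⟩ := ψ
  obtain rfl : f = f' := h
  obtain rfl : g = g' := RMod.hom_ext (M := mod X) (N := (resR f).obj (mod Y)) _ _ h'
  rfl

lemma base_eq {X Y : (rmodDiagram C).Total} (f : X.base ⟶ Y.base) (φ : X ⟶ Y)
    (h : (rmodDiagram C).proj.IsHomLift f φ) : φ.base = f :=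
  (@IsHomLift.eq_of_isHomLift _ _ _ _ (rmodDiagram C).proj _ _ f φ h).symm

lemma hom_incl {R : Mon C} {M N : RMod R} (g : M ⟶ N) :
    hom (((rmodDiagram C).incl R).map g) = g.hom := Category.comp_id _

lemma hom_cocart {R S : Mon C} (M : RMod R) (f : R ⟶ S) :
    hom ((rmodDiagram C).cocart M f) = unitR f M := unitR_eq f M

lemma incl_iff (P : MorphismProperty C) {R : Mon C} {M N : RMod R} (g : M ⟶ N) :
    P (hom (((rmodDiagram C).incl R).map g)) ↔ P g.hom := by
  have h : P (hom (((rmodDiagram C).incl R).map g)) = P g.hom := congrArg (P ·) (hom_incl g)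
  exact iff_of_eq h

lemma cocart_iff (P : MorphismProperty C) {R S : Mon C} (M : RMod R) (f : R ⟶ S) :
    P (hom ((rmodDiagram C).cocart M f)) ↔ P (unitR f M) := by
  have h : P (hom ((rmodDiagram C).cocart M f)) = P (unitR f M) := congrArg (P ·) (hom_cocart M f)
  exact iff_of_eq h

lemma cocartesian {R S : Mon C} (M : RMod R) (f : R ⟶ S) :
    (rmodDiagram C).proj.IsStronglyCocartesian f ((rmodDiagram C).cocart M f) where
  toIsHomLift := .map (((rmodDiagram C).cocart M f))
  universal_property' {Z} g φ' hφ' := by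
    have hb : φ'.base = f ≫ g := base_eq (X := of M) (f ≫ g) φ' hφ'
    have ht : M.act ≫ hom φ' = hom φ' ▷ R.X ≫ (mod Z).X ◁ f.hom ≫ (mod Z).X ◁ g.hom ≫
        (mod Z).act := by
      have := act_hom φ'
      rw [hb] at this
      refine this.trans ?_
      exact congrArg (hom φ' ▷ R.X ≫ ·) (MonoidalCategory.whiskerLeft_comp_assoc _ f.hom g.hom _)
    obtain ⟨H, hH, hH'⟩ := exists_extRX_desc (f := f) (O := M) ((resR g).obj (mod Z)) (hom φ') ht
    refine ⟨mk (X := of ((extR f).obj M)) g H hH, ⟨.map (mk (X := of ((extR f).obj M)) g H hH), ?_⟩, ?_⟩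
    · refine hom_ext hb.symm ?_
      refine (hom_comp _ _).trans ?_
      rw [hom_cocart]
      exact hH'
    · rintro χ ⟨hχ, hχ'⟩
      obtain rfl : χ.base = g := base_eq (X := of ((extR f).obj M)) g χ hχ
      refine hom_ext rfl (extRX_lin_ext (f := f) (O := M) ((resR χ.base).obj (mod Z)) (act_hom χ) hH ?_)
      refine Eq.trans ?_ hH'.symm
      have := congrArg hom hχ'
      rw [hom_comp, hom_cocart] at this
      exact this

lemma cocart_adjoint {X Y : (rmodDiagram C).Total} (φ : X ⟶ Y) :
    (rmodDiagram C).cocart X.fiber φ.base ≫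
      ((rmodDiagram C).incl Y.base).map ((rmodDiagram C).adjoint φ) = φ := by
  refine hom_ext (Category.comp_id _) ?_
  refine (hom_comp _ _).trans ((congrArg (_ ≫ ·) (hom_incl _)).trans ?_)
  have := ((rmodDiagram C).adj φ.base).homEquiv_unit (f := (rmodDiagram C).adjoint φ)
  have h := this.symm.trans
    ((((rmodDiagram C).adj φ.base).homEquiv X.fiber Y.fiber).apply_symm_apply φ.fiber)
  exact congrArg RMod.Hom.hom h

lemma cocart_naturality {R S : Mon C} (f : R ⟶ S) {M N : RMod R} (g : M ⟶ N) :
    (rmodDiagram C).cocart M f ≫ ((rmodDiagram C).incl S).map ((extR f).map g) =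
      ((rmodDiagram C).incl R).map g ≫ (rmodDiagram C).cocart N f := by
  refine hom_ext ((Category.comp_id f).trans (Category.id_comp f).symm) ?_
  refine ((hom_comp _ _).trans (congrArg (_ ≫ ·) (hom_incl _))).trans
    (Eq.trans ?_ ((hom_comp _ _).trans (congrArg (· ≫ _) (hom_incl _))).symm)
  exact congrArg RMod.Hom.hom ((adjR f).unit.naturality g).symm

/-! Filtered colimits of pairs are computed in the ambient category. -/

namespace Colimit
variable {J : Type u₁} [Category.{v₁} J] [IsSifted J]
  [∀ X : C, PreservesColimitsOfShape J (tensorLeft X)]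
  [∀ X : C, PreservesColimitsOfShape J (tensorRight X)]
  (F : J ⥤ (rmodDiagram C).Total) {c : Cocone ((F ⋙ (rmodDiagram C).proj) ⋙ Mon.forget C)}
  (hc : IsColimit c) {d : Cocone (F ⋙ forget C)} (hd : IsColimit d)

variable (c) in
def legB (j : J) : (F.obj j).base.X ⟶ c.pt := c.ι.app j

variable (d) in
def leg (j : J) : (mod (F.obj j)).X ⟶ d.pt := d.ι.app j

lemma w {i j : J} (f : i ⟶ j) : hom (F.map f) ≫ leg F d j = leg F d i := d.w f

variable {F} in
include hd in
lemma ext {Z : C} {a b : d.pt ⟶ Z} (h : ∀ j, leg F d j ≫ a = leg F d j ≫ b) : a = b :=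
  hd.hom_ext h

variable {F} in
include hc hd in
lemma ext₂ {Z : C} {a b : d.pt ⊗ c.pt ⟶ Z}
    (h : ∀ j, (leg F d j ⊗ₘ legB F c j) ≫ a = (leg F d j ⊗ₘ legB F c j) ≫ b) : a = b :=
  (isColimitTensor hd hc).hom_ext h

variable {F} in
include hc hd in
lemma ext₃ {Z : C} {a b : (d.pt ⊗ c.pt) ⊗ c.pt ⟶ Z}
    (h : ∀ j, ((leg F d j ⊗ₘ legB F c j) ⊗ₘ legB F c j) ≫ a =
      ((leg F d j ⊗ₘ legB F c j) ⊗ₘ legB F c j) ≫ b) : a = b :=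
  (isColimitTensor (isColimitTensor hd hc) hc).hom_ext h

def act : d.pt ⊗ c.pt ⟶ d.pt :=
  (isColimitTensor hd hc).desc (Cocone.mk d.pt
    { app j := (mod (F.obj j)).act ≫ leg F d j
      naturality i j f := by
        refine Eq.trans ?_ (Category.comp_id _).symm
        change (hom (F.map f) ⊗ₘ (F.map f).base.hom) ≫ (mod (F.obj j)).act ≫ leg F d j =
          (mod (F.obj i)).act ≫ leg F d i
        rw [← w F f, reassoc_of% (act_hom (F.map f)), MonoidalCategory.tensorHom_def, Category.assoc] })

lemma fac (j : J) : (leg F d j ⊗ₘ legB F c j) ≫ act F hc hd =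
    (mod (F.obj j)).act ≫ leg F d j :=
  (isColimitTensor hd hc).fac (Cocone.mk d.pt _) j

def base : Mon C := MonColimit.pt (F ⋙ (rmodDiagram C).proj) hc

def module : RMod (base F hc) where
  X := d.pt
  act := act F hc hd
  act_one := by
    change d.pt ◁ MonColimit.one (F ⋙ (rmodDiagram C).proj) c ≫ act F hc hd = (ρ_ d.pt).hom
    rw [← cancel_epi (ρ_ d.pt).inv]
    refine ext hd fun j ↦ ?_
    have h : MonColimit.one (F ⋙ (rmodDiagram C).proj) c = η[(F.obj j).base.X] ≫ legB F c j :=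
      MonColimit.one_eq (F ⋙ (rmodDiagram C).proj) j
    rw [rightUnitor_inv_naturality_assoc, ← whisker_exchange_assoc, h,
      MonoidalCategory.whiskerLeft_comp_assoc, ← tensorHom_def'_assoc, fac]
    simp
  act_mul := by
    change d.pt ◁ MonColimit.mul (F ⋙ (rmodDiagram C).proj) hc ≫ act F hc hd =
      (α_ d.pt c.pt c.pt).inv ≫ act F hc hd ▷ c.pt ≫ act F hc hd
    rw [← cancel_epi (α_ d.pt c.pt c.pt).hom]
    refine ext₃ hc hd fun j ↦ ?_
    have h := fac F hc hd j
    have h' : (legB F c j ⊗ₘ legB F c j) ≫ MonColimit.mul (F ⋙ (rmodDiagram C).proj) hc =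
      μ[(F.obj j).base.X] ≫ legB F c j := MonColimit.fac (F ⋙ (rmodDiagram C).proj) hc j
    have h₁ : leg F d j ⊗ₘ μ[(F.obj j).base.X] ≫ legB F c j =
      (mod (F.obj j)).X ◁ μ[(F.obj j).base.X] ≫ (leg F d j ⊗ₘ legB F c j) := by
      simp [tensorHom_def']
    have h₂ : (mod (F.obj j)).act ≫ leg F d j ⊗ₘ legB F c j =
      (mod (F.obj j)).act ▷ (F.obj j).base.X ≫ (leg F d j ⊗ₘ legB F c j) := by
      simp [MonoidalCategory.tensorHom_def]
    rw [Iso.hom_inv_id_assoc, associator_naturality_assoc, ← tensorHom_id, ← id_tensorHom,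
      tensorHom_comp_tensorHom_assoc, tensorHom_comp_tensorHom_assoc, h, h', Category.comp_id,
      Category.comp_id, h₁, h₂, Category.assoc, Category.assoc, h, RMod.act_mul_assoc,
      Iso.hom_inv_id_assoc]

/-- The cocone of pairs on a filtered colimit. -/
def cocone : Cocone F :=
  Cocone.mk (of (module F hc hd))
    { app j := mk (X := F.obj j) (Y := of (module F hc hd))
        ((MonColimit.cocone (F ⋙ (rmodDiagram C).proj) hc).ι.app j) (leg F d j) (by
          refine (fac F hc hd j).symm.trans ?_
          rw [MonoidalCategory.tensorHom_def, Category.assoc]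
          rfl)
      naturality i j f := by
        refine Eq.trans ?_ (Category.comp_id _).symm
        exact hom_ext ((MonColimit.cocone (F ⋙ (rmodDiagram C).proj) hc).w f)
          ((hom_comp _ _).trans (w F f)) }

def desc (s : Cocone F) : d.pt ⟶ (mod s.pt).X := hd.desc ((forget C).mapCocone s)

lemma leg_desc (s : Cocone F) (j : J) : leg F d j ≫ desc F hd s = hom (s.ι.app j) := hd.fac _ j

def descB (s : Cocone F) : base F hc ⟶ s.pt.base :=
  (MonColimit.isColimitCocone (F ⋙ (rmodDiagram C).proj) hc).desc ((rmodDiagram C).proj.mapCocone s)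

def descX (s : Cocone F) : c.pt ⟶ s.pt.base.X := (descB F hc s).hom

lemma legB_descX (s : Cocone F) (j : J) : legB F c j ≫ descX F hc s = (s.ι.app j).base.hom :=
  hc.fac _ j

def isColimitCocone : IsColimit (cocone F hc hd) where
  desc s := mk (X := of (module F hc hd)) (descB F hc s) (desc F hd s) (by
    change act F hc hd ≫ desc F hd s = desc F hd s ▷ c.pt ≫ (mod s.pt).X ◁ descX F hc s ≫
      (mod s.pt).act
    refine ext₂ hc hd fun j ↦ ?_
    rw [reassoc_of% (fac F hc hd j), leg_desc, act_hom, ← tensorHom_def_assoc,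
      ← tensorHom_def_assoc, tensorHom_comp_tensorHom_assoc, leg_desc, legB_descX]
    rfl)
  fac s j := hom_ext
    ((MonColimit.isColimitCocone (F ⋙ (rmodDiagram C).proj) hc).fac
      ((rmodDiagram C).proj.mapCocone s) j) ((hom_comp _ _).trans (leg_desc F hd s j))
  uniq s m h := hom_ext
    ((MonColimit.isColimitCocone (F ⋙ (rmodDiagram C).proj) hc).uniq
      ((rmodDiagram C).proj.mapCocone s) m.base
        fun j ↦ congrArg Pseudofunctor.CoGrothendieck.Hom.base (h j))
    (ext hd fun j ↦ ((hom_comp _ _).symm.trans (congrArg hom (h j))).trans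
      (leg_desc F hd s j).symm)

end Colimit

instance [HasColimits C] [∀ X : C, PreservesColimitsOfSize.{v, v} (tensorLeft X)]
    [∀ X : C, PreservesColimitsOfSize.{v, v} (tensorRight X)] :
    PreservesFilteredColimitsOfSize.{v, v} (forget C) where
  preserves_filtered_colimits J _ _ := by
    have : IsSifted J := IsFiltered.isSifted
    exact ⟨fun {F} ↦ preservesColimit_of_preserves_colimit_cocone
      (Colimit.isColimitCocone F (colimit.isColimit _) (colimit.isColimit (F ⋙ forget C)))
      (IsColimit.ofIsoColimit (colimit.isColimit (F ⋙ forget C))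
        (Cocone.ext (Iso.refl _) fun _ ↦ Category.comp_id _))⟩

end TotalR
end TotalR

/-! ### Right modules satisfy the hypotheses of the general construction. -/

section UnderlyingR
variable {C : Type u} [Category.{v} C] [MonoidalCategory C] [SymmetricCategory C]
  [MonoidalClosed C] [ModelCategory C]

namespace TotalR

lemma isRightAdjoint [HasInitial (Mon C)] : (forget C).IsRightAdjoint := by
  have (X : C) : HasInitial (StructuredArrow X (forget C)) := by
    let Z : (rmodDiagram C).Total := of ((RMod.free (⊥_ (Mon C))).obj X)
    refine IsInitial.hasInitial (X := StructuredArrow.mk (Y := Z)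
      ((RMod.adj (⊥_ (Mon C))).unit.app X : X ⟶ (forget C).obj Z)) ?_
    let κ (s : StructuredArrow X (forget C)) : Z ⟶ s.right :=
      ⟨initial.to _, ((RMod.adj (⊥_ (Mon C))).homEquiv X
        ((resR (initial.to _)).obj (mod s.right))).symm s.hom⟩
    refine IsInitial.ofUniqueHom (fun s ↦ StructuredArrow.homMk (κ s) ?_) fun s m ↦ ?_
    · exact ((RMod.adj (⊥_ (Mon C))).homEquiv_unit _ _ _).symm.trans
        (((RMod.adj (⊥_ (Mon C))).homEquiv X
          ((resR (initial.to _)).obj (mod s.right))).apply_symm_apply s.hom)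
    · refine StructuredArrow.ext _ _ ?_
      obtain ⟨φ, hφ⟩ : ∃ φ : Z ⟶ s.right, φ = m.right := ⟨_, rfl⟩
      have hφ' : (RMod.adj (⊥_ (Mon C))).unit.app X ≫ hom φ = s.hom := by
        rw [hφ]; exact StructuredArrow.w m
      change m.right = κ s
      rw [← hφ]
      obtain ⟨f, g⟩ := φ
      obtain rfl : f = initial.to _ := initialIsInitial.hom_ext f _
      refine congrArg (Pseudofunctor.CoGrothendieck.Hom.mk (X := Z) (Y := s.right) (initial.to _)) ?_
      refine (((RMod.adj (⊥_ (Mon C))).homEquiv X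
        ((resR (initial.to _)).obj (mod s.right))).eq_symm_apply).2 ?_
      exact ((RMod.adj (⊥_ (Mon C))).homEquiv_unit _ _ _).trans hφ'
  exact isRightAdjointOfStructuredArrowInitials _

lemma isUnderlying (hC : IsCombinatorial C) (hpp : PushoutProductAxiom C)
    (hSS : SchwedeShipley C) :
    (rmodDiagram C).IsUnderlying algClasses (forget C) where
  isModel R := rmodClasses_isModel R hC hSS.monoidAxiom
  isIso R S M f := by
    change IsIso (𝟙 (TotalR.mod (TotalR.of M)).X)
    infer_instance
  cocartesian R S M f := cocartesian M f
  cocart_adjoint X Y φ := cocart_adjoint φ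
  cocart_naturality R S f M N g := cocart_naturality f g
  weq_iff R M N g := (incl_iff (weakEquivalences C) g).symm
  fib_iff R M N g := (incl_iff (fibrations C) g).symm
  cof_eq R := rfl
  fib_fiber_iff X Y φ := Iff.rfl
  weq_of_cofibrant R S M f hf hM := by
    refine (cocart_iff (weakEquivalences C) M f).2 ((unitR_weq_iff f M).2 ?_)
    exact hSS.flat_right R M hM (hLeft f) hf
  weq_of_trivial_cof R S M f hf hf' := by
    have := hC.hasColimits
    refine (cocart_iff (weakEquivalences C) M f).2 ?_
    exact hSS.monoidAxiom _ (unitR_mem_of_trivialCof hC hpp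
      (fun _ _ p hp ↦ (algClasses_isModel hC hpp hSS.monoidAxiom).lift_trivial_cof f p hf hf' hp) M)

end TotalR
end UnderlyingR

end
end ModFib

theorem mainTheorem7 {C : Type u} [Category.{v} C] [MonoidalCategory C] [SymmetricCategory C]
    [MonoidalClosed C] [ModelCategory C]
    (hcomb : ModFib.IsCombinatorial C) (hpp : ModFib.PushoutProductAxiom C)
    (hSS : ModFib.SchwedeShipley C) :
    (ModFib.algClasses (C := C)).IsModel ∧
    (ModFib.lmodDiagram C).IsModelDiagram ∧
    (ModFib.rmodDiagram C).IsModelDiagram ∧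
    (∀ ⦃R S : Mon C⦄ (h : R ⟶ S), ModFib.algClasses.cof h → ModFib.algClasses.weq h →
      ModFib.IsFlatEquivRight (ModFib.hRight h) ∧ ModFib.IsFlatEquivLeft (ModFib.hLeft h)) ∧
    (ModFib.lmodDiagram C).IsProper ModFib.algClasses ∧
    (ModFib.rmodDiagram C).IsProper ModFib.algClasses ∧
    ((ModFib.lmodDiagram C).integral ModFib.algClasses).IsModel ∧
    ModFib.IsModelFibration.{v} (ModFib.lmodDiagram C).proj
      ((ModFib.lmodDiagram C).integral ModFib.algClasses) ModFib.algClasses ∧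
    ((ModFib.rmodDiagram C).integral ModFib.algClasses).IsModel ∧
    ModFib.IsModelFibration.{v} (ModFib.rmodDiagram C).proj
      ((ModFib.rmodDiagram C).integral ModFib.algClasses) ModFib.algClasses := by
  have := hcomb.hasColimits
  have hm := ModFib.algClasses_isModel hcomb hpp hSS.monoidAxiom
  have hL := ModFib.TotalL.isUnderlying hcomb hpp hSS
  have hR := ModFib.TotalR.isUnderlying hcomb hpp hSS
  have := hm.hasColimits
  have : HasInitial (Mon C) :=
    have := hasColimitsOfSizeShrink.{0, 0, v, v} (Mon C)
    inferInstance
  have := ModFib.TotalL.isRightAdjoint (C := C)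
  have := ModFib.TotalR.isRightAdjoint (C := C)
  have adj := ModFib.FreeMon.adj C
  -- Restriction of scalars keeps the underlying map, so its preservation of fibrations and weak
  -- equivalences, and right properness, hold by definition.
  refine ⟨hm, hL.isModelDiagram (fun _ _ _ _ _ _ h ↦ h) (fun _ _ _ _ _ _ h ↦ h),
    hR.isModelDiagram (fun _ _ _ _ _ _ h ↦ h) (fun _ _ _ _ _ _ h ↦ h),
    fun R S f hf hf' ↦ ⟨fun O ↦ ?_, fun O ↦ ?_⟩,
    ⟨hL.isLeftProper, fun _ _ _ _ _ _ _ _ h ↦ h⟩, ⟨hR.isLeftProper, fun _ _ _ _ _ _ _ _ h ↦ h⟩,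
    hL.integral_isModel hcomb hm adj, hL.isModelFibration ModFib.ModelClasses.isPreModel_transfer,
    hR.integral_isModel hcomb hm adj, hR.isModelFibration ModFib.ModelClasses.isPreModel_transfer⟩
  · exact (ModFib.unitL_weq_iff f O).1
      ((ModFib.TotalL.cocart_iff _ O f).1 (hL.weq_of_trivial_cof O f hf hf'))
  · exact (ModFib.unitR_weq_iff f O).1
      ((ModFib.TotalR.cocart_iff _ O f).1 (hR.weq_of_trivial_cof O f hf hf'))
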